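/- Let $X_1,X_2,\dots$ be i.i.d. $\mathcal N(0,1)$ (the null hypothesis), let $\phi>1$ and $\sigma^2>0$. For a sample $x=(x_1,\dots,x_n)$ consider the alternative model $(1-a)\,\mathcal N(0,1)+a\,\mathcal N(b,1)$ with parameter $w=(a,b)\in(0,1)\times\mathbb R$ and prior $\varphi_1(a,b)=\frac{\Gamma(2\phi)}{\Gamma(\phi)^2}a^{\phi-1}(1-a)^{\phi-1}\cdot\frac1{\sqrt{2\pi\sigma^2}}e^{-b^2/(2\sigma^2)}$, and with labels $y\in\{0,1\}^n$ the joint density $$p(w,y,x)=\varphi_1(w)\prod_{i:\,y_i=0}(1-a)\tfrac{1}{\sqrt{2\pi}}e^{-x_i^2/2}\prod_{i:\,y_i=1}a\,\tfrac{1}{\sqrt{2\pi}}e^{-(x_i-b)^2/2}.$$ The variational free energy is $$F=\inf_{q,r}\ \int dw\sum_{y}q(y)r(w)\log\frac{q(y)r(w)}{p(w,y,x)},$$ the infimum over probability mass functions $q$ on $\{0,1\}^n$ and probability densities $r$ on $(0,1)\times\mathbb R$; $F(\alpha)$ denotes the same infimum restricted to those $q$ with $n_1:=\sum_i q(y_i=1)=\alpha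 n$. The free energy of the null hypothesis is $F_0=\frac12\sum_i x_i^2+\frac n2\log(2\pi)$. Put $\xi_n=n^{-1/2}\sum_{i\le n}X_i$ and $$c(\alpha)=(1-\phi)\log\alpha-\left(\phi-\tfrac12\right)\log(1-\alpha)+\tfrac12\log\sigma^2-\log\frac{\Gamma(2\phi)}{\Gamma(\phi)^2}-\tfrac12\log 2\pi .$$ **Theorem 3.** For the sample $X_1,\dots,X_n$, as $n\to\infty$: 1. $\xi_n\sim\mathcal N(0,1)$ for every $n\ge1$, and $$F-F_0=\log n-(\phi-1)\log(\phi-1)-\left(\phi-\tfrac12\right)\log\left(\phi-\tfrac12\right)+\left(2\phi-\tfrac32\right)\log\left(2\phi-\tfrac32\right)+\tfrac12\log\sigma^2-\tfrac12\xi_n^2-\log\frac{\Gamma(2\phi)}{\Gamma(\phi)^2}-\tfrac12\log2\pi+o_p(1).$$ 2. For every fixed $\alpha\in(0,1)$, $F(\alpha)-F_0=\log n+c(\alpha)-\frac12\xi_n^2+o_p(1)$. On $(0,1)$ the function $c$ has the unique minimizer $\alpha_0=\frac{\phi-1}{2\phi-3/2}$, and $c(\alpha_0)$ is the constant $C$ that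 stands in part 1 (the right-hand side there without $\log n$, $-\frac12\xi_n^2$ and $o_p(1)$). 3. Minimizing pairs $(q,r)$ exist for every sample. Uniformly over all minimizing pairs, $n_1/n\to\alpha_0$ in probability and $\sqrt{\log n}\,\int b\,r(w)\,dw\to0$ in probability. 4. $-2\,(F-F_0-\log n-C)$ converges in distribution to $\chi^2_1$, the law of $\xi^2$ with $\xi\sim\mathcal N(0,1)$. -/

import Mathlib

open MeasureTheory ProbabilityTheory Filter Topology
open scoped ENNReal NNReal

namespace MixVB

noncomputable section

/-! ### The two-component model -/

/-- Density of `(1 - a) N(0,1) + a N(b,1)` at `x`, where `w = (a, b)`. -/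
def mixtureDensity (w : ℝ × ℝ) (x : ℝ) : ℝ :=
  (1 - w.1) * gaussianPDFReal 0 1 x + w.1 * gaussianPDFReal w.2 1 x

/-- Weight of the component `k`: `1 - a` for `k = 0` and `a` for `k = 1`. -/
def weight (a : ℝ) (k : Fin 2) : ℝ := if k = 1 then a else 1 - a

/-- Mean of the component `k`: `0` for `k = 0` and `b` for `k = 1`. -/
def center (b : ℝ) (k : Fin 2) : ℝ := if k = 1 then b else 0

/-- Prior density of `w = (a, b)` under the alternative: `a` has the symmetric Dirichlet (Beta)
density with hyperparameter `φ`, and, independently, `b` is centred Gaussian with variance `v`. -/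
def prior (φ : ℝ) (v : ℝ≥0) (w : ℝ × ℝ) : ℝ :=
  betaPDFReal φ φ w.1 * gaussianPDFReal 0 v w.2

/-- Joint density `p(w, y, x)` of the parameter, the labels and the sample. -/
def joint (φ : ℝ) (v : ℝ≥0) {n : ℕ} (x : Fin n → ℝ) (y : Fin n → Fin 2) (w : ℝ × ℝ) : ℝ :=
  (∏ i, weight w.1 (y i) * gaussianPDFReal (center w.2 (y i)) 1 (x i)) * prior φ v w

/-! ### The variational problem -/

/-- `q` is a probability mass function on label configurations. -/
def IsLabelLaw {n : ℕ} (q : (Fin n → Fin 2) → ℝ) : Prop :=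
  (∀ y, 0 ≤ q y) ∧ ∑ y, q y = 1

/-- `r` is a probability density on the parameter space `(0,1) × ℝ`. -/
def IsParamDensity (r : ℝ × ℝ → ℝ) : Prop :=
  Measurable r ∧ (∀ w, 0 ≤ r w) ∧ (∀ w, w.1 ∉ Set.Ioo (0 : ℝ) 1 → r w = 0) ∧
    Integrable r ∧ ∫ w, r w = 1

/-- The integrand `∑_y q(y) r(w) log (q(y) r(w) / p(w, y, x))` of the divergence. -/
def divIntegrand (φ : ℝ) (v : ℝ≥0) {n : ℕ} (x : Fin n → ℝ) (q : (Fin n → Fin 2) → ℝ)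
    (r : ℝ × ℝ → ℝ) (w : ℝ × ℝ) : ℝ :=
  ∑ y, q y * r w * Real.log (q y * r w / joint φ v x y w)

/-- The Kullback–Leibler functional `D(q r ‖ p)`, with values that are meaningful for pairs in
`Admissible`. -/
def divergence (φ : ℝ) (v : ℝ≥0) {n : ℕ} (x : Fin n → ℝ) (q : (Fin n → Fin 2) → ℝ)
    (r : ℝ × ℝ → ℝ) : ℝ :=
  ∫ w, divIntegrand φ v x q r w

/-- The pairs `(q, r)` over which one minimizes: factorized laws `q(y) r(w)` of finite divergence.
The negative part of the integrand is always integrable, so for the other factorized laws the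
divergence is `+∞` and they do not affect the infimum. -/
def Admissible (φ : ℝ) (v : ℝ≥0) {n : ℕ} (x : Fin n → ℝ) (q : (Fin n → Fin 2) → ℝ)
    (r : ℝ × ℝ → ℝ) : Prop :=
  IsLabelLaw q ∧ IsParamDensity r ∧ Integrable (divIntegrand φ v x q r)

/-- The variational free energy `F`: the infimum of the divergence over factorized laws. -/
def freeEnergy (φ : ℝ) (v : ℝ≥0) {n : ℕ} (x : Fin n → ℝ) : ℝ :=
  sInf {d | ∃ q r, Admissible φ v x q r ∧ d = divergence φ v x q r}

/-- `(q, r)` is an optimal factorized law (a variational posterior). -/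
def IsOptimal (φ : ℝ) (v : ℝ≥0) {n : ℕ} (x : Fin n → ℝ) (q : (Fin n → Fin 2) → ℝ)
    (r : ℝ × ℝ → ℝ) : Prop :=
  Admissible φ v x q r ∧ ∀ q' r', Admissible φ v x q' r' →
    divergence φ v x q r ≤ divergence φ v x q' r'

/-- The expected number `n₁ = ∑ᵢ E_q[y_{i1}]` of sample points with label `1`. -/
def expectedCount {n : ℕ} (q : (Fin n → Fin 2) → ℝ) : ℝ :=
  ∑ i, ∑ y, q y * (if y i = 1 then 1 else 0)

/-- The free energy `F(α)` at mixing fraction `α`: the infimum of the divergence over the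
factorized laws with `n₁ = α n`. -/
def freeEnergyAt (φ : ℝ) (v : ℝ≥0) {n : ℕ} (x : Fin n → ℝ) (α : ℝ) : ℝ :=
  sInf {d | ∃ q r, Admissible φ v x q r ∧ expectedCount q = α * n ∧ d = divergence φ v x q r}

/-- The mean `⟨b⟩` of the second coordinate under the density `r`. -/
def meanB (r : ℝ × ℝ → ℝ) : ℝ := ∫ w, w.2 * r w

/-- The free energy `F₀` of the null hypothesis, whose prior is the point mass at
`(a, b) = (0, 0)`. -/
def nullFreeEnergy {n : ℕ} (x : Fin n → ℝ) : ℝ :=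
  -Real.log (∫ w, ∏ i, mixtureDensity w (x i) ∂(Measure.dirac ((0, 0) : ℝ × ℝ)))

/-! ### The terms of the expansion -/

/-- The non-random constant term of the expansion at mixing fraction `α`. -/
def profileConst (φ : ℝ) (v : ℝ≥0) (α : ℝ) : ℝ :=
  (1 - φ) * Real.log α - (φ - 1 / 2) * Real.log (1 - α) + 1 / 2 * Real.log v
    - Real.log (Real.Gamma (2 * φ) / Real.Gamma φ ^ 2) - 1 / 2 * Real.log (2 * Real.pi)

/-- The non-random constant term of the expansion of the minimum. -/
def limitConst (φ : ℝ) (v : ℝ≥0) : ℝ :=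
  -(φ - 1) * Real.log (φ - 1) - (φ - 1 / 2) * Real.log (φ - 1 / 2)
    + (2 * φ - 3 / 2) * Real.log (2 * φ - 3 / 2) + 1 / 2 * Real.log v
    - Real.log (Real.Gamma (2 * φ) / Real.Gamma φ ^ 2) - 1 / 2 * Real.log (2 * Real.pi)

/-- The optimal mixing fraction. -/
def optFraction (φ : ℝ) : ℝ := (φ - 1) / (2 * φ - 3 / 2)

/-- The first `n` terms of a sequence of observations. -/
def sample {Ω : Type*} (X : ℕ → Ω → ℝ) (n : ℕ) (ω : Ω) : Fin n → ℝ := fun i => X i ω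

/-- The standardized sum `ξ_n = n^{-1/2} ∑ X_i`. -/
def xi {Ω : Type*} (X : ℕ → Ω → ℝ) (n : ℕ) (ω : Ω) : ℝ :=
  (∑ i ∈ Finset.range n, X i ω) / Real.sqrt n

/-- The test statistic `F - F₀` computed from the first `n` observations. -/
def stat (φ : ℝ) (v : ℝ≥0) {Ω : Type*} (X : ℕ → Ω → ℝ) (n : ℕ) (ω : Ω) : ℝ :=
  freeEnergy φ v (sample X n ω) - nullFreeEnergy (sample X n ω)

end

end MixVB

/-! The variational problem collapses to a finite-dimensional one. Under a label law `q` the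
expected log joint density depends on `q` only through its marginals `m i`, via `N = ∑ m i` and `S =
∑ x i * m i`, and by conjugacy it is, up to a constant, the log density of a Beta law times a
Gaussian law. Gibbs' inequality therefore determines the optimal `r`. For given marginals the
product law has the largest entropy. Hence `F - F₀` is the minimum of `labelEnergy` over the cube
`[0,1]^n`, attained by compactness (`freeEnergy_eq`), and `F(α)` is handled on the slice `N = α n`.

Lower bound. Linearize the square `S ^ 2` at the posterior mean `β` of `b` and apply Gibbs'
inequality to each label: the energy of `m` is at least `profileEnergy α - L(α, β) + β ^ 2 / (2 v)`,
where `L(a, s)` is the log likelihood ratio of the mixture `(1-a) N(0,1) + a N(s,1)` against the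
null (`profileEnergy_sub_logRatio_le`). Stirling's formula gives `profileEnergy = log n + c(α) +
o(1)` on compact subsets of `(0,1)`, together with a bound on all of `[0,1]` carrying the penalty
`(φ - 1) log (n / (α n + 1))`. What remains is an upper bound of `L`, on three scales: - for `|s| ≤
K / √n`, Taylor expansion gives `L ≤ ξ ^ 2 / 2 + o(1)` uniformly in `a`; - for `|s| ≥ K / √n` and
fixed `a`, `L` lies below any prescribed level with high probability, once `K` is large; - uniformly
in `a` and `s`, `L ≤ K + η log (n / (a n + 1))` for any small `η > 0`. Since `φ > 1`, some `η < φ -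
1` is available; the penalty then dominates and keeps the mixing fraction of near minimizers away
from `0` and `1`.

The last two rest on a maximal inequality for `exp (3 L / 4)` in `s`. The exponent `3/4`
interpolates between `1/2`, where the Hellinger deficit `h` gives the mean `(1 - h) ^ n`, and `1`,
where the mean of `exp L` times the squared score is `n` times a Fisher information. Cauchy–Schwarz
bounds the mean derivative by `√(n I) exp (-n h / 2)`, which is integrated over `s`. A dyadic net in
`a` gives uniformity in the mixing fraction.

Upper bound. Tilt the constant labels `a` slightly along the data (`tiltedLabels`). The entropy cost
is `ξ ^ 2 (1 - a) / (2 a)` and the gain `ξ ^ 2 / (2 a)`, so the net change is `-ξ ^ 2 / 2` for every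
`a`.

All of this is collected in `RegularAt`, which holds with probability close to one. Up to a factor,
`c(α) - c(α₀)` is a Bernoulli relative entropy, so `α₀` is the unique minimizer. The mean of `b` is
the shift `β`, of order `n ^ (-1/2)`; and since `ξ_n ^ 2` has exactly the chi-square law, Slutsky's
theorem yields the null distribution. -/

open MeasureTheory ProbabilityTheory Filter Topology
open scoped ENNReal NNReal

namespace MixVB

noncomputable section

/-! ### Reduction of the variational problem to a function of the label marginals -/

/-- The marginal probability of the label `1` at the index `i`. -/
def marginal {n : ℕ} (q : (Fin n → Fin 2) → ℝ) (i : Fin n) : ℝ :=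
  ∑ y, q y * (if y i = 1 then 1 else 0)

lemma expectedCount_eq {n : ℕ} (q : (Fin n → Fin 2) → ℝ) :
    expectedCount q = ∑ i, marginal q i := rfl

/-- The part of the free energy which depends on the expected count `N` only, apart from the
label entropy. -/
def countEnergy (φ : ℝ) (v : ℝ≥0) (n N : ℝ) : ℝ :=
  Real.log (beta φ φ) - Real.log (beta (N + φ) (n - N + φ)) + 1 / 2 * Real.log (1 + v * N)

/-- The optimal posterior variance of `b`. -/
def postVar (v : ℝ≥0) (N : ℝ) : ℝ≥0 := Real.toNNReal (v / (1 + v * N))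

/-- The excess free energy of the label marginals `m`, after optimizing over the parameter law. -/
def labelEnergy (φ : ℝ) (v : ℝ≥0) {n : ℕ} (x m : Fin n → ℝ) : ℝ :=
  -∑ i, Real.binEntropy (m i) + countEnergy φ v n (∑ i, m i)
    - v / (1 + v * ∑ i, m i) * (∑ i, x i * m i) ^ 2 / 2

/-- The optimal parameter law for label marginals with sum `N` and weighted data sum `S`. -/
def postDensity (φ : ℝ) (v : ℝ≥0) (n N S : ℝ) (w : ℝ × ℝ) : ℝ :=
  betaPDFReal (N + φ) (n - N + φ) w.1 *
    gaussianPDFReal (v / (1 + v * N) * S) (postVar v N) w.2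

lemma coe_postVar (v : ℝ≥0) {N : ℝ} (hN : 0 ≤ N) : (postVar v N : ℝ) = v / (1 + v * N) := by
  rw [postVar, Real.coe_toNNReal]; positivity

lemma postVar_ne_zero {v : ℝ≥0} (hv : 0 < v) {N : ℝ} (hN : 0 ≤ N) : postVar v N ≠ 0 := by
  have : (0 : ℝ) < postVar v N := by
    rw [coe_postVar v hN]
    have : (0 : ℝ) < v := hv
    positivity
  exact fun h => by simp [h] at this

lemma log_gaussianPDFReal (μ : ℝ) {v : ℝ≥0} (hv : v ≠ 0) (x : ℝ) :
    Real.log (gaussianPDFReal μ v x) =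
      -(1 / 2 * Real.log (2 * Real.pi)) - 1 / 2 * Real.log v - (x - μ) ^ 2 / (2 * v) := by
  have hv' : (0 : ℝ) < v := by positivity
  rw [gaussianPDFReal, Real.log_mul (by positivity) (Real.exp_pos _).ne', Real.log_exp,
    Real.log_inv, Real.log_sqrt (by positivity), Real.log_mul (by positivity) hv'.ne']
  ring

lemma log_betaPDFReal {a b x : ℝ} (ha : 0 < a) (hb : 0 < b) (hx : x ∈ Set.Ioo (0 : ℝ) 1) :
    Real.log (betaPDFReal a b x) =
      (a - 1) * Real.log x + (b - 1) * Real.log (1 - x) - Real.log (beta a b) := by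
  have h1 : 0 < 1 - x := by linarith [hx.2]
  have hB := beta_pos ha hb
  rw [betaPDFReal, if_pos ⟨hx.1, hx.2⟩, Real.log_mul, Real.log_mul, Real.log_rpow hx.1,
    Real.log_rpow h1, one_div, Real.log_inv]
  · ring
  · positivity
  · exact (Real.rpow_pos_of_pos hx.1 _).ne'
  · exact (mul_pos (by positivity) (Real.rpow_pos_of_pos hx.1 _)).ne'
  · exact (Real.rpow_pos_of_pos h1 _).ne'

lemma integrable_betaPDFReal {a b : ℝ} (ha : 0 < a) (hb : 0 < b) :
    Integrable (betaPDFReal a b) ∧ ∫ x, betaPDFReal a b x = 1 := by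
  have h := lintegral_betaPDF_eq_one ha hb
  have hnn : ∀ x, 0 ≤ betaPDFReal a b x := fun x => by
    by_cases hx : 0 < x ∧ x < 1
    · exact (betaPDFReal_pos hx.1 hx.2 ha hb).le
    · simp [betaPDFReal, hx]
  have hm := (measurable_betaPDFReal a b).aestronglyMeasurable (μ := volume)
  refine ⟨⟨hm, ?_⟩, ?_⟩
  · rw [hasFiniteIntegral_iff_ofReal (ae_of_all _ hnn)]
    show ∫⁻ x, betaPDF a b x < ∞
    rw [h]; exact ENNReal.one_lt_top
  · rw [integral_eq_lintegral_of_nonneg_ae (ae_of_all _ hnn) hm]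
    show (∫⁻ x, betaPDF a b x).toReal = 1
    rw [h]; rfl

lemma betaPDFReal_nonneg' {a b : ℝ} (ha : 0 < a) (hb : 0 < b) (x : ℝ) : 0 ≤ betaPDFReal a b x := by
  by_cases hx : 0 < x ∧ x < 1
  · exact (betaPDFReal_pos hx.1 hx.2 ha hb).le
  · simp [betaPDFReal, hx]

/-! ### The conjugate parameter law. -/

section Post
variable {φ : ℝ} {v : ℝ≥0} {n N S : ℝ}

lemma isParamDensity_postDensity (hφ : 0 < φ) (hv : 0 < v) (hN : 0 ≤ N) (hNn : N ≤ n) :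
    IsParamDensity (postDensity φ v n N S) := by
  have ha : 0 < N + φ := by linarith
  have hb : 0 < n - N + φ := by linarith
  have hB := integrable_betaPDFReal ha hb
  refine ⟨?_, ?_, ?_, ?_, ?_⟩
  · exact ((measurable_betaPDFReal _ _).comp measurable_fst).mul
      ((measurable_gaussianPDFReal _ _).comp measurable_snd)
  · exact fun w => mul_nonneg (betaPDFReal_nonneg' ha hb _) (gaussianPDFReal_nonneg _ _ _)
  · intro w hw
    have : ¬ (0 < w.1 ∧ w.1 < 1) := hw
    simp [postDensity, betaPDFReal, this]
  · exact hB.1.mul_prod (integrable_gaussianPDFReal _ _)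
  · have := integral_prod_mul (μ := volume) (ν := volume) (betaPDFReal (N + φ) (n - N + φ))
      (gaussianPDFReal (v / (1 + v * N) * S) (postVar v N))
    rw [hB.2, integral_gaussianPDFReal_eq_one _ (postVar_ne_zero hv hN), one_mul] at this
    exact this

lemma integral_snd_mul_postDensity (hφ : 0 < φ) (hv : 0 < v) (hN : 0 ≤ N) (hNn : N ≤ n) :
    meanB (postDensity φ v n N S) = v / (1 + v * N) * S := by
  have ha : 0 < N + φ := by linarith
  have hb : 0 < n - N + φ := by linarith
  have hB := integrable_betaPDFReal ha hb
  have h0 := postVar_ne_zero hv hN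
  have := integral_prod_mul (μ := volume) (ν := volume) (betaPDFReal (N + φ) (n - N + φ))
      (fun y => gaussianPDFReal (v / (1 + v * N) * S) (postVar v N) y * y)
  have h2 := integral_gaussianReal_eq_integral_smul (μ := v / (1 + v * N) * S) (v := postVar v N)
    (f := fun x : ℝ => x) h0
  rw [integral_id_gaussianReal] at h2
  simp only [smul_eq_mul] at h2
  rw [hB.2, one_mul, ← h2] at this
  rw [meanB, ← this]
  refine integral_congr_ae (ae_of_all _ fun w => ?_)
  simp only [postDensity]; ring

lemma postDensity_pos (hφ : 0 < φ) (hv : 0 < v) (hN : 0 ≤ N) (hNn : N ≤ n) {w : ℝ × ℝ}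
    (hw : w.1 ∈ Set.Ioo (0 : ℝ) 1) : 0 < postDensity φ v n N S w :=
  mul_pos (betaPDFReal_pos hw.1 hw.2 (by linarith) (by linarith))
    (gaussianPDFReal_pos _ _ _ (postVar_ne_zero hv hN))

end Post

lemma nullFreeEnergy_eq {n : ℕ} (x : Fin n → ℝ) :
    nullFreeEnergy x = ∑ i, (1 / 2 * Real.log (2 * Real.pi) + x i ^ 2 / 2) := by
  have : ∀ i, Real.log (gaussianPDFReal 0 1 (x i)) =
      -(1 / 2 * Real.log (2 * Real.pi) + x i ^ 2 / 2) := fun i => by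
    rw [log_gaussianPDFReal _ one_ne_zero]; simp; ring
  rw [nullFreeEnergy, integral_dirac]
  simp only [mixtureDensity, sub_zero, one_mul, zero_mul, add_zero]
  rw [Real.log_prod (fun i _ => (gaussianPDFReal_pos _ _ _ one_ne_zero).ne'),
    Finset.sum_congr rfl (fun i _ => this i), Finset.sum_neg_distrib, neg_neg]

lemma weight_pos {a : ℝ} (ha : a ∈ Set.Ioo (0 : ℝ) 1) (k : Fin 2) : 0 < weight a k := by
  unfold weight; split_ifs
  · exact ha.1
  · linarith [ha.2]

lemma prior_pos {φ : ℝ} (hφ : 0 < φ) {v : ℝ≥0} (hv : 0 < v) {w : ℝ × ℝ}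
    (hw : w.1 ∈ Set.Ioo (0 : ℝ) 1) : 0 < prior φ v w :=
  mul_pos (betaPDFReal_pos hw.1 hw.2 hφ hφ) (gaussianPDFReal_pos _ _ _ hv.ne')

lemma joint_pos {φ : ℝ} (hφ : 0 < φ) {v : ℝ≥0} (hv : 0 < v) {n : ℕ} (x : Fin n → ℝ)
    (y : Fin n → Fin 2) {w : ℝ × ℝ} (hw : w.1 ∈ Set.Ioo (0 : ℝ) 1) : 0 < joint φ v x y w :=
  mul_pos (Finset.prod_pos fun _ _ => mul_pos (weight_pos hw _)
    (gaussianPDFReal_pos _ _ _ one_ne_zero)) (prior_pos hφ hv hw)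

lemma log_prior {φ : ℝ} (hφ : 0 < φ) {v : ℝ≥0} (hv : 0 < v) {w : ℝ × ℝ}
    (hw : w.1 ∈ Set.Ioo (0 : ℝ) 1) : Real.log (prior φ v w) =
      (φ - 1) * (Real.log w.1 + Real.log (1 - w.1)) - Real.log (beta φ φ)
      - 1 / 2 * Real.log (2 * Real.pi) - 1 / 2 * Real.log v - w.2 ^ 2 / (2 * v) := by
  rw [prior, Real.log_mul (betaPDFReal_pos hw.1 hw.2 hφ hφ).ne'
    (gaussianPDFReal_pos _ _ _ hv.ne').ne', log_betaPDFReal hφ hφ hw, log_gaussianPDFReal _ hv.ne']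
  ring

lemma log_joint {φ : ℝ} (hφ : 0 < φ) {v : ℝ≥0} (hv : 0 < v) {n : ℕ} (x : Fin n → ℝ)
    (y : Fin n → Fin 2) {w : ℝ × ℝ} (hw : w.1 ∈ Set.Ioo (0 : ℝ) 1) :
    Real.log (joint φ v x y w) = -nullFreeEnergy x + n * Real.log (1 - w.1)
      + ∑ i, (if y i = 1 then 1 else 0) * (Real.log w.1 - Real.log (1 - w.1) + x i * w.2
        - w.2 ^ 2 / 2) + Real.log (prior φ v w) := by
  rw [joint, Real.log_mul (Finset.prod_pos fun i _ => mul_pos (weight_pos hw _)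
    (gaussianPDFReal_pos _ _ _ one_ne_zero)).ne' (prior_pos hφ hv hw).ne',
    Real.log_prod (fun _ _ => (mul_pos (weight_pos hw _)
    (gaussianPDFReal_pos _ _ _ one_ne_zero)).ne'), nullFreeEnergy_eq]
  congr 1
  have hc : (n : ℝ) * Real.log (1 - w.1) = ∑ _i : Fin n, Real.log (1 - w.1) := by simp
  rw [hc, ← Finset.sum_neg_distrib, ← Finset.sum_add_distrib, ← Finset.sum_add_distrib]
  refine Finset.sum_congr rfl fun i _ => ?_
  rw [Real.log_mul (weight_pos hw _).ne' (gaussianPDFReal_pos _ _ _ one_ne_zero).ne',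
    log_gaussianPDFReal _ one_ne_zero]
  unfold weight center
  split_ifs <;> simp <;> ring

/-- Completing the square in `b` puts the Gaussian terms of prior and likelihood into conjugate
form. The terms free of `w` are the log normalizing constant, and they become the parameter-law part
of `labelEnergy`. -/
lemma log_postDensity {φ : ℝ} {v : ℝ≥0} {n N S : ℝ} (hφ : 0 < φ) (hv : 0 < v) (hN : 0 ≤ N)
    (hNn : N ≤ n) {w : ℝ × ℝ} (hw : w.1 ∈ Set.Ioo (0 : ℝ) 1) :
    Real.log (postDensity φ v n N S w) = Real.log (prior φ v w) + countEnergy φ v n N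
      - v / (1 + v * N) * S ^ 2 / 2 + n * Real.log (1 - w.1)
      + N * (Real.log w.1 - Real.log (1 - w.1) - w.2 ^ 2 / 2) + w.2 * S := by
  have h0 := postVar_ne_zero hv hN
  have hv' : (0 : ℝ) < v := hv
  have h1 : 0 < 1 + v * N := by positivity
  rw [postDensity, Real.log_mul (betaPDFReal_pos hw.1 hw.2 (by linarith) (by linarith)).ne'
    (gaussianPDFReal_pos _ _ _ h0).ne', log_betaPDFReal (by linarith) (by linarith) hw,
    log_gaussianPDFReal _ h0, log_prior hφ hv hw, countEnergy, coe_postVar v hN,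
    Real.log_div hv'.ne' h1.ne']
  have : (w.2 - v / (1 + v * N) * S) ^ 2 / (2 * (v / (1 + v * N))) =
      w.2 ^ 2 / (2 * v) + N * w.2 ^ 2 / 2 - w.2 * S + v / (1 + v * N) * S ^ 2 / 2 := by
    field_simp; ring
  rw [this]; ring

/-! ### Label marginals. -/

section Marginal
variable {n : ℕ} {q : (Fin n → Fin 2) → ℝ}

lemma marginal_nonneg (hq : IsLabelLaw q) (i : Fin n) : 0 ≤ marginal q i :=
  Finset.sum_nonneg fun y _ => mul_nonneg (hq.1 y) (by split_ifs <;> norm_num)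

lemma marginal_le_one (hq : IsLabelLaw q) (i : Fin n) : marginal q i ≤ 1 := by
  rw [← hq.2]
  refine Finset.sum_le_sum fun y _ => ?_
  have := hq.1 y
  split_ifs <;> simp [this]

lemma sum_mul_indicator (c : Fin n → ℝ) :
    ∑ y, q y * ∑ i, (if y i = 1 then 1 else 0) * c i = ∑ i, marginal q i * c i := by
  simp only [marginal, Finset.mul_sum, Finset.sum_mul]
  rw [Finset.sum_comm]
  refine Finset.sum_congr rfl fun i _ => Finset.sum_congr rfl fun y _ => by ring

lemma sum_card_bounds {m : Fin n → ℝ} (hm : ∀ i, m i ∈ Set.Icc (0 : ℝ) 1) :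
    0 ≤ ∑ i, m i ∧ ∑ i, m i ≤ n := by
  refine ⟨Finset.sum_nonneg fun i _ => (hm i).1, ?_⟩
  calc ∑ i, m i ≤ ∑ _i : Fin n, (1 : ℝ) := Finset.sum_le_sum fun i _ => (hm i).2
    _ = n := by simp

end Marginal

/-- The conditional expectation of the log joint density under a label law. -/
lemma sum_mul_log_joint {φ : ℝ} (hφ : 0 < φ) {v : ℝ≥0} (hv : 0 < v) {n : ℕ} (x : Fin n → ℝ)
    {q : (Fin n → Fin 2) → ℝ} (hq : IsLabelLaw q) {w : ℝ × ℝ} (hw : w.1 ∈ Set.Ioo (0 : ℝ) 1) :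
    ∑ y, q y * Real.log (joint φ v x y w) =
      Real.log (postDensity φ v n (∑ i, marginal q i) (∑ i, x i * marginal q i) w)
      - nullFreeEnergy x - countEnergy φ v n (∑ i, marginal q i)
      + v / (1 + v * ∑ i, marginal q i) * (∑ i, x i * marginal q i) ^ 2 / 2 := by
  have hb := sum_card_bounds (m := marginal q) fun i => ⟨marginal_nonneg hq i, marginal_le_one hq i⟩
  rw [log_postDensity hφ hv hb.1 hb.2 hw]
  have h1 : ∀ y, q y * Real.log (joint φ v x y w) =
      q y * (-nullFreeEnergy x + n * Real.log (1 - w.1) + Real.log (prior φ v w)) +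
      q y * ∑ i, (if y i = 1 then 1 else 0) * (Real.log w.1 - Real.log (1 - w.1) + x i * w.2
        - w.2 ^ 2 / 2) := fun y => by rw [log_joint hφ hv x y hw]; ring
  rw [Finset.sum_congr rfl fun y _ => h1 y, Finset.sum_add_distrib, ← Finset.sum_mul, hq.2,
    sum_mul_indicator]
  have h2 : ∑ i, marginal q i * (Real.log w.1 - Real.log (1 - w.1) + x i * w.2 - w.2 ^ 2 / 2) =
      (∑ i, marginal q i) * (Real.log w.1 - Real.log (1 - w.1) - w.2 ^ 2 / 2)
      + w.2 * ∑ i, x i * marginal q i := by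
    rw [Finset.sum_mul, Finset.mul_sum, ← Finset.sum_add_distrib]
    exact Finset.sum_congr rfl fun i _ => by ring
  rw [h2]; ring

/-- The part of the divergence which does not depend on the parameter law. -/
def labelPart (φ : ℝ) (v : ℝ≥0) {n : ℕ} (x : Fin n → ℝ) (q : (Fin n → Fin 2) → ℝ) : ℝ :=
  ∑ y, q y * Real.log (q y) + nullFreeEnergy x + countEnergy φ v n (∑ i, marginal q i)
      - v / (1 + v * ∑ i, marginal q i) * (∑ i, x i * marginal q i) ^ 2 / 2

/-- Averaging the log joint density over `q` gives the log of the conjugate density plus a constant,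
so the divergence is a constant plus a relative entropy of `r`. The logarithms are split only where
`q y` and `r w` are nonzero; elsewhere both sides vanish. -/
lemma divIntegrand_eq {φ : ℝ} (hφ : 0 < φ) {v : ℝ≥0} (hv : 0 < v) {n : ℕ} (x : Fin n → ℝ)
    {q : (Fin n → Fin 2) → ℝ} (hq : IsLabelLaw q) {r : ℝ × ℝ → ℝ} (hr : IsParamDensity r)
    (w : ℝ × ℝ) :
    divIntegrand φ v x q r w = r w * labelPart φ v x q + r w * Real.log (r w /
      postDensity φ v n (∑ i, marginal q i) (∑ i, x i * marginal q i) w) := by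
  by_cases h0 : r w = 0
  · simp [divIntegrand, h0]
  have hw : w.1 ∈ Set.Ioo (0 : ℝ) 1 := by
    by_contra h; exact h0 (hr.2.2.1 w h)
  have hb := sum_card_bounds (m := marginal q) fun i => ⟨marginal_nonneg hq i, marginal_le_one hq i⟩
  rw [Real.log_div h0 (postDensity_pos hφ hv hb.1 hb.2 hw).ne', divIntegrand]
  have h1 : ∀ y, q y * r w * Real.log (q y * r w / joint φ v x y w) =
      r w * (q y * Real.log (q y)) + q y * (r w * Real.log (r w)) -
        r w * (q y * Real.log (joint φ v x y w)) := fun y => by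
    by_cases hy : q y = 0
    · simp [hy]
    rw [Real.log_div (mul_ne_zero hy h0) (joint_pos hφ hv x y hw).ne', Real.log_mul hy h0]
    ring
  rw [Finset.sum_congr rfl fun y _ => h1 y, Finset.sum_sub_distrib, Finset.sum_add_distrib,
    ← Finset.mul_sum, ← Finset.mul_sum, ← Finset.sum_mul, hq.2, sum_mul_log_joint hφ hv x hq hw,
    labelPart]
  ring

/-- This is `log u ≥ 1 - 1 / u` at `u = r / s`, multiplied by `r`. Summed or integrated over two
probability laws the left side vanishes, which is Gibbs' inequality. -/
lemma sub_le_mul_log_div {r s : ℝ} (hr : 0 ≤ r) (hs : 0 < s) : r - s ≤ r * Real.log (r / s) := by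
  rcases hr.eq_or_lt with rfl | hr
  · simp [hs.le]
  have := Real.one_sub_inv_le_log_of_pos (div_pos hr hs)
  calc r - s = r * (1 - (r / s)⁻¹) := by field_simp
    _ ≤ _ := by gcongr

lemma eq_of_mul_log_div_eq {r s : ℝ} (hr : 0 ≤ r) (hs : 0 < s)
    (h : r * Real.log (r / s) = r - s) : r = s := by
  rcases hr.eq_or_lt with rfl | hr
  · simpa [eq_comm] using h
  by_contra hne
  have h1 : (r / s)⁻¹ ≠ 1 := by
    rw [inv_div]; intro h; rw [div_eq_one_iff_eq hr.ne'] at h; exact hne h.symm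
  have h2 := Real.log_lt_sub_one_of_pos (inv_pos.2 (div_pos hr hs)) h1
  rw [Real.log_inv] at h2
  have : r * (1 - (r / s)⁻¹) < r * Real.log (r / s) := by
    apply mul_lt_mul_of_pos_left _ hr; linarith
  have h3 : r * (1 - (r / s)⁻¹) = r - s := by field_simp
  linarith

/-- Gibbs' inequality for the parameter law. -/
lemma labelPart_le_divergence {φ : ℝ} (hφ : 0 < φ) {v : ℝ≥0} (hv : 0 < v) {n : ℕ} {x : Fin n → ℝ}
    {q : (Fin n → Fin 2) → ℝ} {r : ℝ × ℝ → ℝ} (h : Admissible φ v x q r) :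
    labelPart φ v x q ≤ divergence φ v x q r ∧ (divergence φ v x q r ≤ labelPart φ v x q →
      r =ᵐ[volume] postDensity φ v n (∑ i, marginal q i) (∑ i, x i * marginal q i)) := by
  obtain ⟨hq, hr, hint⟩ := h
  have hb := sum_card_bounds (m := marginal q) fun i => ⟨marginal_nonneg hq i, marginal_le_one hq i⟩
  set s := postDensity φ v n (∑ i, marginal q i) (∑ i, x i * marginal q i) with hs
  have hsd : IsParamDensity s := isParamDensity_postDensity hφ hv hb.1 hb.2
  have hEq := divIntegrand_eq hφ hv x hq hr
  -- Subtracting `r - s`, whose integral is zero, makes the relative entropy integrand pointwise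
  -- nonnegative. Positivity of the integral is then immediate, and its vanishing forces `r = s`
  -- almost everywhere.
  let g : ℝ × ℝ → ℝ := fun w => divIntegrand φ v x q r w - r w * labelPart φ v x q - (r w - s w)
  have hgi : Integrable g :=
    (hint.sub (hr.2.2.2.1.mul_const _)).sub (hr.2.2.2.1.sub hsd.2.2.2.1)
  have hgint : ∫ w, g w = divergence φ v x q r - labelPart φ v x q := by
    have e1 : ∫ w, g w = (∫ w, (divIntegrand φ v x q r w - r w * labelPart φ v x q)) -
        ∫ w, (r w - s w) :=
      integral_sub (hint.sub (hr.2.2.2.1.mul_const _)) (hr.2.2.2.1.sub hsd.2.2.2.1)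
    rw [e1, integral_sub hint (hr.2.2.2.1.mul_const _), integral_sub hr.2.2.2.1 hsd.2.2.2.1,
      integral_mul_const, hr.2.2.2.2, hsd.2.2.2.2, divergence]
    ring
  have hg : ∀ w, g w = r w * Real.log (r w / s w) - (r w - s w) := fun w => by
    simp only [g]; rw [hEq w]; ring
  have hg0 : ∀ w, 0 ≤ g w := fun w => by
    rw [hg w]
    by_cases hw : w.1 ∈ Set.Ioo (0 : ℝ) 1
    · linarith [sub_le_mul_log_div (hr.2.1 w) (postDensity_pos hφ hv hb.1 hb.2
        (S := ∑ i, x i * marginal q i) hw)]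
    · simp [hr.2.2.1 w hw, hsd.2.2.1 w hw]
  refine ⟨by linarith [integral_nonneg (μ := volume) (f := g) fun w => hg0 w, hgint], fun hle => ?_⟩
  have h0 : ∫ w, g w = 0 := le_antisymm (by linarith) (integral_nonneg fun w => hg0 w)
  filter_upwards [(integral_eq_zero_iff_of_nonneg (fun w => hg0 w) hgi).1 h0] with w hw
  rw [hg w] at hw
  by_cases hw1 : w.1 ∈ Set.Ioo (0 : ℝ) 1
  · exact eq_of_mul_log_div_eq (hr.2.1 w) (postDensity_pos hφ hv hb.1 hb.2 hw1)
      (by simpa [sub_eq_zero] using hw)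
  · rw [hr.2.2.1 w hw1, hsd.2.2.1 w hw1]

lemma exists_admissible_of_isLabelLaw {φ : ℝ} (hφ : 0 < φ) {v : ℝ≥0} (hv : 0 < v) {n : ℕ}
    (x : Fin n → ℝ) {q : (Fin n → Fin 2) → ℝ} (hq : IsLabelLaw q) :
    ∃ r, Admissible φ v x q r ∧ divergence φ v x q r = labelPart φ v x q := by
  have hb := sum_card_bounds (m := marginal q) fun i => ⟨marginal_nonneg hq i, marginal_le_one hq i⟩
  set s := postDensity φ v n (∑ i, marginal q i) (∑ i, x i * marginal q i) with hs
  have hsd : IsParamDensity s := isParamDensity_postDensity hφ hv hb.1 hb.2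
  have hEq : divIntegrand φ v x q s = fun w => s w * labelPart φ v x q := by
    funext w
    rw [divIntegrand_eq hφ hv x hq hsd w, ← hs]
    by_cases h0 : s w = 0
    · simp [h0]
    · simp [div_self h0]
  refine ⟨s, ⟨hq, hsd, ?_⟩, ?_⟩
  · rw [hEq]; exact hsd.2.2.2.1.mul_const _
  · rw [divergence, hEq, integral_mul_const, hsd.2.2.2.2, one_mul]

/-! ### Product label laws and the entropy bound -/

/-- The Bernoulli mass function. -/
def bernoulliMass (m : ℝ) (k : Fin 2) : ℝ := if k = 1 then m else 1 - m

/-- The product of Bernoulli laws with the given marginals. -/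
def productLaw {n : ℕ} (m : Fin n → ℝ) (y : Fin n → Fin 2) : ℝ := ∏ i, bernoulliMass (m i) (y i)

section Product
variable {n : ℕ} {m : Fin n → ℝ}

lemma bernoulliMass_nonneg {m : ℝ} (hm : m ∈ Set.Icc (0 : ℝ) 1) (k : Fin 2) :
    0 ≤ bernoulliMass m k := by
  unfold bernoulliMass; split_ifs
  · exact hm.1
  · linarith [hm.2]

lemma sum_bernoulliMass (m : ℝ) : ∑ k, bernoulliMass m k = 1 := by
  simp [Fin.sum_univ_two, bernoulliMass]

lemma isLabelLaw_productLaw (hm : ∀ i, m i ∈ Set.Icc (0 : ℝ) 1) : IsLabelLaw (productLaw m) := by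
  refine ⟨fun y => Finset.prod_nonneg fun i _ => bernoulliMass_nonneg (hm i) _, ?_⟩
  have := (Fintype.prod_sum fun (i : Fin n) (k : Fin 2) => bernoulliMass (m i) k)
  simp only [sum_bernoulliMass, Finset.prod_const_one] at this
  exact this.symm

/-- Absorbing `f` into the `i`-th factor keeps the product form; every other factor sums to one. -/
lemma sum_productLaw_mul (m : Fin n → ℝ) (i : Fin n) (f : Fin 2 → ℝ) :
    ∑ y, productLaw m y * f (y i) = ∑ k, bernoulliMass (m i) k * f k := by
  have := (Fintype.prod_sum fun (j : Fin n) (k : Fin 2) =>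
    bernoulliMass (m j) k * if j = i then f k else 1)
  rw [← Finset.mul_prod_erase _ _ (Finset.mem_univ i)] at this
  have h1 : ∏ j ∈ Finset.univ.erase i, ∑ k, (bernoulliMass (m j) k * if j = i then f k else 1)
      = 1 := Finset.prod_eq_one fun j hj => by
    simp [Finset.ne_of_mem_erase hj, bernoulliMass]
  rw [h1, mul_one] at this
  simp only [if_true] at this
  rw [this]
  refine Finset.sum_congr rfl fun y _ => ?_
  rw [Finset.prod_mul_distrib, productLaw]
  congr 1
  rw [Finset.prod_ite_eq' Finset.univ i fun j => f (y j)]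
  simp

lemma marginal_productLaw (m : Fin n → ℝ) (i : Fin n) : marginal (productLaw m) i = m i := by
  rw [marginal, sum_productLaw_mul m i fun k => if k = 1 then 1 else 0]
  simp [bernoulliMass]

lemma log_productLaw {y : Fin n → Fin 2} (hy : productLaw m y ≠ 0) :
    Real.log (productLaw m y) = ∑ i, Real.log (bernoulliMass (m i) (y i)) := by
  refine Real.log_prod fun _ hi h => hy (Finset.prod_eq_zero hi h)

lemma binEntropy_eq_sum (m : ℝ) :
    Real.binEntropy m = -∑ k, bernoulliMass m k * Real.log (bernoulliMass m k) := by
  simp [Real.binEntropy, Fin.sum_univ_two, bernoulliMass, Real.log_inv]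

lemma sum_productLaw_mul_log (m : Fin n → ℝ) :
    ∑ y, productLaw m y * Real.log (productLaw m y) = -∑ i, Real.binEntropy (m i) := by
  have h : ∀ y, productLaw m y * Real.log (productLaw m y) =
      ∑ i, productLaw m y * Real.log (bernoulliMass (m i) (y i)) := fun y => by
    by_cases hy : productLaw m y = 0
    · simp [hy]
    · rw [log_productLaw hy, Finset.mul_sum]
  rw [Finset.sum_congr rfl fun y _ => h y, Finset.sum_comm, ← Finset.sum_neg_distrib]
  refine Finset.sum_congr rfl fun i _ => ?_
  rw [sum_productLaw_mul m i fun k => Real.log (bernoulliMass (m i) k), binEntropy_eq_sum, neg_neg]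

lemma sum_mul_eq_marginal {q : (Fin n → Fin 2) → ℝ} (hq : IsLabelLaw q) (i : Fin n)
    (f : Fin 2 → ℝ) : ∑ y, q y * f (y i) = ∑ k, bernoulliMass (marginal q i) k * f k := by
  have h : ∀ y, q y * f (y i) = q y * f 0 + (q y * if y i = 1 then 1 else 0) * (f 1 - f 0) :=
    fun y => by
      obtain h | h : y i = 0 ∨ y i = 1 := by omega
      · simp [h]
      · simp [h]; ring
  rw [Finset.sum_congr rfl fun y _ => h y, Finset.sum_add_distrib, ← Finset.sum_mul,
    ← Finset.sum_mul, hq.2]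
  simp [Fin.sum_univ_two, bernoulliMass, marginal]; ring

/-- Among the label laws with given marginals the product law has the largest entropy. -/
lemma neg_sum_binEntropy_le {q : (Fin n → Fin 2) → ℝ} (hq : IsLabelLaw q) :
    -∑ i, Real.binEntropy (marginal q i) ≤ ∑ y, q y * Real.log (q y) := by
  have hm : ∀ i, marginal q i ∈ Set.Icc (0 : ℝ) 1 :=
    fun i => ⟨marginal_nonneg hq i, marginal_le_one hq i⟩
  have hp := isLabelLaw_productLaw hm
  have hpt : ∀ y, q y - productLaw (marginal q) y ≤ q y * Real.log (q y) -
      ∑ i, q y * Real.log (bernoulliMass (marginal q i) (y i)) := fun y => by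
    rcases (hp.1 y).eq_or_lt with h0 | h0
    -- Absolute continuity: where the product law vanishes, some label value has marginal
    -- probability zero, hence `q y = 0` as well. The convention `log 0 = 0` would otherwise hide an
    -- infinite divergence.
    · have : ∃ i, bernoulliMass (marginal q i) (y i) = 0 := by
        have := Finset.prod_eq_zero_iff.1 h0.symm
        simpa using this
      obtain ⟨i, hi⟩ := this
      have hqy : q y = 0 := by
        have h1 : ∑ z, q z * (if z i = y i then 1 else 0) = 0 := by
          rw [sum_mul_eq_marginal hq i fun k => if k = y i then 1 else 0]
          rw [Finset.sum_eq_single (y i)] <;> simp +contextual [hi]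
        have h2 := (Finset.sum_eq_zero_iff_of_nonneg fun z _ =>
          mul_nonneg (hq.1 z) (by split_ifs <;> norm_num)).1 h1 y (Finset.mem_univ _)
        simpa using h2
      simp [hqy, ← h0]
    · rw [← Finset.mul_sum, ← log_productLaw h0.ne']
      rcases (hq.1 y).eq_or_lt with hq0 | hq0
      · simp [← hq0, h0.le]
      have := sub_le_mul_log_div (hq.1 y) h0
      rwa [Real.log_div hq0.ne' h0.ne', mul_sub] at this
  have hsum := Finset.sum_le_sum fun y (_ : y ∈ Finset.univ) => hpt y
  rw [Finset.sum_sub_distrib, Finset.sum_sub_distrib, hq.2, hp.2, Finset.sum_comm] at hsum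
  have : ∑ i, ∑ y, q y * Real.log (bernoulliMass (marginal q i) (y i)) =
      -∑ i, Real.binEntropy (marginal q i) := by
    rw [← Finset.sum_neg_distrib]
    refine Finset.sum_congr rfl fun i _ => ?_
    rw [sum_mul_eq_marginal hq i fun k => Real.log (bernoulliMass (marginal q i) k),
      binEntropy_eq_sum, neg_neg]
  linarith

end Product

/-! ### The free energies as minima over the marginals -/

section Minimum
variable {φ : ℝ} {v : ℝ≥0} {n : ℕ} {x : Fin n → ℝ}

lemma labelEnergy_le_divergence (hφ : 0 < φ) (hv : 0 < v)
    {q : (Fin n → Fin 2) → ℝ} {r : ℝ × ℝ → ℝ} (h : Admissible φ v x q r) :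
    nullFreeEnergy x + labelEnergy φ v x (marginal q) ≤ labelPart φ v x q ∧
    nullFreeEnergy x + labelEnergy φ v x (marginal q) ≤ divergence φ v x q r := by
  have h1 := (labelPart_le_divergence hφ hv h).1
  have h2 := neg_sum_binEntropy_le h.1
  have h3 : nullFreeEnergy x + labelEnergy φ v x (marginal q) ≤ labelPart φ v x q := by
    simp only [labelPart, labelEnergy] at *; linarith
  exact ⟨h3, h3.trans h1⟩

lemma exists_admissible (hφ : 0 < φ) (hv : 0 < v) (x : Fin n → ℝ) {m : Fin n → ℝ}
    (hm : ∀ i, m i ∈ Set.Icc (0 : ℝ) 1) :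
    ∃ q r, Admissible φ v x q r ∧ marginal q = m ∧
      divergence φ v x q r = nullFreeEnergy x + labelEnergy φ v x m := by
  obtain ⟨r, hr, hd⟩ := exists_admissible_of_isLabelLaw hφ hv x (isLabelLaw_productLaw hm)
  have hmar : marginal (productLaw m) = m := funext fun i => marginal_productLaw m i
  refine ⟨_, r, hr, hmar, ?_⟩
  rw [hd, labelPart, hmar, labelEnergy, sum_productLaw_mul_log]; ring

lemma continuous_log_beta (hφ : 0 < φ) (n : ℕ) :
    ContinuousOn (fun N : ℝ => Real.log (beta (N + φ) (n - N + φ))) (Set.Icc 0 n) := by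
  refine ContinuousOn.log ?_ fun N hN => (beta_pos (by linarith [hN.1]) (by linarith [hN.2])).ne'
  have hG : ∀ (f : ℝ → ℝ), Continuous f → (∀ N ∈ Set.Icc (0 : ℝ) n, 0 < f N) →
      ContinuousOn (fun N => Real.Gamma (f N)) (Set.Icc 0 n) := fun f hf hpos N hN =>
    ((Real.differentiableAt_Gamma fun k => by
      have := hpos N hN
      have hk : (0 : ℝ) ≤ k := by positivity
      linarith).continuousAt.comp hf.continuousAt).continuousWithinAt
  unfold beta
  refine ((hG _ (by fun_prop) fun N hN => by linarith [hN.1]).mul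
    (hG _ (by fun_prop) fun N hN => by linarith [hN.2])).div
    (hG _ (by fun_prop) fun N hN => by linarith [hN.1, hN.2]) fun N hN =>
      (Real.Gamma_pos_of_pos (by linarith [hN.1, hN.2])).ne'

/-- The cube of label marginals. -/
def cube (n : ℕ) : Set (Fin n → ℝ) := Set.univ.pi fun _ => Set.Icc 0 1

lemma mem_cube {m : Fin n → ℝ} : m ∈ cube n ↔ ∀ i, m i ∈ Set.Icc (0 : ℝ) 1 := by
  simp only [cube, Set.mem_univ_pi]

lemma isCompact_cube (n : ℕ) : IsCompact (cube n) := isCompact_univ_pi fun _ => isCompact_Icc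

lemma cube_nonempty (n : ℕ) : (cube n).Nonempty := ⟨0, by simp [mem_cube]⟩

lemma continuousOn_labelEnergy (hφ : 0 < φ) (v : ℝ≥0) (n : ℕ) :
    ContinuousOn (fun p : (Fin n → ℝ) × (Fin n → ℝ) => labelEnergy φ v p.1 p.2)
      (Set.univ ×ˢ cube n) := by
  have hN : ContinuousOn (fun p : (Fin n → ℝ) × (Fin n → ℝ) => ∑ i, p.2 i) (Set.univ ×ˢ cube n) :=
    Continuous.continuousOn (by fun_prop)
  have hmaps : Set.MapsTo (fun p : (Fin n → ℝ) × (Fin n → ℝ) => ∑ i, p.2 i)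
      (Set.univ ×ˢ cube n) (Set.Icc 0 n) := fun p hp => sum_card_bounds (mem_cube.1 hp.2)
  have hpos : ∀ p ∈ (Set.univ : Set (Fin n → ℝ)) ×ˢ cube n, (1 + (v : ℝ) * ∑ i, p.2 i) ≠ 0 :=
    fun p hp => by
      have := (hmaps hp).1
      have : 0 ≤ (v : ℝ) * ∑ i, p.2 i := mul_nonneg v.2 this
      linarith
  have hB := (continuous_log_beta hφ n).comp hN hmaps
  have hc : ContinuousOn (fun p : (Fin n → ℝ) × (Fin n → ℝ) => 1 + (v : ℝ) * ∑ i, p.2 i)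
      (Set.univ ×ˢ cube n) := Continuous.continuousOn (by fun_prop)
  unfold labelEnergy countEnergy
  refine ContinuousOn.sub (ContinuousOn.add ?_ (ContinuousOn.add (ContinuousOn.sub ?_ hB) ?_)) ?_
  · exact Continuous.continuousOn (by fun_prop)
  · exact continuousOn_const
  · exact continuousOn_const.mul (hc.log hpos)
  · refine ContinuousOn.div_const (ContinuousOn.mul (continuousOn_const.div hc hpos) ?_) _
    exact Continuous.continuousOn (by fun_prop)

/-- The minimum of the label energy over the cube of marginals. -/
def minLabelEnergy (φ : ℝ) (v : ℝ≥0) {n : ℕ} (x : Fin n → ℝ) : ℝ :=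
  sInf ((fun m => labelEnergy φ v x m) '' cube n)

lemma exists_labelEnergy_min (hφ : 0 < φ) (v : ℝ≥0) (x : Fin n → ℝ) :
    ∃ m ∈ cube n, labelEnergy φ v x m = minLabelEnergy φ v x ∧
      ∀ m' ∈ cube n, minLabelEnergy φ v x ≤ labelEnergy φ v x m' := by
  have hc : ContinuousOn (fun m => labelEnergy φ v x m) (cube n) :=
    (continuousOn_labelEnergy hφ v n).comp (f := fun m => (x, m))
      (by fun_prop) fun m hm => ⟨trivial, hm⟩
  obtain ⟨m, hm, he, hle⟩ := (isCompact_cube n).exists_sInf_image_eq_and_le (cube_nonempty n) hc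
  refine ⟨m, hm, he.symm, fun m' hm' => ?_⟩
  rw [minLabelEnergy, he]; exact hle m' hm'

/-- A minimum over a fixed compact set depends continuously on the parameter when the function is
jointly continuous. Its role is the measurability of the statistic, required for convergence in
distribution. -/
lemma continuous_minLabelEnergy (hφ : 0 < φ) (v : ℝ≥0) (n : ℕ) :
    Continuous fun x : Fin n → ℝ => minLabelEnergy φ v x := by
  have h := continuousOn_labelEnergy hφ v n
  have hK : IsCompact (Set.univ : Set (cube n)) := isCompact_iff_isCompact_univ.1 (isCompact_cube n)
  have h2 : Continuous fun p : (Fin n → ℝ) × cube n => labelEnergy φ v p.1 (p.2 : Fin n → ℝ) :=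
    h.comp_continuous (f := fun p : (Fin n → ℝ) × cube n => (p.1, (p.2 : Fin n → ℝ)))
      (by fun_prop) fun p => ⟨trivial, p.2.2⟩
  have h3 := hK.continuous_sInf (f := fun (x : Fin n → ℝ) (m : cube n) => labelEnergy φ v x m) h2
  refine h3.congr fun x => ?_
  rw [minLabelEnergy, Set.image_univ]
  congr 1
  ext d; simp

lemma freeEnergy_eq (hφ : 0 < φ) (hv : 0 < v) (x : Fin n → ℝ) :
    freeEnergy φ v x = nullFreeEnergy x + minLabelEnergy φ v x := by
  obtain ⟨m, hm, he, hle⟩ := exists_labelEnergy_min hφ v x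
  obtain ⟨q, r, hqr, -, hd⟩ := exists_admissible hφ hv x (mem_cube.1 hm)
  refine IsLeast.csInf_eq ⟨⟨q, r, hqr, by rw [hd, he]⟩, ?_⟩
  rintro d ⟨q', r', h', rfl⟩
  have := hle (marginal q') (mem_cube.2 fun i =>
    ⟨marginal_nonneg h'.1 i, marginal_le_one h'.1 i⟩)
  linarith [(labelEnergy_le_divergence hφ hv h').2]

lemma exists_isOptimal (hφ : 0 < φ) (hv : 0 < v) (x : Fin n → ℝ) :
    ∃ q r, IsOptimal φ v x q r := by
  obtain ⟨m, hm, he, hle⟩ := exists_labelEnergy_min hφ v x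
  obtain ⟨q, r, hqr, -, hd⟩ := exists_admissible hφ hv x (mem_cube.1 hm)
  refine ⟨q, r, hqr, fun q' r' h' => ?_⟩
  have := hle (marginal q') (mem_cube.2 fun i =>
    ⟨marginal_nonneg h'.1 i, marginal_le_one h'.1 i⟩)
  linarith [(labelEnergy_le_divergence hφ hv h').2]

/-- Optimal pairs minimize the label energy, and their parameter law has the conjugate mean. -/
lemma IsOptimal.spec (hφ : 0 < φ) (hv : 0 < v) {q : (Fin n → Fin 2) → ℝ} {r : ℝ × ℝ → ℝ}
    (h : IsOptimal φ v x q r) :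
    marginal q ∈ cube n ∧ labelEnergy φ v x (marginal q) = minLabelEnergy φ v x ∧
      meanB r = v / (1 + v * ∑ i, marginal q i) * ∑ i, x i * marginal q i := by
  have hcube : marginal q ∈ cube n := mem_cube.2 fun i =>
    ⟨marginal_nonneg h.1.1 i, marginal_le_one h.1.1 i⟩
  obtain ⟨m, hm, he, hle⟩ := exists_labelEnergy_min hφ v x
  obtain ⟨q', r', hqr, -, hd⟩ := exists_admissible hφ hv x (mem_cube.1 hm)
  have h1 := h.2 q' r' hqr
  have h2 := labelEnergy_le_divergence hφ hv h.1
  have h3 := hle _ hcube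
  have h4 := labelPart_le_divergence hφ hv h.1
  have hb := sum_card_bounds (mem_cube.1 hcube)
  refine ⟨hcube, by linarith, ?_⟩
  -- Optimality closes the chain minimum ≤ label part ≤ divergence ≤ minimum, so Gibbs' inequality
  -- for `r` is an equality and `r` is the conjugate density.
  have hae := h4.2 (by linarith)
  rw [← integral_snd_mul_postDensity (n := n) hφ hv hb.1 hb.2]
  refine integral_congr_ae ?_
  filter_upwards [hae] with w hw
  rw [hw]

lemma freeEnergyAt_le (hφ : 0 < φ) (hv : 0 < v) {α : ℝ} {m : Fin n → ℝ} (hm : m ∈ cube n)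
    (hα : ∑ i, m i = α * n) :
    freeEnergyAt φ v x α ≤ nullFreeEnergy x + labelEnergy φ v x m := by
  obtain ⟨m₀, -, -, hle⟩ := exists_labelEnergy_min hφ v x
  obtain ⟨q, r, hqr, hq, hd⟩ := exists_admissible hφ hv x (mem_cube.1 hm)
  -- The unrestricted minimum serves as the lower bound of the constrained set that a real infimum
  -- needs.
  refine csInf_le ⟨nullFreeEnergy x + minLabelEnergy φ v x, ?_⟩
    ⟨q, r, hqr, by rw [expectedCount_eq, hq, hα], hd.symm⟩
  rintro d ⟨q', r', h', -, rfl⟩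
  have := hle (marginal q') (mem_cube.2 fun i =>
    ⟨marginal_nonneg h'.1 i, marginal_le_one h'.1 i⟩)
  linarith [(labelEnergy_le_divergence hφ hv h').2]

lemma le_freeEnergyAt (hφ : 0 < φ) (hv : 0 < v) {α c : ℝ} (hα : α ∈ Set.Icc (0 : ℝ) 1)
    (h : ∀ m ∈ cube n, ∑ i, m i = α * n → c ≤ labelEnergy φ v x m) :
    nullFreeEnergy x + c ≤ freeEnergyAt φ v x α := by
  obtain ⟨q, r, hqr, hq, hd⟩ := exists_admissible hφ hv x (m := fun _ => α) fun _ => hα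
  -- The constant marginals `α` show that the constraint is feasible.
  refine le_csInf ⟨_, q, r, hqr, by rw [expectedCount_eq, hq]; simp [mul_comm], rfl⟩ ?_
  rintro d ⟨q', r', h', hc, rfl⟩
  have := h (marginal q') (mem_cube.2 fun i =>
    ⟨marginal_nonneg h'.1 i, marginal_le_one h'.1 i⟩) hc
  linarith [(labelEnergy_le_divergence hφ hv h').2]

end Minimum

/-! ### Duality with the likelihood ratio of the mixture -/

/-- The likelihood ratio of the mixture with parameter `(a, s)` against the standard normal law. -/
def likRatio (a s x : ℝ) : ℝ := 1 - a + a * Real.exp (s * x - s ^ 2 / 2)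

/-- The log likelihood ratio of a sample. -/
def logRatio {n : ℕ} (a s : ℝ) (x : Fin n → ℝ) : ℝ := ∑ i, Real.log (likRatio a s (x i))

/-- The free energy of the constant marginals `α`, without the data term. -/
def profileEnergy (φ : ℝ) (v : ℝ≥0) (n α : ℝ) : ℝ :=
  -(n * Real.binEntropy α) + countEnergy φ v n (α * n)

lemma likRatio_pos {a : ℝ} (ha : a ∈ Set.Icc (0 : ℝ) 1) (s x : ℝ) : 0 < likRatio a s x := by
  have h := Real.exp_pos (s * x - s ^ 2 / 2)
  unfold likRatio
  rcases ha.1.eq_or_lt with rfl | h0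
  · simp
  · have := mul_pos h0 h
    linarith [ha.2]

/-- The relative entropy of the Bernoulli law `m` with respect to the law `a` tilted by `exp θ` is
nonnegative. The two implications keep `m` absolutely continuous at the endpoints, where the real
value `log 0 = 0` would lose an infinite term. -/
lemma bernoulli_gibbs {a m θ : ℝ} (ha : a ∈ Set.Icc (0 : ℝ) 1) (hm : m ∈ Set.Icc (0 : ℝ) 1)
    (h0 : a = 0 → m = 0) (h1 : a = 1 → m = 1) :
    m * θ + Real.binEntropy m + (m * Real.log a + (1 - m) * Real.log (1 - a)) ≤
      Real.log (1 - a + a * Real.exp θ) := by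
  rcases ha.1.eq_or_lt with rfl | ha0
  · simp [h0 rfl]
  rcases ha.2.eq_or_lt with rfl | ha1
  · simp [h1 rfl]
  have hb : 0 < 1 - a := by linarith
  have he := Real.exp_pos θ
  have hZ : 0 < 1 - a + a * Real.exp θ := by positivity
  set Z := 1 - a + a * Real.exp θ with hZd
  have g1 := sub_le_mul_log_div hm.1 (show 0 < a * Real.exp θ / Z by positivity)
  have g2 := sub_le_mul_log_div (sub_nonneg.2 hm.2) (show 0 < (1 - a) / Z by positivity)
  have hs : a * Real.exp θ / Z + (1 - a) / Z = 1 := by rw [hZd]; field_simp; ring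
  have e1 : m * Real.log (m / (a * Real.exp θ / Z)) =
      m * Real.log m - m * (Real.log a + θ - Real.log Z) := by
    rcases hm.1.eq_or_lt with rfl | h
    · simp
    rw [Real.log_div h.ne' (by positivity), Real.log_div (by positivity) hZ.ne',
      Real.log_mul ha0.ne' he.ne', Real.log_exp]; ring
  have e2 : (1 - m) * Real.log ((1 - m) / ((1 - a) / Z)) =
      (1 - m) * Real.log (1 - m) - (1 - m) * (Real.log (1 - a) - Real.log Z) := by
    rcases hm.2.eq_or_lt with rfl | h
    · simp
    rw [Real.log_div (by linarith) (by positivity), Real.log_div hb.ne' hZ.ne']; ring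
  rw [e1] at g1
  rw [e2] at g2
  simp only [Real.binEntropy, Real.log_inv]
  nlinarith

/-- The concave function `β ↦ β S - β² N / 2 - β² / (2v)` has its maximum `v S² / (2 (1 + v N))` at
the posterior mean, so there the quadratic term becomes a sum over observations. Then
`bernoulli_gibbs` with `θ = β x i - β² / 2` bounds each label separately and the likelihood ratio of
the mixture appears. -/
lemma profileEnergy_sub_logRatio_le {φ : ℝ} {v : ℝ≥0} (hv : 0 < v) {n : ℕ} (hn : n ≠ 0)
    (x : Fin n → ℝ) {m : Fin n → ℝ} (hm : m ∈ cube n) {α : ℝ} (hα : ∑ i, m i = α * n) :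
    let β := v / (1 + v * ∑ i, m i) * ∑ i, x i * m i
    profileEnergy φ v n α - logRatio α β x + β ^ 2 / (2 * v) ≤ labelEnergy φ v x m := by
  intro β
  have hm' := mem_cube.1 hm
  have hb := sum_card_bounds hm'
  have hn' : (0 : ℝ) < n := by positivity
  have hα01 : α ∈ Set.Icc (0 : ℝ) 1 := by
    rw [hα] at hb
    exact ⟨le_of_mul_le_mul_right (by simpa using hb.1) hn',
      le_of_mul_le_mul_right (by simpa using hb.2) hn'⟩
  -- At `α = 0` and `α = 1` all labels are degenerate, as the endpoint conditions of
  -- `bernoulli_gibbs` require.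
  have h0 : α = 0 → ∀ i, m i = 0 := fun h i => by
    have h2 : ∑ i, m i = 0 := by rw [hα, h, zero_mul]
    exact (Finset.sum_eq_zero_iff_of_nonneg fun i _ => (hm' i).1).1 h2 i (Finset.mem_univ _)
  have h1 : α = 1 → ∀ i, m i = 1 := fun h i => by
    have h2 : ∑ i, (1 - m i) = 0 := by simp [hα, h]
    have := (Finset.sum_eq_zero_iff_of_nonneg fun i _ => sub_nonneg.2 (hm' i).2).1 h2 i
      (Finset.mem_univ _)
    linarith
  have hsum := Finset.sum_le_sum fun i (_ : i ∈ Finset.univ) =>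
    bernoulli_gibbs (θ := β * x i - β ^ 2 / 2) hα01 (hm' i) (fun h => h0 h i) (fun h => h1 h i)
  simp only [Finset.sum_add_distrib] at hsum
  have e1 : ∑ i, m i * (β * x i - β ^ 2 / 2) = β * ∑ i, x i * m i - β ^ 2 / 2 * ∑ i, m i := by
    rw [Finset.mul_sum, Finset.mul_sum, ← Finset.sum_sub_distrib]
    exact Finset.sum_congr rfl fun i _ => by ring
  have e2 : ∑ i, m i * Real.log α + ∑ i, (1 - m i) * Real.log (1 - α) =
      -(n * Real.binEntropy α) := by
    rw [← Finset.sum_mul, ← Finset.sum_mul, Finset.sum_sub_distrib, hα]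
    simp [Real.binEntropy]; ring
  rw [e1, e2] at hsum
  have hv' : (0 : ℝ) < v := hv
  have hpos : 0 < 1 + (v : ℝ) * ∑ i, m i := by
    have := mul_nonneg hv'.le hb.1
    linarith
  have e3 : (v : ℝ) / (1 + v * ∑ i, m i) * (∑ i, x i * m i) ^ 2 / 2 =
      β * (∑ i, x i * m i) - β ^ 2 / 2 * (∑ i, m i) - β ^ 2 / (2 * v) := by
    simp only [β]; field_simp; ring
  rw [labelEnergy, e3, profileEnergy, ← hα]
  simp only [logRatio, likRatio]
  linarith

/-! ### Stirling's formula for the Gamma function and the deterministic terms -/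

lemma log_Gamma_add_one {y : ℝ} (hy : 0 < y) :
    (Real.log ∘ Real.Gamma) (y + 1) = (Real.log ∘ Real.Gamma) y + Real.log y := by
  simp only [Function.comp]
  rw [Real.Gamma_add_one hy.ne', Real.log_mul hy.ne' (Real.Gamma_pos_of_pos hy).ne', add_comm]

/-- The error in Stirling's formula. -/
def stirlingError (z : ℝ) : ℝ :=
  Real.log (Real.Gamma z) - ((z - 1 / 2) * Real.log z - z + 1 / 2 * Real.log (2 * Real.pi))

lemma tendsto_stirlingError_nat : Tendsto (fun n : ℕ => stirlingError n) atTop (𝓝 0) := by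
  have h := (Stirling.tendsto_stirlingSeq_sqrt_pi.log (by positivity)).sub
    (tendsto_const_nhds (x := Real.log (√Real.pi)))
  rw [sub_self] at h
  refine h.congr' ?_
  filter_upwards [eventually_gt_atTop 0] with n hn
  have hn' : (0 : ℝ) < n := by exact_mod_cast hn
  rw [Stirling.log_stirlingSeq_formula, stirlingError]
  obtain ⟨k, rfl⟩ := Nat.exists_eq_succ_of_ne_zero hn.ne'
  have : Real.Gamma ((k.succ : ℕ) : ℝ) = k.factorial := by
    rw [Nat.cast_succ, Real.Gamma_nat_eq_factorial]
  rw [this, Nat.factorial_succ, Nat.cast_mul, Real.log_mul (by positivity) (by positivity),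
    Real.log_mul (by positivity) (by positivity), Real.log_div (by positivity) (by positivity),
    Real.log_exp, Real.log_sqrt (by positivity), Real.log_mul (by positivity) (by positivity)]
  ring

/-- Log-convexity of `Γ` places `log Γ(n + x)` between `log Γ(n) + x log (n - 1)` and `log Γ(n) + x
log n`, which transfers Stirling's formula from the integers to the reals up to a vanishing error.
-/
lemma stirlingError_le_nat {n : ℕ} (hn : 2 ≤ n) {z : ℝ} (hz : (n : ℝ) ≤ z) (hz' : z ≤ n + 1) :
    stirlingError z ≤ stirlingError n + 1 / n ∧
    stirlingError n + Real.log (((n : ℝ) - 1) / n) - 1 / n ≤ stirlingError z := by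
  have hn' : (2 : ℝ) ≤ n := by exact_mod_cast hn
  obtain ⟨x, rfl⟩ : ∃ x, z = n + x := ⟨z - n, by ring⟩
  have hx0 : 0 ≤ x := by linarith
  have hx1 : x ≤ 1 := by linarith
  have hub : Real.log (Real.Gamma (n + x)) ≤ Real.log (Real.Gamma n) + x * Real.log n := by
    rcases hx0.eq_or_lt with rfl | hx
    · simp
    · exact Real.BohrMollerup.f_add_nat_le Real.convexOn_log_Gamma (@log_Gamma_add_one)
        (by omega) hx hx1
  have hlb : Real.log (Real.Gamma n) + x * Real.log (n - 1) ≤ Real.log (Real.Gamma (n + x)) := by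
    rcases hx0.eq_or_lt with rfl | hx
    · simp
    · exact Real.BohrMollerup.f_add_nat_ge Real.convexOn_log_Gamma (@log_Gamma_add_one) hn hx
  have hnx : (0 : ℝ) < n + x := by linarith
  have hlog : Real.log (n + x) = Real.log n + Real.log (1 + x / n) := by
    rw [← Real.log_mul (by positivity) (by positivity)]; congr 1; field_simp
  have l1 : Real.log (1 + x / n) ≤ x / n := by
    have := Real.log_le_sub_one_of_pos (show 0 < 1 + x / n by positivity)
    linarith
  have l2 : x / (n + x) ≤ Real.log (1 + x / n) := by
    have := Real.one_sub_inv_le_log_of_pos (show 0 < 1 + x / n by positivity)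
    have e : 1 - (1 + x / n)⁻¹ = x / (n + x) := by field_simp; ring
    linarith
  have hc : 0 ≤ (n : ℝ) + x - 1 / 2 := by linarith
  have b1 : (n + x - 1 / 2) * Real.log (1 + x / n) - x ≤ 1 / n := by
    have := mul_le_mul_of_nonneg_left l1 hc
    have e : (n + x - 1 / 2) * (x / n) - x = (x - 1 / 2) * x / n := by field_simp; ring
    have : (x - 1 / 2) * x / n ≤ 1 / n := by gcongr; nlinarith
    linarith
  have b2 : -(1 / n) ≤ (n + x - 1 / 2) * Real.log (1 + x / n) - x := by
    have := mul_le_mul_of_nonneg_left l2 hc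
    have e : (n + x - 1 / 2) * (x / (n + x)) - x = -(x / 2 / (n + x)) := by field_simp; ring
    have : x / 2 / (n + x) ≤ 1 / n := by gcongr; linarith
    linarith
  have hlog2 : x * (Real.log (n - 1) - Real.log n) ≥ Real.log (((n : ℝ) - 1) / n) := by
    rw [Real.log_div (by linarith) (by linarith)]
    have : Real.log ((n : ℝ) - 1) ≤ Real.log n := Real.log_le_log (by linarith) (by linarith)
    nlinarith
  simp only [stirlingError, hlog]
  constructor <;> nlinarith

lemma tendsto_stirlingError : Tendsto stirlingError atTop (𝓝 0) := by
  have hf : Tendsto (fun z : ℝ => ⌊z⌋₊) atTop atTop := tendsto_nat_floor_atTop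
  have h1 : Tendsto (fun n : ℕ => 1 / (n : ℝ)) atTop (𝓝 0) := tendsto_one_div_atTop_nhds_zero_nat
  have h2 : Tendsto (fun n : ℕ => Real.log (((n : ℝ) - 1) / n)) atTop (𝓝 0) := by
    have h3 : Tendsto (fun n : ℕ => 1 - 1 / (n : ℝ)) atTop (𝓝 (1 - 0)) := h1.const_sub 1
    have h4 := h3.log (by norm_num)
    rw [sub_zero, Real.log_one] at h4
    refine h4.congr' ?_
    filter_upwards [eventually_gt_atTop 0] with n hn
    congr 1
    have : (n : ℝ) ≠ 0 := by positivity
    field_simp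
  have u := (tendsto_stirlingError_nat.add h1).comp hf
  have l := ((tendsto_stirlingError_nat.add h2).sub h1).comp hf
  simp only [add_zero, sub_zero] at u l
  refine tendsto_of_tendsto_of_tendsto_of_le_of_le' l u ?_ ?_ <;>
  filter_upwards [eventually_ge_atTop 2] with z hz
  · exact (stirlingError_le_nat (Nat.le_floor hz) (Nat.floor_le (by linarith))
      (Nat.lt_floor_add_one z).le).2
  · exact (stirlingError_le_nat (Nat.le_floor hz) (Nat.floor_le (by linarith))
      (Nat.lt_floor_add_one z).le).1

/-- The error in Stirling's formula for `Γ(z + c)`, expanded at `z`. -/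
def shiftedStirlingError (c z : ℝ) : ℝ :=
  Real.log (Real.Gamma (z + c)) -
    ((z + c - 1 / 2) * Real.log z - z + 1 / 2 * Real.log (2 * Real.pi))

lemma tendsto_mul_log_one_add_div_sub (c d : ℝ) :
    Tendsto (fun z : ℝ => (z + d) * Real.log (1 + c / z)) atTop (𝓝 c) := by
  have h1 := Real.tendsto_mul_log_one_add_div_atTop c
  have h2 : Tendsto (fun z : ℝ => d * Real.log (1 + c / z)) atTop (𝓝 (d * Real.log (1 + 0))) := by
    refine Tendsto.const_mul _ (Tendsto.log (tendsto_const_nhds.add ?_) (by norm_num))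
    exact tendsto_const_nhds.div_atTop tendsto_id
  have := h1.add h2
  simp only [add_zero, Real.log_one, mul_zero] at this
  refine this.congr fun z => by ring

lemma tendsto_shiftedStirlingError {c : ℝ} (hc : 0 < c) :
    Tendsto (shiftedStirlingError c) atTop (𝓝 0) := by
  have h1 : Tendsto (fun z => stirlingError (z + c)) atTop (𝓝 0) :=
    tendsto_stirlingError.comp (tendsto_atTop_add_const_right _ _ tendsto_id)
  have h2 := (h1.add (tendsto_mul_log_one_add_div_sub c (c - 1 / 2))).sub
    (tendsto_const_nhds (x := c))
  rw [zero_add, sub_self] at h2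
  refine h2.congr' ?_
  filter_upwards [eventually_gt_atTop 0] with z hz
  have : Real.log (z + c) = Real.log z + Real.log (1 + c / z) := by
    rw [← Real.log_mul (by positivity) (by positivity)]; congr 1; field_simp
  simp only [stirlingError, shiftedStirlingError, this]
  ring

/-- The form with `log (z + 1)` in place of `log z` stays bounded down to `z = 0`, so it covers
expected counts of any size. The difference converges at infinity and is continuous on compact
intervals. -/
lemma exists_abs_log_Gamma_sub_le {c : ℝ} (hc : 0 < c) :
    ∃ C, ∀ z, 0 ≤ z →
      |Real.log (Real.Gamma (z + c)) - ((z + c - 1 / 2) * Real.log (z + 1) - z)| ≤ C := by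
  set f : ℝ → ℝ := fun z => Real.log (Real.Gamma (z + c)) -
    ((z + c - 1 / 2) * Real.log (z + 1) - z) with hf
  have hlim : Tendsto f atTop (𝓝 (0 + 1 / 2 * Real.log (2 * Real.pi) - 1)) := by
    have h2 := ((tendsto_shiftedStirlingError hc).add_const (1 / 2 * Real.log (2 * Real.pi))).sub
      (tendsto_mul_log_one_add_div_sub 1 (c - 1 / 2))
    refine h2.congr' ?_
    filter_upwards [eventually_gt_atTop 0] with z hz
    have : Real.log (z + 1) = Real.log z + Real.log (1 + 1 / z) := by
      rw [← Real.log_mul (by positivity) (by positivity)]; congr 1; field_simp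
    simp only [shiftedStirlingError, hf, this]
    ring
  obtain ⟨A, hA⟩ := eventually_atTop.1 (hlim.abs.eventually_le_const (lt_add_one _))
  have hcont : ContinuousOn f (Set.Icc 0 A) := by
    intro z hz
    refine ContinuousAt.continuousWithinAt ?_
    have hG : ContinuousAt (fun z => Real.Gamma (z + c)) z :=
      (Real.differentiableAt_Gamma fun k => by
        have hk : (0 : ℝ) ≤ k := by positivity
        linarith [hz.1]).continuousAt.comp (f := fun z => z + c) (by fun_prop)
    have h1 : ContinuousAt (fun z : ℝ => Real.log (z + 1)) z :=
      ContinuousAt.log (by fun_prop) (by linarith [hz.1])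
    exact (hG.log (Real.Gamma_pos_of_pos (by linarith [hz.1])).ne').sub
      ((ContinuousAt.mul (by fun_prop) h1).sub continuousAt_id)
  obtain ⟨C, hC⟩ := isCompact_Icc.exists_bound_of_continuousOn hcont
  refine ⟨max C (|0 + 1 / 2 * Real.log (2 * Real.pi) - 1| + 1), fun z hz => ?_⟩
  rcases le_total z A with h | h
  · exact (hC z ⟨hz, h⟩).trans (le_max_left _ _)
  · exact (hA z h).trans (le_max_right _ _)

lemma log_beta_eq {a b : ℝ} (ha : 0 < a) (hb : 0 < b) : Real.log (beta a b) =
    Real.log (Real.Gamma a) + Real.log (Real.Gamma b) - Real.log (Real.Gamma (a + b)) := by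
  have h1 := Real.Gamma_pos_of_pos ha
  have h2 := Real.Gamma_pos_of_pos hb
  have h3 := Real.Gamma_pos_of_pos (add_pos ha hb)
  rw [beta, Real.log_div (by positivity) h3.ne', Real.log_mul h1.ne' h2.ne']

lemma log_beta_self {φ : ℝ} (hφ : 0 < φ) :
    Real.log (beta φ φ) = -Real.log (Real.Gamma (2 * φ) / Real.Gamma φ ^ 2) := by
  have h1 := Real.Gamma_pos_of_pos hφ
  have h3 := Real.Gamma_pos_of_pos (show 0 < 2 * φ by positivity)
  rw [log_beta_eq hφ hφ, Real.log_div h3.ne' (by positivity), Real.log_pow, two_mul]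
  push_cast; ring

/-- The terms of order `n` and `n log n` cancel between the entropy and the Gamma functions. The
coefficient of `log n` left over is `(2φ - 1/2) - 2 (φ - 1/2) + 1/2 = 1`. The last `1/2`, from the
posterior variance of `b`, also turns the coefficient `1/2 - φ` of `log α` into `1 - φ`; `log (1 -
α)` gets no such correction. -/
lemma profileEnergy_eq {φ : ℝ} (hφ : 0 < φ) {v : ℝ≥0} (hv : 0 < v) {n α : ℝ} (hn : 0 < n)
    (hα : α ∈ Set.Ioo (0 : ℝ) 1) :
    profileEnergy φ v n α = Real.log n + profileConst φ v α +
      (shiftedStirlingError (2 * φ) n - shiftedStirlingError φ (α * n)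
        - shiftedStirlingError φ ((1 - α) * n) + 1 / 2 * Real.log (1 + 1 / (v * (α * n)))) := by
  have hα1 : 0 < 1 - α := by linarith [hα.2]
  have hα0 := hα.1
  have hv' : (0 : ℝ) < v := hv
  have e1 : n - α * n = (1 - α) * n := by ring
  have e2 : α * n + φ + ((1 - α) * n + φ) = n + 2 * φ := by ring
  have e3 : Real.log (1 + v * (α * n)) = Real.log v + (Real.log α + Real.log n)
      + Real.log (1 + 1 / (v * (α * n))) := by
    rw [← Real.log_mul hα0.ne' hn.ne', ← Real.log_mul (by positivity) (by positivity),
      ← Real.log_mul (by positivity) (by positivity)]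
    congr 1; field_simp; ring
  simp only [profileEnergy, countEnergy, e1, shiftedStirlingError, e3]
  rw [log_beta_eq (a := α * n + φ) (by positivity) (by positivity), e2, log_beta_self hφ,
    Real.log_mul hα0.ne' hn.ne', Real.log_mul hα1.ne' hn.ne', profileConst]
  simp only [Real.binEntropy, Real.log_inv]
  ring

/-- Expansion of the profile energy, uniformly on compact sets of mixing fractions. -/
lemma eventually_abs_profileEnergy_sub_le {φ : ℝ} (hφ : 0 < φ) {v : ℝ≥0} (hv : 0 < v) {a δ : ℝ}
    (ha : 0 < a) (hδ : 0 < δ) : ∀ᶠ n : ℕ in atTop, ∀ α ∈ Set.Icc a (1 - a),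
      |profileEnergy φ v n α - (Real.log n + profileConst φ v α)| ≤ δ := by
  have hv' : (0 : ℝ) < v := hv
  have hd : 0 < δ / 4 := by positivity
  have h1 := (tendsto_shiftedStirlingError hφ).abs.eventually_le_const (u := δ / 4) (by simpa)
  have h2 := (tendsto_shiftedStirlingError (show 0 < 2 * φ by positivity)).abs.eventually_le_const
    (u := δ / 4) (by simpa)
  have h3 : ∀ᶠ z : ℝ in atTop, |1 / 2 * Real.log (1 + 1 / (v * z))| ≤ δ / 4 := by
    have : Tendsto (fun z : ℝ => 1 / 2 * Real.log (1 + 1 / (v * z))) atTop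
        (𝓝 (1 / 2 * Real.log (1 + 0))) := by
      refine Tendsto.const_mul _ (Tendsto.log (tendsto_const_nhds.add ?_) (by norm_num))
      exact tendsto_const_nhds.div_atTop (tendsto_id.const_mul_atTop hv')
    exact this.abs.eventually_le_const (by simpa)
  obtain ⟨A, hA⟩ := eventually_atTop.1 (h1.and (h2.and h3))
  have hlarge : ∀ᶠ n : ℕ in atTop, max A 1 ≤ a * n :=
    (tendsto_natCast_atTop_atTop.const_mul_atTop ha).eventually_ge_atTop _
  filter_upwards [hlarge, eventually_gt_atTop 0] with n hn hn0 α hα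
  have hn' : (0 : ℝ) < n := by exact_mod_cast hn0
  have hA1 : A ≤ a * n := (le_max_left _ _).trans hn
  have ha1 : a ≤ 1 := by linarith [hα.1.trans hα.2]
  rw [profileEnergy_eq hφ hv hn' ⟨by linarith [hα.1], by linarith [hα.2]⟩, add_sub_cancel_left]
  have b1 := (hA n (by nlinarith)).2.1
  have b2 := hA (α * n) (by nlinarith [hα.1])
  have b3 := (hA ((1 - α) * n) (by nlinarith [hα.2])).1
  have b4 := b2.1
  have b5 := b2.2.2
  rw [abs_le] at *
  constructor <;> linarith [b1.1, b1.2, b3.1, b3.2, b4.1, b4.2, b5.1, b5.2]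

/-- A lower bound of the profile energy which is uniform in the mixing fraction. -/
lemma exists_le_profileEnergy {φ : ℝ} (hφ : 1 < φ) {v : ℝ≥0} (hv : 0 < v) :
    ∃ C, ∀ n : ℝ, 1 ≤ n → ∀ α ∈ Set.Icc (0 : ℝ) 1,
      Real.log n + (φ - 1) * Real.log (n / (α * n + 1))
        + (φ - 1 / 2) * Real.log (n / ((1 - α) * n + 1)) - C ≤ profileEnergy φ v n α := by
  have hv' : (0 : ℝ) < v := hv
  obtain ⟨C1, hC1⟩ := exists_abs_log_Gamma_sub_le (show 0 < φ by linarith)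
  obtain ⟨C2, hC2⟩ := exists_abs_log_Gamma_sub_le (show 0 < 2 * φ by linarith)
  -- Two Gamma errors for the label counts, one for `n + 2φ`, and `1 + 1` from the two uses of
  -- `key`, each of which replaces `log (t n)` by `log (t n + 1)`. The factor `min 1 v` compares `1
  -- + v α n` with `α n + 1`.
  refine ⟨2 * C1 + C2 + 2 - Real.log (beta φ φ) - 1 / 2 * Real.log (min (1 : ℝ) v), ?_⟩
  intro n hn α hα
  have hn0 : 0 < n := by linarith
  have hN : 0 ≤ α * n := mul_nonneg hα.1 hn0.le
  have hM : 0 ≤ (1 - α) * n := mul_nonneg (by linarith [hα.2]) hn0.le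
  have g1 := (abs_le.1 (hC1 _ hN)).2
  have g2 := (abs_le.1 (hC1 _ hM)).2
  have g3 := (abs_le.1 (hC2 _ hn0.le)).1
  have key : ∀ t, 0 ≤ t → t * n * Real.log (t * n + 1) - 1 ≤ t * n * Real.log (t * n) := by
    intro t ht
    rcases (mul_nonneg ht hn0.le).eq_or_lt with h | h
    · simp [← h]
    have := Real.log_le_sub_one_of_pos (show 0 < 1 + 1 / (t * n) by positivity)
    have e : Real.log (t * n + 1) = Real.log (t * n) + Real.log (1 + 1 / (t * n)) := by
      rw [← Real.log_mul (by positivity) (by positivity), mul_add, mul_one,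
        mul_one_div_cancel h.ne']
    have h2 : t * n * Real.log (1 + 1 / (t * n)) ≤ t * n * (1 / (t * n)) := by
      gcongr; linarith
    rw [mul_one_div_cancel h.ne'] at h2
    rw [e]; linarith
  have hent : -(n * Real.binEntropy α) = α * n * Real.log (α * n)
      + (1 - α) * n * Real.log ((1 - α) * n) - n * Real.log n := by
    have a1 : α * n * Real.log (α * n) = α * n * (Real.log α + Real.log n) := by
      rcases hα.1.eq_or_lt with rfl | h
      · simp
      rw [Real.log_mul h.ne' hn0.ne']
    have a2 : (1 - α) * n * Real.log ((1 - α) * n) =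
        (1 - α) * n * (Real.log (1 - α) + Real.log n) := by
      rcases hα.2.eq_or_lt with rfl | h
      · simp
      rw [Real.log_mul (by linarith) hn0.ne']
    rw [a1, a2]; simp only [Real.binEntropy, Real.log_inv]; ring
  have hvar : Real.log (min (1 : ℝ) v) + Real.log (α * n + 1) ≤ Real.log (1 + v * (α * n)) := by
    have hmin : 0 < min (1 : ℝ) v := lt_min one_pos hv'
    rw [← Real.log_mul hmin.ne' (by positivity)]
    apply Real.log_le_log (by positivity)
    have h1 : min 1 (v : ℝ) ≤ 1 := min_le_left _ _
    have h2 : min 1 (v : ℝ) ≤ v := min_le_right _ _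
    nlinarith
  have hlogn : (n + 2 * φ - 1 / 2) * Real.log n ≤ (n + 2 * φ - 1 / 2) * Real.log (n + 1) := by
    apply mul_le_mul_of_nonneg_left (Real.log_le_log hn0 (by linarith)); linarith
  have e1 : n - α * n = (1 - α) * n := by ring
  have e2 : α * n + φ + ((1 - α) * n + φ) = n + 2 * φ := by ring
  rw [profileEnergy, hent, countEnergy, e1, log_beta_eq (a := α * n + φ) (by positivity)
    (by positivity), e2, Real.log_div hn0.ne' (by positivity), Real.log_div hn0.ne' (by positivity)]
  have k1 := key α hα.1
  have k2 := key (1 - α) (by linarith [hα.2])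
  nlinarith

/-! ### The minimizer of the profile constant -/

lemma optFraction_mem {φ : ℝ} (hφ : 1 < φ) : optFraction φ ∈ Set.Ioo (0 : ℝ) 1 := by
  unfold optFraction
  exact ⟨div_pos (by linarith) (by linarith), by rw [div_lt_one] <;> linarith⟩

lemma profileConst_optFraction {φ : ℝ} (hφ : 1 < φ) (v : ℝ≥0) :
    profileConst φ v (optFraction φ) = limitConst φ v := by
  have e : 1 - optFraction φ = (φ - 1 / 2) / (2 * φ - 3 / 2) := by
    have : 2 * φ - 3 / 2 ≠ 0 := by linarith
    rw [optFraction, eq_div_iff this, sub_mul, div_mul_cancel₀ _ this]; ring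
  rw [profileConst, e, optFraction, Real.log_div (by linarith) (by linarith),
    Real.log_div (by linarith) (by linarith), limitConst]
  ring

/-- The difference of the two sides is `2φ - 3/2` times the relative entropy of the Bernoulli law
`α₀` with respect to the Bernoulli law `α`. -/
lemma limitConst_lt_profileConst {φ : ℝ} (hφ : 1 < φ) (v : ℝ≥0) {α : ℝ}
    (hα : α ∈ Set.Ioo (0 : ℝ) 1) (hne : α ≠ optFraction φ) :
    limitConst φ v < profileConst φ v α := by
  have h0 := optFraction_mem hφ
  have hα1 : 0 < 1 - α := by linarith [hα.2]
  have h01 : 0 < 1 - optFraction φ := by linarith [h0.2]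
  have g2 := sub_le_mul_log_div h01.le hα1
  have g1 := sub_le_mul_log_div h0.1.le hα.1
  have g3 : optFraction φ - α ≠ optFraction φ * Real.log (optFraction φ / α) := fun h =>
    hne (eq_of_mul_log_div_eq h0.1.le hα.1 h.symm).symm
  have g4 := lt_of_le_of_ne g1 g3
  have hsum : 0 < optFraction φ * Real.log (optFraction φ / α) +
      (1 - optFraction φ) * Real.log ((1 - optFraction φ) / (1 - α)) := by linarith
  rw [Real.log_div h0.1.ne' hα.1.ne', Real.log_div h01.ne' hα1.ne'] at hsum
  have hk : 0 < 2 * φ - 3 / 2 := by linarith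
  have m1 : (2 * φ - 3 / 2) * optFraction φ = φ - 1 := by
    rw [optFraction, mul_div_cancel₀ _ hk.ne']
  have m2 : (2 * φ - 3 / 2) * (1 - optFraction φ) = φ - 1 / 2 := by
    rw [mul_sub, m1]; ring
  have := mul_pos hk hsum
  rw [← profileConst_optFraction hφ v, profileConst, profileConst]
  have e : (2 * φ - 3 / 2) * (optFraction φ * (Real.log (optFraction φ) - Real.log α) +
      (1 - optFraction φ) * (Real.log (1 - optFraction φ) - Real.log (1 - α))) =
      (φ - 1) * (Real.log (optFraction φ) - Real.log α) +
      (φ - 1 / 2) * (Real.log (1 - optFraction φ) - Real.log (1 - α)) := by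
    rw [← m1, ← m2]; ring
  rw [e] at this
  linarith

lemma limitConst_le_profileConst {φ : ℝ} (hφ : 1 < φ) (v : ℝ≥0) {α : ℝ}
    (hα : α ∈ Set.Ioo (0 : ℝ) 1) : limitConst φ v ≤ profileConst φ v α := by
  by_cases h : α = optFraction φ
  · rw [h, profileConst_optFraction hφ]
  · exact (limitConst_lt_profileConst hφ v hα h).le

/-- Compactness upgrades the strict inequality to a uniform gap, by which near minimality of the
energy locates the mixing fraction. -/
lemma exists_limitConst_add_le {φ : ℝ} (hφ : 1 < φ) (v : ℝ≥0) {a ε : ℝ} (ha : 0 < a)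
    (hε : 0 < ε) : ∃ δ > 0, ∀ α ∈ Set.Icc a (1 - a), ε ≤ |α - optFraction φ| →
      limitConst φ v + δ ≤ profileConst φ v α := by
  set K : Set ℝ := Set.Icc a (1 - a) ∩ {α | ε ≤ |α - optFraction φ|} with hK
  have hKc : IsCompact K := isCompact_Icc.inter_right
    (isClosed_le continuous_const (by fun_prop))
  rcases K.eq_empty_or_nonempty with h | h
  · exact ⟨1, one_pos, fun α h1 h2 => absurd (show α ∈ K from ⟨h1, h2⟩) (by simp [h])⟩
  have hcont : ContinuousOn (profileConst φ v) K := by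
    intro α hα
    have h1 : ContinuousAt Real.log α := Real.continuousAt_log (by linarith [hα.1.1])
    have h2 : ContinuousAt (fun α => Real.log (1 - α)) α :=
      ContinuousAt.log (by fun_prop) (by linarith [hα.1.2])
    refine ContinuousAt.continuousWithinAt ?_
    unfold profileConst
    fun_prop
  obtain ⟨α₁, hα₁, hmin⟩ := hKc.exists_isMinOn h hcont
  refine ⟨profileConst φ v α₁ - limitConst φ v, sub_pos.2 (limitConst_lt_profileConst hφ v
    ⟨by linarith [hα₁.1.1], by linarith [hα₁.1.2]⟩ ?_), fun α h1 h2 => ?_⟩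
  · rintro rfl
    have := hα₁.2
    simp at this; linarith
  · have := hmin (show α ∈ K from ⟨h1, h2⟩)
    simp only [Set.mem_ofPred_eq] at this
    linarith

/-! ### Hellinger deficit and Fisher information of the mixture -/

lemma gaussianReal_eq_withDensity (s : ℝ) : gaussianReal s 1 =
    (gaussianReal 0 1).withDensity fun x => ENNReal.ofReal (Real.exp (s * x - s ^ 2 / 2)) := by
  rw [gaussianReal_of_var_ne_zero _ one_ne_zero, gaussianReal_of_var_ne_zero _ one_ne_zero,
    ← withDensity_mul _ (measurable_gaussianPDF _ _) (by fun_prop)]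
  congr 1
  ext x
  rw [Pi.mul_apply, gaussianPDF, gaussianPDF, ← ENNReal.ofReal_mul (gaussianPDFReal_nonneg _ _ _)]
  congr 1
  rw [gaussianPDFReal, gaussianPDFReal, mul_assoc (√_)⁻¹, ← Real.exp_add]
  congr 2
  simp; ring

lemma gaussianReal_map_add (s : ℝ) : (gaussianReal 0 1).map (· + s) = gaussianReal s 1 := by
  rw [gaussianReal_map_add_const, zero_add]

/-- The exponential is the density of `N(s,1)` with respect to `N(0,1)`, and `N(s,1)` is the
translate of `N(0,1)`. -/
lemma integral_exp_mul_eq_shift (s : ℝ) (F : ℝ → ℝ) :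
    ∫ x, Real.exp (s * x - s ^ 2 / 2) * F x ∂gaussianReal 0 1 =
      ∫ z, F (z + s) ∂gaussianReal 0 1 := by
  rw [← (measurableEmbedding_addRight s).integral_map (μ := gaussianReal 0 1) F,
    gaussianReal_map_add, gaussianReal_eq_withDensity s,
    integral_withDensity_eq_integral_toReal_smul (by fun_prop) (ae_of_all _ fun x => by simp)]
  refine integral_congr_ae (ae_of_all _ fun x => ?_)
  simp [ENNReal.toReal_ofReal (Real.exp_pos _).le]

lemma integrable_exp_mul_iff_shift (s : ℝ) (F : ℝ → ℝ) :
    Integrable (fun x => Real.exp (s * x - s ^ 2 / 2) * F x) (gaussianReal 0 1) ↔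
      Integrable (fun z => F (z + s)) (gaussianReal 0 1) := by
  have h := (measurableEmbedding_addRight s).integrable_map_iff (μ := gaussianReal 0 1) (g := F)
  rw [gaussianReal_map_add, gaussianReal_eq_withDensity s,
    integrable_withDensity_iff_integrable_smul' (by fun_prop) (ae_of_all _ fun x => by simp)] at h
  simp only [ENNReal.toReal_ofReal (Real.exp_pos _).le, smul_eq_mul] at h
  exact h

lemma integrable_sq_gaussian : Integrable (fun z : ℝ => z ^ 2) (gaussianReal 0 1) :=
  (memLp_id_gaussianReal 2).integrable_sq

lemma integrable_exp_sq_gaussian :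
    Integrable (fun z : ℝ => Real.exp (z ^ 2 / 4)) (gaussianReal 0 1) := by
  rw [gaussianReal_of_var_ne_zero _ one_ne_zero, integrable_withDensity_iff_integrable_smul'
    (measurable_gaussianPDF _ _) (ae_of_all _ fun x => by simp [gaussianPDF])]
  refine ((integrable_exp_neg_mul_sq (b := 1 / 4) (by norm_num)).const_mul
    ((√(2 * Real.pi * (1 : ℝ≥0)))⁻¹)).congr (ae_of_all _ fun x => ?_)
  show _ = (gaussianPDF 0 1 x).toReal • Real.exp (x ^ 2 / 4)
  rw [toReal_gaussianPDF, gaussianPDFReal, smul_eq_mul, mul_assoc (√_)⁻¹, ← Real.exp_add]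
  show _ * _ = _
  congr 2
  simp; ring

/-- The score of the mixture with respect to the mean `s` of the second component. -/
def score (a s x : ℝ) : ℝ := a * (x - s) * Real.exp (s * x - s ^ 2 / 2) / likRatio a s x

/-- Half the squared Hellinger distance between the mixture and the null density. -/
def hellinger (a s : ℝ) : ℝ := 1 - ∫ x, √(likRatio a s x) ∂gaussianReal 0 1

/-- The Fisher information of the mixture with respect to `s`. -/
def fisher (a s : ℝ) : ℝ := ∫ x, likRatio a s x * score a s x ^ 2 ∂gaussianReal 0 1

lemma continuous_likRatio (a : ℝ) : Continuous fun p : ℝ × ℝ => likRatio a p.1 p.2 := by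
  unfold likRatio; fun_prop

lemma continuous_likRatio_right (a s : ℝ) : Continuous (likRatio a s) := by
  unfold likRatio; fun_prop

/-! ### Integrals over a single observation. -/

section OneDim
variable {a : ℝ}

lemma continuous_score (ha : a ∈ Set.Icc (0 : ℝ) 1) :
    Continuous fun p : ℝ × ℝ => score a p.1 p.2 := by
  unfold score
  exact Continuous.div (by fun_prop) (continuous_likRatio a) fun p => (likRatio_pos ha _ _).ne'

lemma continuous_score_right (ha : a ∈ Set.Icc (0 : ℝ) 1) (s : ℝ) : Continuous (score a s) :=
  (continuous_score ha).comp (by fun_prop : Continuous fun x : ℝ => (s, x))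

lemma integrable_likRatio (a s : ℝ) : Integrable (likRatio a s) (gaussianReal 0 1) := by
  have h := (integrable_exp_mul_iff_shift s fun _ => a).2 (integrable_const _)
  refine ((integrable_const (1 - a)).add h).congr (ae_of_all _ fun x => ?_)
  simp [likRatio, mul_comm]

lemma integral_likRatio (a s : ℝ) : ∫ x, likRatio a s x ∂gaussianReal 0 1 = 1 := by
  have h := (integrable_exp_mul_iff_shift s fun _ => a).2 (integrable_const _)
  have h2 := integral_exp_mul_eq_shift s fun _ => a
  have : ∀ x, likRatio a s x = (1 - a) + Real.exp (s * x - s ^ 2 / 2) * a := fun x => by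
    unfold likRatio; ring
  simp_rw [this]
  rw [integral_add (integrable_const _) h, h2]
  simp

lemma likRatio_mul_score (ha : a ∈ Set.Icc (0 : ℝ) 1) (s x : ℝ) :
    likRatio a s x * score a s x = Real.exp (s * x - s ^ 2 / 2) * (a * (x - s)) := by
  have := (likRatio_pos ha s x).ne'
  unfold score; field_simp

lemma integrable_likRatio_mul_score (ha : a ∈ Set.Icc (0 : ℝ) 1) (s : ℝ) :
    Integrable (fun x => likRatio a s x * score a s x) (gaussianReal 0 1) := by
  simp_rw [likRatio_mul_score ha]
  refine (integrable_exp_mul_iff_shift s fun x => a * (x - s)).2 ?_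
  simp only [add_sub_cancel_right]
  exact ((memLp_id_gaussianReal 1).integrable (by simp)).const_mul a

lemma integral_likRatio_mul_score (ha : a ∈ Set.Icc (0 : ℝ) 1) (s : ℝ) :
    ∫ x, likRatio a s x * score a s x ∂gaussianReal 0 1 = 0 := by
  simp_rw [likRatio_mul_score ha]
  rw [integral_exp_mul_eq_shift s fun x => a * (x - s)]
  simp only [add_sub_cancel_right]
  rw [integral_const_mul, integral_id_gaussianReal, mul_zero]

lemma likRatio_mul_score_sq (ha : a ∈ Set.Icc (0 : ℝ) 1) (s x : ℝ) :
    likRatio a s x * score a s x ^ 2 = (x - s) ^ 2 *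
      (a ^ 2 * Real.exp (s * x - s ^ 2 / 2) ^ 2 / likRatio a s x) := by
  have := (likRatio_pos ha s x).ne'
  unfold score; field_simp

/-- The posterior probability `a e / f` of the second component is at most one. -/
lemma quotient_le (ha : a ∈ Set.Icc (0 : ℝ) 1) (s x : ℝ) :
    a ^ 2 * Real.exp (s * x - s ^ 2 / 2) ^ 2 / likRatio a s x ≤
      Real.exp (s * x - s ^ 2 / 2) * a := by
  rw [div_le_iff₀ (likRatio_pos ha s x)]
  have he := Real.exp_pos (s * x - s ^ 2 / 2)
  have h1 : a * Real.exp (s * x - s ^ 2 / 2) ≤ likRatio a s x := by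
    unfold likRatio; linarith [ha.2]
  have := mul_le_mul_of_nonneg_left h1 (mul_nonneg he.le ha.1)
  nlinarith

lemma integrable_likRatio_mul_score_sq (ha : a ∈ Set.Icc (0 : ℝ) 1) (s : ℝ) :
    Integrable (fun x => likRatio a s x * score a s x ^ 2) (gaussianReal 0 1) := by
  have h : Integrable (fun x => Real.exp (s * x - s ^ 2 / 2) * (a * (x - s) ^ 2))
      (gaussianReal 0 1) := by
    refine (integrable_exp_mul_iff_shift s fun x => a * (x - s) ^ 2).2 ?_
    simp only [add_sub_cancel_right]
    exact integrable_sq_gaussian.const_mul a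
  refine h.mono' ((continuous_likRatio_right a s).mul
    ((continuous_score_right ha s).pow 2)).aestronglyMeasurable (ae_of_all _ fun x => ?_)
  have hnn : 0 ≤ likRatio a s x * score a s x ^ 2 :=
    mul_nonneg (likRatio_pos ha s x).le (sq_nonneg _)
  rw [Real.norm_of_nonneg hnn, likRatio_mul_score_sq ha]
  calc _ ≤ (x - s) ^ 2 * (Real.exp (s * x - s ^ 2 / 2) * a) := by
        gcongr; exact quotient_le ha s x
    _ = _ := by ring

lemma integrable_sqrt_likRatio (ha : a ∈ Set.Icc (0 : ℝ) 1) (s : ℝ) :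
    Integrable (fun x => √(likRatio a s x)) (gaussianReal 0 1) := by
  refine ((integrable_const (1 : ℝ)).add (integrable_likRatio a s)).mono'
    (continuous_likRatio_right a s).sqrt.aestronglyMeasurable (ae_of_all _ fun x => ?_)
  have h0 := (likRatio_pos ha s x).le
  rw [Real.norm_of_nonneg (Real.sqrt_nonneg _), Pi.add_apply]
  nlinarith [Real.sq_sqrt h0, sq_nonneg (√(likRatio a s x) - 1)]

lemma integrable_sqrt_sub_one_sq (ha : a ∈ Set.Icc (0 : ℝ) 1) (s : ℝ) :
    Integrable (fun x => (√(likRatio a s x) - 1) ^ 2) (gaussianReal 0 1) ∧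
      ∫ x, (√(likRatio a s x) - 1) ^ 2 ∂gaussianReal 0 1 = 2 * hellinger a s := by
  have e : ∀ x, (√(likRatio a s x) - 1) ^ 2 = likRatio a s x + 1 - 2 * √(likRatio a s x) :=
    fun x => by
      have := Real.sq_sqrt (likRatio_pos ha s x).le
      nlinarith
  have i1 := (integrable_likRatio a s).add (integrable_const (1 : ℝ))
  have i2 := (integrable_sqrt_likRatio ha s).const_mul 2
  simp_rw [e]
  refine ⟨i1.sub i2, ?_⟩
  have h1 : ∫ x, (likRatio a s x + 1 - 2 * √(likRatio a s x)) ∂gaussianReal 0 1 =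
      (∫ x, (likRatio a s x + 1) ∂gaussianReal 0 1) -
        ∫ x, 2 * √(likRatio a s x) ∂gaussianReal 0 1 := integral_sub i1 i2
  rw [h1, integral_add (integrable_likRatio a s) (integrable_const _), integral_const_mul,
    integral_likRatio, hellinger]
  simp; ring

lemma hellinger_nonneg (ha : a ∈ Set.Icc (0 : ℝ) 1) (s : ℝ) : 0 ≤ hellinger a s := by
  have := (integrable_sqrt_sub_one_sq ha s).2
  have h2 : 0 ≤ ∫ x, (√(likRatio a s x) - 1) ^ 2 ∂gaussianReal 0 1 :=
    integral_nonneg fun x => sq_nonneg _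
  linarith

lemma half_min_le_one_sub_exp_neg {u : ℝ} (hu : 0 ≤ u) : min 1 u / 2 ≤ 1 - Real.exp (-u) := by
  have h : ∀ t : ℝ, 0 ≤ t → t ≤ 1 → t / 2 ≤ 1 - Real.exp (-t) := fun t h0 h1 => by
    have h2 := Real.add_one_le_exp t
    have h3 : Real.exp (-t) ≤ (t + 1)⁻¹ := by
      rw [Real.exp_neg]; exact inv_anti₀ (by linarith) h2
    have h4 : (t + 1)⁻¹ ≤ 1 - t / 2 := by
      rw [inv_le_iff_one_le_mul₀ (by linarith)]; nlinarith
    linarith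
  refine (h _ (le_min zero_le_one hu) (min_le_left _ _)).trans ?_
  have : Real.exp (-u) ≤ Real.exp (-min 1 u) := Real.exp_le_exp.2 (neg_le_neg (min_le_right _ _))
  linarith

/-- The probability that a standard normal variable exceeds one. -/
lemma gaussianReal_tail_pos :
    0 < (gaussianReal 0 1).real (Set.Ici 1) ∧ 0 < (gaussianReal 0 1).real (Set.Iic (-1)) := by
  have h : ∀ S : Set ℝ, volume S ≠ 0 → 0 < (gaussianReal 0 1).real S := fun S hS => by
    rw [measureReal_def, ENNReal.toReal_pos_iff]
    refine ⟨pos_iff_ne_zero.2 fun h0 => hS ?_, measure_lt_top _ _⟩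
    exact gaussianReal_absolutelyContinuous' 0 one_ne_zero h0
  exact ⟨h _ (by simp), h _ (by simp)⟩

/-- On the half line where `x` is opposite in sign to `s` and `|x| ≥ 1`, the likelihood ratio is at
most `1 - a (1 - exp (-|s|))`, hence `1 - √f` is at least `a min 1 |s| / 4`. That half line has a
fixed positive Gaussian probability. -/
lemma exists_le_hellinger : ∃ c > 0, ∀ a ∈ Set.Icc (0 : ℝ) 1, ∀ s : ℝ,
    c * a ^ 2 * min 1 (s ^ 2) ≤ hellinger a s := by
  obtain ⟨p1, p2⟩ := gaussianReal_tail_pos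
  set p := min ((gaussianReal 0 1).real (Set.Ici 1)) ((gaussianReal 0 1).real (Set.Iic (-1)))
    with hp
  have hp0 : 0 < p := lt_min p1 p2
  refine ⟨p / 32, by positivity, fun a ha s => ?_⟩
  rcases eq_or_ne s 0 with rfl | hs
  · simpa using hellinger_nonneg ha 0
  have hmin : min 1 (s ^ 2) = min 1 |s| ^ 2 := by
    rcases le_total 1 |s| with h | h
    · rw [min_eq_left h, min_eq_left (by rw [← sq_abs]; nlinarith)]; norm_num
    · rw [min_eq_right h, min_eq_right (by rw [← sq_abs]; nlinarith [abs_nonneg s]), sq_abs]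
  have hm0 : 0 ≤ min 1 |s| := le_min zero_le_one (abs_nonneg s)
  have hpt : ∀ x, s * x ≤ -|s| → a ^ 2 * min 1 |s| ^ 2 / 16 ≤ (√(likRatio a s x) - 1) ^ 2 := by
    intro x hx
    have hpos := likRatio_pos ha s x
    have h1 : Real.exp (s * x - s ^ 2 / 2) ≤ Real.exp (-|s|) :=
      Real.exp_le_exp.2 (by nlinarith [sq_nonneg s])
    have h2 := half_min_le_one_sub_exp_neg (abs_nonneg s)
    have h3 : a * min 1 |s| / 2 ≤ 1 - likRatio a s x := by
      unfold likRatio; nlinarith [ha.1]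
    have h4 := Real.sqrt_nonneg (likRatio a s x)
    have h5 : √(likRatio a s x) ≤ 1 := by
      rw [Real.sqrt_le_one]; have := mul_nonneg ha.1 hm0; linarith
    have h6 := Real.sq_sqrt hpos.le
    have h7 : a * min 1 |s| / 4 ≤ 1 - √(likRatio a s x) := by nlinarith
    have := mul_nonneg ha.1 hm0
    nlinarith
  have hI := integrable_sqrt_sub_one_sq ha s
  have hset : ∀ S : Set ℝ, MeasurableSet S → (∀ x ∈ S, s * x ≤ -|s|) →
      (gaussianReal 0 1).real S * (a ^ 2 * min 1 |s| ^ 2 / 16) ≤ 2 * hellinger a s := by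
    intro S hS hSx
    rw [← hI.2, ← smul_eq_mul, ← setIntegral_const]
    refine (setIntegral_mono_on (integrable_const _).integrableOn hI.1.integrableOn hS
      fun x hx => hpt x (hSx x hx)).trans ?_
    exact setIntegral_le_integral hI.1 (ae_of_all _ fun x => sq_nonneg _)
  have hfin : p * (a ^ 2 * min 1 |s| ^ 2 / 16) ≤ 2 * hellinger a s := by
    have hnn : 0 ≤ a ^ 2 * min 1 |s| ^ 2 / 16 := by positivity
    rcases lt_or_gt_of_ne hs with h | h
    · refine (mul_le_mul_of_nonneg_right (min_le_left _ _) hnn).trans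
        (hset _ measurableSet_Ici fun x hx => ?_)
      rw [abs_of_neg h]; have : 1 ≤ x := hx; nlinarith
    · refine (mul_le_mul_of_nonneg_right (min_le_right _ _) hnn).trans
        (hset _ measurableSet_Iic fun x hx => ?_)
      rw [abs_of_pos h]; have : x ≤ -1 := hx; nlinarith
  rw [hmin]; linarith

/-- For `a ≤ 1/2` the likelihood ratio is at least `1/2`, so the denominator of the Fisher
information is harmless. After translation by `s` the rest is dominated, for `|s| ≤ 1`, by one
integrable function. -/
lemma exists_fisher_le : ∃ C > 0, ∀ a ∈ Set.Icc (0 : ℝ) (1 / 2), ∀ s ∈ Set.Icc (-1 : ℝ) 1,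
    fisher a s ≤ C * a ^ 2 := by
  set D := ∫ z, z ^ 2 * (Real.exp (1 / 2) * (Real.exp z + Real.exp (-z))) ∂gaussianReal 0 1 with hD
  have hint : Integrable (fun z => z ^ 2 * (Real.exp (1 / 2) * (Real.exp z + Real.exp (-z))))
      (gaussianReal 0 1) := by
    have h1 : ∀ t : ℝ, Integrable (fun z => z ^ 2 * Real.exp (t * z)) (gaussianReal 0 1) :=
      fun t => by
        have h2 : Integrable (fun x => Real.exp (t * x - t ^ 2 / 2) * x ^ 2)
            (gaussianReal 0 1) := by
          refine (integrable_exp_mul_iff_shift t fun x => x ^ 2).2 ?_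
          have : ∀ z : ℝ, (z + t) ^ 2 = z ^ 2 + (2 * t) * z + t ^ 2 := fun z => by ring
          simp_rw [this]
          exact (integrable_sq_gaussian.add (((memLp_id_gaussianReal 1).integrable
            (by simp)).const_mul (2 * t))).add (integrable_const _)
        refine (h2.const_mul (Real.exp (t ^ 2 / 2))).congr (ae_of_all _ fun x => ?_)
        simp only
        rw [← mul_assoc, ← Real.exp_add, mul_comm]; congr 2; ring
    refine (((h1 1).add (h1 (-1))).const_mul (Real.exp (1 / 2))).congr
      (ae_of_all _ fun x => ?_)
    simp only [Pi.add_apply, one_mul, neg_mul]; ring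
  refine ⟨2 * |D| + 1, by positivity, fun a ha s hs => ?_⟩
  have ha' : a ∈ Set.Icc (0 : ℝ) 1 := ⟨ha.1, by linarith [ha.2]⟩
  have hle : ∀ x, likRatio a s x * score a s x ^ 2 ≤ 2 * a ^ 2 *
      (Real.exp (s * x - s ^ 2 / 2) * ((x - s) ^ 2 * Real.exp (s * x - s ^ 2 / 2))) := fun x => by
    rw [likRatio_mul_score_sq ha']
    have he := Real.exp_pos (s * x - s ^ 2 / 2)
    have hf : 1 / 2 ≤ likRatio a s x := by
      unfold likRatio; have := mul_nonneg ha.1 he.le; linarith [ha.2]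
    have : a ^ 2 * Real.exp (s * x - s ^ 2 / 2) ^ 2 / likRatio a s x ≤
        a ^ 2 * Real.exp (s * x - s ^ 2 / 2) ^ 2 / (1 / 2) := by gcongr
    calc _ ≤ (x - s) ^ 2 * (a ^ 2 * Real.exp (s * x - s ^ 2 / 2) ^ 2 / (1 / 2)) := by gcongr
      _ = _ := by ring
  have hpt : ∀ z : ℝ, (z + s - s) ^ 2 * Real.exp (s * (z + s) - s ^ 2 / 2) ≤
      z ^ 2 * (Real.exp (1 / 2) * (Real.exp z + Real.exp (-z))) := fun z => by
    have e1 : s * (z + s) - s ^ 2 / 2 = s ^ 2 / 2 + s * z := by ring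
    rw [add_sub_cancel_right, e1, Real.exp_add]
    have h1 : Real.exp (s ^ 2 / 2) ≤ Real.exp (1 / 2) :=
      Real.exp_le_exp.2 (by nlinarith [hs.1, hs.2])
    have h2 : Real.exp (s * z) ≤ Real.exp z + Real.exp (-z) := by
      rcases le_total 0 z with h | h
      · have : Real.exp (s * z) ≤ Real.exp z := Real.exp_le_exp.2 (by nlinarith [hs.2])
        linarith [Real.exp_pos (-z)]
      · have : Real.exp (s * z) ≤ Real.exp (-z) := Real.exp_le_exp.2 (by nlinarith [hs.1])
        linarith [Real.exp_pos z]
    gcongr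
  have hi2 : Integrable (fun x => Real.exp (s * x - s ^ 2 / 2) *
      ((x - s) ^ 2 * Real.exp (s * x - s ^ 2 / 2))) (gaussianReal 0 1) := by
    refine (integrable_exp_mul_iff_shift s fun x =>
      (x - s) ^ 2 * Real.exp (s * x - s ^ 2 / 2)).2 ?_
    refine hint.mono' (Continuous.aestronglyMeasurable (by fun_prop)) (ae_of_all _ fun z => ?_)
    rw [Real.norm_of_nonneg (by positivity)]; exact hpt z
  have h3 : fisher a s ≤ 2 * a ^ 2 * D := by
    refine (integral_mono (integrable_likRatio_mul_score_sq ha' s) (hi2.const_mul _) hle).trans ?_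
    rw [integral_const_mul, integral_exp_mul_eq_shift s fun x =>
      (x - s) ^ 2 * Real.exp (s * x - s ^ 2 / 2)]
    refine mul_le_mul_of_nonneg_left ?_ (by positivity)
    refine integral_mono ?_ hint hpt
    exact (integrable_exp_mul_iff_shift s fun x =>
      (x - s) ^ 2 * Real.exp (s * x - s ^ 2 / 2)).1 hi2
  nlinarith [le_abs_self D, sq_nonneg a]

/-- Split at exponential `2`. Below it, `f ≥ 1/2` gives `8 a²`. Above it, `f - 1 ≥ a e / 2` and `f -
1 = (√f - 1)(√f + 1) ≤ 2 √f (√f - 1)`, which gives the Hellinger term. -/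
lemma quotient_le_hellinger (ha : a ∈ Set.Icc (0 : ℝ) (1 / 2)) (s x : ℝ) :
    a ^ 2 * Real.exp (s * x - s ^ 2 / 2) ^ 2 / likRatio a s x ≤
      8 * a ^ 2 + 16 * (√(likRatio a s x) - 1) ^ 2 := by
  have ha' : a ∈ Set.Icc (0 : ℝ) 1 := ⟨ha.1, by linarith [ha.2]⟩
  have hpos := likRatio_pos ha' s x
  have he := Real.exp_pos (s * x - s ^ 2 / 2)
  set E := Real.exp (s * x - s ^ 2 / 2) with hE
  rw [div_le_iff₀ hpos]
  set f := likRatio a s x with hf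
  have hfe : f = 1 - a + a * E := rfl
  have hsq := Real.sq_sqrt hpos.le
  have hs0 := Real.sqrt_nonneg f
  have haE := mul_nonneg ha.1 he.le
  rcases le_total E 2 with h | h
  · have h1 : a ^ 2 * E ^ 2 ≤ a ^ 2 * 4 := by gcongr; nlinarith
    have h2 : 1 / 2 ≤ f := by linarith [ha.2]
    have h3 : 8 * a ^ 2 * (1 / 2) ≤ 8 * a ^ 2 * f := by gcongr
    have h4 : 0 ≤ 16 * (√f - 1) ^ 2 * f := by positivity
    nlinarith
  · have h1 : a * E / 2 ≤ f - 1 := by rw [hfe]; nlinarith [ha.1]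
    have h2 : 1 ≤ √f := by rw [Real.one_le_sqrt]; linarith
    have h3 : f - 1 ≤ (√f - 1) * (2 * √f) := by nlinarith
    have h4 : a * E ≤ 4 * ((√f - 1) * √f) := by linarith
    have h5 : (a * E) ^ 2 ≤ (4 * ((√f - 1) * √f)) ^ 2 := pow_le_pow_left₀ haE h4 2
    have h6 : (4 * ((√f - 1) * √f)) ^ 2 = 16 * (√f - 1) ^ 2 * f := by
      rw [mul_pow, mul_pow, hsq]; ring
    have h7 : 0 ≤ 8 * a ^ 2 * f := by positivity
    nlinarith

/-- Far from the null the information is not controlled by `a²`, but nearly by the Hellinger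
deficit: truncate `(x - s)²` at level `T`, using `z² ≤ T + 4 exp ((z² - T) / 4)`. The bounded part
is handled by `quotient_le_hellinger`, and the excess by the finite Gaussian moment of `exp (z² /
4)`. -/
lemma exists_fisher_le_hellinger : ∃ C > 0, ∀ a ∈ Set.Icc (0 : ℝ) (1 / 2), ∀ s : ℝ, 1 ≤ |s| →
    ∀ T, 0 ≤ T → fisher a s ≤ C * (T * hellinger a s + Real.exp (-(T / 4))) := by
  obtain ⟨c, hc, hcH⟩ := exists_le_hellinger
  set D := ∫ z, Real.exp (z ^ 2 / 4) ∂gaussianReal 0 1 with hD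
  have hD0 : 0 ≤ D := integral_nonneg fun z => (Real.exp_pos _).le
  refine ⟨8 / c + 32 + 4 * D, by positivity, fun a ha s hs T hT => ?_⟩
  have ha' : a ∈ Set.Icc (0 : ℝ) 1 := ⟨ha.1, by linarith [ha.2]⟩
  have hI := integrable_sqrt_sub_one_sq ha' s
  have hH := hcH a ha' s
  rw [min_eq_left (by rw [← sq_abs]; nlinarith), mul_one] at hH
  have hi1 : Integrable (fun x => T * (8 * a ^ 2 + 16 * (√(likRatio a s x) - 1) ^ 2))
      (gaussianReal 0 1) := ((integrable_const _).add (hI.1.const_mul 16)).const_mul T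
  have hi2 : Integrable (fun x => Real.exp (s * x - s ^ 2 / 2) *
      (4 * a * Real.exp (-(T / 4)) * Real.exp ((x - s) ^ 2 / 4))) (gaussianReal 0 1) := by
    refine (integrable_exp_mul_iff_shift s fun x =>
      4 * a * Real.exp (-(T / 4)) * Real.exp ((x - s) ^ 2 / 4)).2 ?_
    simp only [add_sub_cancel_right]
    exact integrable_exp_sq_gaussian.const_mul _
  have hpt : ∀ x, likRatio a s x * score a s x ^ 2 ≤
      T * (8 * a ^ 2 + 16 * (√(likRatio a s x) - 1) ^ 2) + Real.exp (s * x - s ^ 2 / 2) *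
      (4 * a * Real.exp (-(T / 4)) * Real.exp ((x - s) ^ 2 / 4)) := fun x => by
    rw [likRatio_mul_score_sq ha']
    set J := a ^ 2 * Real.exp (s * x - s ^ 2 / 2) ^ 2 / likRatio a s x with hJ
    have hJ0 : 0 ≤ J := by have := likRatio_pos ha' s x; positivity
    have hz : (x - s) ^ 2 ≤ T + 4 * (Real.exp (-(T / 4)) * Real.exp ((x - s) ^ 2 / 4)) := by
      rw [← Real.exp_add]
      have := Real.add_one_le_exp (-(T / 4) + (x - s) ^ 2 / 4)
      linarith
    have j1 := quotient_le_hellinger ha s x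
    have j2 := quotient_le ha' s x
    have hE : 0 ≤ 4 * (Real.exp (-(T / 4)) * Real.exp ((x - s) ^ 2 / 4)) := by positivity
    calc (x - s) ^ 2 * J
        ≤ (T + 4 * (Real.exp (-(T / 4)) * Real.exp ((x - s) ^ 2 / 4))) * J := by gcongr
      _ = T * J + 4 * (Real.exp (-(T / 4)) * Real.exp ((x - s) ^ 2 / 4)) * J := by ring
      _ ≤ T * (8 * a ^ 2 + 16 * (√(likRatio a s x) - 1) ^ 2) +
          4 * (Real.exp (-(T / 4)) * Real.exp ((x - s) ^ 2 / 4)) *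
            (Real.exp (s * x - s ^ 2 / 2) * a) := by gcongr
      _ = _ := by ring
  have h1 := integral_mono (integrable_likRatio_mul_score_sq ha' s) (hi1.add hi2) hpt
  simp only [Pi.add_apply] at h1
  rw [integral_add hi1 hi2, integral_const_mul, integral_add (integrable_const _)
    (hI.1.const_mul 16), integral_const_mul (16 : ℝ), hI.2, integral_exp_mul_eq_shift s fun x =>
      4 * a * Real.exp (-(T / 4)) * Real.exp ((x - s) ^ 2 / 4)] at h1
  simp only [add_sub_cancel_right, integral_const, probReal_univ, smul_eq_mul,
    one_mul] at h1
  rw [integral_const_mul, ← hD] at h1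
  have hh := hellinger_nonneg ha' s
  have he := Real.exp_pos (-(T / 4))
  have k1 : 8 * a ^ 2 ≤ 8 / c * hellinger a s := by
    have : a ^ 2 ≤ hellinger a s / c := by rw [le_div_iff₀ hc]; linarith
    calc 8 * a ^ 2 ≤ 8 * (hellinger a s / c) := by gcongr
      _ = _ := by ring
  have k2 : T * (8 * a ^ 2 + 16 * (2 * hellinger a s)) ≤ (8 / c + 32) * (T * hellinger a s) := by
    nlinarith
  have k3 : 4 * a * Real.exp (-(T / 4)) * D ≤ 4 * D * Real.exp (-(T / 4)) := by
    have : a * (Real.exp (-(T / 4)) * D) ≤ 1 * (Real.exp (-(T / 4)) * D) := by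
      gcongr; exact ha'.2
    linarith
  have k4 : 0 ≤ (8 / c + 32) * Real.exp (-(T / 4)) := by positivity
  have k5 : 0 ≤ 4 * D * (T * hellinger a s) := by positivity
  change fisher a s ≤ _ at h1
  nlinarith

end OneDim

/-! ### A maximal inequality for the likelihood ratio process -/

/-- The law of a standard normal sample. -/
abbrev stdSample (n : ℕ) : Measure (Fin n → ℝ) := Measure.pi fun _ => gaussianReal 0 1

/-- The score of a sample. -/
def sumScore {n : ℕ} (a s : ℝ) (x : Fin n → ℝ) : ℝ := ∑ i, score a s (x i)

section
variable {n : ℕ} {a : ℝ}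

lemma exp_logRatio (ha : a ∈ Set.Icc (0 : ℝ) 1) (s : ℝ) (x : Fin n → ℝ) :
    Real.exp (logRatio a s x) = ∏ i, likRatio a s (x i) := by
  rw [logRatio, Real.exp_sum]
  exact Finset.prod_congr rfl fun i _ => Real.exp_log (likRatio_pos ha _ _)

lemma exp_half_logRatio (ha : a ∈ Set.Icc (0 : ℝ) 1) (s : ℝ) (x : Fin n → ℝ) :
    Real.exp (logRatio a s x / 2) = ∏ i, √(likRatio a s (x i)) := by
  rw [logRatio, Finset.sum_div, Real.exp_sum]
  refine Finset.prod_congr rfl fun i _ => ?_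
  rw [Real.exp_half, Real.exp_log (likRatio_pos ha _ _)]

lemma integrable_exp_half_logRatio (ha : a ∈ Set.Icc (0 : ℝ) 1) (s : ℝ) :
    Integrable (fun x => Real.exp (logRatio a s x / 2)) (stdSample n) ∧
      ∫ x, Real.exp (logRatio a s x / 2) ∂stdSample n = (1 - hellinger a s) ^ n := by
  simp_rw [exp_half_logRatio ha]
  refine ⟨Integrable.fintype_prod fun _ => integrable_sqrt_likRatio ha s, ?_⟩
  rw [integral_fintype_prod_eq_pow fun x => √(likRatio a s x)]
  simp [hellinger]

lemma integrable_exp_logRatio (ha : a ∈ Set.Icc (0 : ℝ) 1) (s : ℝ) :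
    Integrable (fun x => Real.exp (logRatio a s x)) (stdSample n) ∧
      ∫ x, Real.exp (logRatio a s x) ∂stdSample n = 1 := by
  simp_rw [exp_logRatio ha]
  refine ⟨Integrable.fintype_prod fun _ => integrable_likRatio a s, ?_⟩
  rw [integral_fintype_prod_eq_pow (likRatio a s), integral_likRatio, one_pow]

/-- Weighting by `exp L` passes to the mixture law, under which the scores are independent and
centred; the cross terms drop out. -/
lemma integrable_exp_logRatio_mul_sumScore_sq (ha : a ∈ Set.Icc (0 : ℝ) 1) (s : ℝ) :
    Integrable (fun x => Real.exp (logRatio a s x) * sumScore a s x ^ 2) (stdSample n) ∧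
      ∫ x, Real.exp (logRatio a s x) * sumScore a s x ^ 2 ∂stdSample n = n * fisher a s := by
  let F : Fin n → Fin n → Fin n → ℝ → ℝ := fun i k j z =>
    likRatio a s z * ((if j = i then score a s z else 1) * (if j = k then score a s z else 1))
  have e : ∀ x : Fin n → ℝ, Real.exp (logRatio a s x) * sumScore a s x ^ 2 =
      ∑ i, ∑ k, ∏ j, F i k j (x j) := fun x => by
    rw [exp_logRatio ha, sumScore, pow_two, Finset.sum_mul_sum, Finset.mul_sum]
    refine Finset.sum_congr rfl fun i _ => ?_
    rw [Finset.mul_sum]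
    refine Finset.sum_congr rfl fun k _ => ?_
    simp only [F]
    rw [Finset.prod_mul_distrib, Finset.prod_mul_distrib,
      Finset.prod_ite_eq' Finset.univ i fun j => score a s (x j),
      Finset.prod_ite_eq' Finset.univ k fun j => score a s (x j)]
    simp
  have hFi : ∀ i k j, Integrable (F i k j) (gaussianReal 0 1) := fun i k j => by
    by_cases h1 : j = i <;> by_cases h2 : j = k <;> simp only [F, h1, h2, if_true, if_false]
    · subst h1; subst h2; simp only [if_true, ← pow_two]
      exact integrable_likRatio_mul_score_sq ha s
    · subst h1; simp only [h2, if_false, mul_one]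
      exact integrable_likRatio_mul_score ha s
    · subst h2; simp only [h1, if_false, one_mul]
      exact integrable_likRatio_mul_score ha s
    · simpa using integrable_likRatio a s
  have hPi : ∀ i k, Integrable (fun x : Fin n → ℝ => ∏ j, F i k j (x j)) (stdSample n) :=
    fun i k => Integrable.fintype_prod fun j => hFi i k j
  have hval : ∀ i k, ∫ x : Fin n → ℝ, ∏ j, F i k j (x j) ∂stdSample n =
      if i = k then fisher a s else 0 := fun i k => by
    rw [integral_fintype_prod_eq_prod (F i k)]
    split_ifs with hik
    · subst hik
      rw [← Finset.mul_prod_erase _ _ (Finset.mem_univ i)]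
      rw [Finset.prod_eq_one fun j hj => ?_]
      · simp [F, fisher, pow_two]
      · simp [F, Finset.ne_of_mem_erase hj, integral_likRatio]
    · refine Finset.prod_eq_zero (Finset.mem_univ i) ?_
      simp [F, hik, integral_likRatio_mul_score ha]
  simp_rw [e]
  refine ⟨integrable_finsetSum _ fun i _ => integrable_finsetSum _ fun k _ => hPi i k, ?_⟩
  rw [integral_finsetSum _ fun i _ => integrable_finsetSum _ fun k _ => hPi i k]
  simp_rw [integral_finsetSum _ fun k _ => hPi _ k, hval]
  simp

lemma continuous_logRatio (ha : a ∈ Set.Icc (0 : ℝ) 1) :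
    Continuous fun p : ℝ × (Fin n → ℝ) => logRatio a p.1 p.2 := by
  unfold logRatio
  refine continuous_finsetSum _ fun i _ => Continuous.log ?_ fun p => (likRatio_pos ha _ _).ne'
  exact (continuous_likRatio a).comp (by fun_prop : Continuous fun p : ℝ × (Fin n → ℝ) =>
    (p.1, p.2 i))

lemma continuous_sumScore (ha : a ∈ Set.Icc (0 : ℝ) 1) :
    Continuous fun p : ℝ × (Fin n → ℝ) => sumScore a p.1 p.2 := by
  unfold sumScore
  refine continuous_finsetSum _ fun i _ => ?_
  exact (continuous_score ha).comp (by fun_prop : Continuous fun p : ℝ × (Fin n → ℝ) =>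
    (p.1, p.2 i))

/-- Cauchy–Schwarz for `exp (L / 4)` and `exp (L / 2) W`: the first factor contributes `(1 - h) ^ n
≤ exp (-n h)`, the second `U²`. It is carried out as an inequality of arithmetic and geometric means
with the balancing weight `t`. -/
lemma lintegral_exp_mul_le (ha : a ∈ Set.Icc (0 : ℝ) 1) (s : ℝ) {W : (Fin n → ℝ) → ℝ}
    (hi : Integrable (fun x => Real.exp (logRatio a s x) * W x ^ 2) (stdSample n)) {U : ℝ}
    (hU : 0 < U) (h : ∫ x, Real.exp (logRatio a s x) * W x ^ 2 ∂stdSample n ≤ U ^ 2) :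
    ∫⁻ x, ENNReal.ofReal (Real.exp (3 / 4 * logRatio a s x) * W x) ∂stdSample n ≤
      ENNReal.ofReal (U * Real.exp (-(n * hellinger a s / 2))) := by
  set t := U * Real.exp (n * hellinger a s / 2) with ht
  have ht0 : 0 < t := by positivity
  obtain ⟨i1, v1⟩ := integrable_exp_half_logRatio (n := n) ha s
  have hI : Integrable (fun x => t / 2 * Real.exp (logRatio a s x / 2) +
      1 / (2 * t) * (Real.exp (logRatio a s x) * W x ^ 2)) (stdSample n) :=
    (i1.const_mul _).add (hi.const_mul _)
  have hpt : ∀ x, Real.exp (3 / 4 * logRatio a s x) * W x ≤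
      t / 2 * Real.exp (logRatio a s x / 2) +
      1 / (2 * t) * (Real.exp (logRatio a s x) * W x ^ 2) := fun x => by
    have e1 : Real.exp (3 / 4 * logRatio a s x) =
        Real.exp (logRatio a s x / 4) * Real.exp (logRatio a s x / 2) := by
      rw [← Real.exp_add]; congr 1; ring
    have e2 : Real.exp (logRatio a s x / 2) = Real.exp (logRatio a s x / 4) ^ 2 := by
      rw [← Real.exp_nat_mul]; congr 1; push_cast; ring
    have e3 : Real.exp (logRatio a s x) = Real.exp (logRatio a s x / 2) ^ 2 := by
      rw [← Real.exp_nat_mul]; congr 1; push_cast; ring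
    rw [e1, e3, e2]
    set y := Real.exp (logRatio a s x / 4)
    have key : t / 2 * y ^ 2 + 1 / (2 * t) * ((y ^ 2) ^ 2 * W x ^ 2) - y * y ^ 2 * W x =
        1 / (2 * t) * (t * y - y ^ 2 * W x) ^ 2 := by
      field_simp; ring
    have : 0 ≤ 1 / (2 * t) * (t * y - y ^ 2 * W x) ^ 2 := by positivity
    linarith
  calc _ ≤ ∫⁻ x, ENNReal.ofReal (t / 2 * Real.exp (logRatio a s x / 2) +
      1 / (2 * t) * (Real.exp (logRatio a s x) * W x ^ 2)) ∂stdSample n :=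
        lintegral_mono fun x => ENNReal.ofReal_le_ofReal (hpt x)
    _ = ENNReal.ofReal (∫ x, (t / 2 * Real.exp (logRatio a s x / 2) +
      1 / (2 * t) * (Real.exp (logRatio a s x) * W x ^ 2)) ∂stdSample n) := by
        rw [ofReal_integral_eq_lintegral_ofReal hI (ae_of_all _ fun x => by positivity)]
    _ ≤ _ := by
        apply ENNReal.ofReal_le_ofReal
        rw [integral_add (i1.const_mul _) (hi.const_mul _), integral_const_mul, integral_const_mul,
          v1]
        have hh : 0 ≤ 1 - hellinger a s := by
          rw [hellinger, sub_sub_cancel]; exact integral_nonneg fun x => Real.sqrt_nonneg _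
        have h1 : (1 - hellinger a s) ^ n ≤ Real.exp (-(n * hellinger a s)) := by
          have := Real.add_one_le_exp (-hellinger a s)
          calc _ ≤ Real.exp (-hellinger a s) ^ n := pow_le_pow_left₀ hh (by linarith) n
            _ = _ := by rw [← Real.exp_nat_mul]; congr 1; ring
        have e4 : Real.exp (-(n * hellinger a s)) = Real.exp (-(n * hellinger a s / 2)) ^ 2 := by
          rw [← Real.exp_nat_mul]; congr 1; push_cast; ring
        have e5 : Real.exp (n * hellinger a s / 2) = (Real.exp (-(n * hellinger a s / 2)))⁻¹ := by
          rw [Real.exp_neg, inv_inv]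
        have hz := Real.exp_pos (-(n * hellinger a s / 2))
        calc _ ≤ t / 2 * Real.exp (-(n * hellinger a s)) + 1 / (2 * t) * U ^ 2 := by gcongr
          _ = _ := by
            rw [ht, e4, e5]; field_simp; ring

lemma hasDerivAt_likRatio (a s x : ℝ) : HasDerivAt (fun s => likRatio a s x)
    (a * (x - s) * Real.exp (s * x - s ^ 2 / 2)) s := by
  have h1 : HasDerivAt (fun s : ℝ => s * x - s ^ 2 / 2) (x - s) s := by
    have := ((hasDerivAt_id' s).mul_const x).fun_sub (((hasDerivAt_id' s).fun_pow 2).div_const 2)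
    simpa using this
  have := (h1.exp.const_mul a).const_add (1 - a)
  unfold likRatio
  exact this.congr_deriv (by ring)

lemma hasDerivAt_logRatio (ha : a ∈ Set.Icc (0 : ℝ) 1) (s : ℝ) (x : Fin n → ℝ) :
    HasDerivAt (fun s => logRatio a s x) (sumScore a s x) s := by
  unfold logRatio sumScore
  refine HasDerivAt.fun_sum fun i _ => ?_
  exact (hasDerivAt_likRatio a s (x i)).log (likRatio_pos ha _ _).ne'

/-- An integral which dominates `exp (3 L / 4)` on an interval of values of `s`. -/
def supBound (a p A B : ℝ) (x : Fin n → ℝ) : ℝ≥0∞ :=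
  ENNReal.ofReal (Real.exp (3 / 4 * logRatio a p x)) +
    ∫⁻ u in Set.Icc A B, ENNReal.ofReal (Real.exp (3 / 4 * logRatio a u x) * |sumScore a u x|)

/-- By the fundamental theorem of calculus the value at any `s` is at most the value at `p` plus the
integral of the absolute derivative. The factor `3/4` of the derivative is dropped. -/
lemma ofReal_exp_le_supBound (ha : a ∈ Set.Icc (0 : ℝ) 1) {p s A B : ℝ}
    (hp : p ∈ Set.Icc A B) (hs : s ∈ Set.Icc A B) (x : Fin n → ℝ) :
    ENNReal.ofReal (Real.exp (3 / 4 * logRatio a s x)) ≤ supBound a p A B x := by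
  set Λ : ℝ → ℝ := fun s => Real.exp (3 / 4 * logRatio a s x) with hΛ
  set Λ' : ℝ → ℝ := fun s => Real.exp (3 / 4 * logRatio a s x) * (3 / 4 * sumScore a s x)
    with hΛ'
  have hd : ∀ u, HasDerivAt Λ (Λ' u) u := fun u =>
    ((hasDerivAt_logRatio ha u x).const_mul (3 / 4)).exp
  have hL : Continuous fun u => logRatio a u x :=
    (continuous_logRatio ha).comp (by fun_prop : Continuous fun u : ℝ => (u, x))
  have hS : Continuous fun u => sumScore a u x :=
    (continuous_sumScore ha).comp (by fun_prop : Continuous fun u : ℝ => (u, x))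
  have hc : Continuous Λ' := by fun_prop
  have hint := intervalIntegral.integral_eq_sub_of_hasDerivAt (a := p) (b := s)
    (fun u _ => hd u) (hc.intervalIntegrable _ _)
  have h1 : ENNReal.ofReal |Λ s - Λ p| ≤ ∫⁻ u in Set.Icc A B,
      ENNReal.ofReal (Real.exp (3 / 4 * logRatio a u x) * |sumScore a u x|) := by
    rw [← hint, ← Real.norm_eq_abs, intervalIntegral.norm_intervalIntegral_eq, ofReal_norm]
    refine (enorm_integral_le_lintegral_enorm _).trans ?_
    refine (lintegral_mono_set (?_ : Set.uIoc p s ⊆ Set.Icc A B)).trans ?_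
    · exact Set.uIoc_subset_uIcc.trans (Set.uIcc_subset_Icc hp hs)
    · refine lintegral_mono fun u => ?_
      rw [← ofReal_norm, Real.norm_eq_abs, abs_mul, abs_of_pos (Real.exp_pos _), abs_mul]
      apply ENNReal.ofReal_le_ofReal
      gcongr
      have : |(3 : ℝ) / 4| ≤ 1 := by norm_num [abs_le]
      nlinarith [abs_nonneg (sumScore a u x)]
  calc ENNReal.ofReal (Λ s) ≤ ENNReal.ofReal (Λ p + |Λ s - Λ p|) :=
        ENNReal.ofReal_le_ofReal (by linarith [le_abs_self (Λ s - Λ p)])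
    _ ≤ ENNReal.ofReal (Λ p) + ENNReal.ofReal |Λ s - Λ p| := ENNReal.ofReal_add_le
    _ ≤ _ := add_le_add le_rfl h1

lemma measurable_supBound_integrand (ha : a ∈ Set.Icc (0 : ℝ) 1) :
    Measurable fun q : ℝ × (Fin n → ℝ) =>
      ENNReal.ofReal (Real.exp (3 / 4 * logRatio a q.1 q.2) * |sumScore a q.1 q.2|) := by
  have h1 := continuous_logRatio (n := n) ha
  have h2 := continuous_sumScore (n := n) ha
  have : Continuous fun q : ℝ × (Fin n → ℝ) =>
      Real.exp (3 / 4 * logRatio a q.1 q.2) * |sumScore a q.1 q.2| := by fun_prop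
  exact this.measurable.ennreal_ofReal

lemma measurable_exp_logRatio (ha : a ∈ Set.Icc (0 : ℝ) 1) (p : ℝ) :
    Measurable fun x : Fin n → ℝ => ENNReal.ofReal (Real.exp (3 / 4 * logRatio a p x)) := by
  have h1 : Continuous fun x : Fin n → ℝ => logRatio a p x :=
    (continuous_logRatio ha).comp (by fun_prop : Continuous fun x : Fin n → ℝ => (p, x))
  have : Continuous fun x : Fin n → ℝ => Real.exp (3 / 4 * logRatio a p x) := by fun_prop
  exact this.measurable.ennreal_ofReal

lemma measurable_supBound (ha : a ∈ Set.Icc (0 : ℝ) 1) (p A B : ℝ) :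
    Measurable (supBound (n := n) a p A B) :=
  (measurable_exp_logRatio ha p).add (measurable_supBound_integrand ha).lintegral_prod_left'

lemma lintegral_swap_of_measurable {α β : Type*} [MeasurableSpace α] [MeasurableSpace β]
    {G : α → β → ℝ≥0∞} (hG : Measurable fun q : α × β => G q.1 q.2) (μ : Measure α)
    (ν : Measure β) [SFinite μ] [SFinite ν] :
    ∫⁻ y, ∫⁻ x, G x y ∂μ ∂ν = ∫⁻ x, ∫⁻ y, G x y ∂ν ∂μ :=
  (lintegral_lintegral_swap (f := G) hG.aemeasurable).symm

lemma lintegral_supBound_le (ha : a ∈ Set.Icc (0 : ℝ) 1) (p A B : ℝ) {D : ℝ → ℝ≥0∞}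
    (hD : ∀ u ∈ Set.Icc A B, ∫⁻ x, ENNReal.ofReal (Real.exp (3 / 4 * logRatio a u x) *
      |sumScore a u x|) ∂stdSample n ≤ D u) :
    ∫⁻ x, supBound a p A B x ∂stdSample n ≤
      ENNReal.ofReal (Real.exp (-(n * hellinger a p / 2))) + ∫⁻ u in Set.Icc A B, D u := by
  unfold supBound
  rw [lintegral_add_left (measurable_exp_logRatio ha p)]
  refine add_le_add ?_ ?_
  · have := lintegral_exp_mul_le (n := n) ha p (W := fun _ => 1)
      (by simpa using (integrable_exp_logRatio ha p).1) one_pos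
      (by simpa using (integrable_exp_logRatio ha p).2.le)
    simpa using this
  · refine (lintegral_swap_of_measurable (measurable_supBound_integrand ha) _ _).trans_le ?_
    exact setLIntegral_mono' measurableSet_Icc hD

end

lemma sqrt_mul_exp_neg_le {u : ℝ} (hu : 0 ≤ u) : √u * Real.exp (-(u / 4)) ≤ 2 := by
  have h1 : √u ≤ 1 + u / 4 := by
    nlinarith [Real.sq_sqrt hu, sq_nonneg (√u - 2)]
  have h2 := Real.add_one_le_exp (u / 4)
  rw [Real.exp_neg, ← div_eq_mul_inv, div_le_iff₀ (Real.exp_pos _)]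
  linarith [Real.exp_pos (u / 4)]

/-- Bound of the expected derivative of the likelihood ratio process. -/
lemma exists_lintegral_deriv_le : ∃ C > 0, ∃ c > 0, ∀ n : ℕ, 1 ≤ n → ∀ a ∈ Set.Ioc (0 : ℝ) (1 / 2),
    ∀ κ ∈ Set.Icc (0 : ℝ) 1, ∀ u : ℝ, κ ≤ |u| →
    ∫⁻ x, ENNReal.ofReal (Real.exp (3 / 4 * logRatio a u x) * |sumScore a u x|) ∂stdSample n ≤
      ENNReal.ofReal (C * (√n * a) * Real.exp (-(c * n * a ^ 2 * κ ^ 2)) *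
        Real.exp (-(c * n * a ^ 2) * u ^ 2) +
        C * (1 + Real.log n) * Real.exp (-(c * n * a ^ 2))) := by
  obtain ⟨c₀, hc₀, hH⟩ := exists_le_hellinger
  obtain ⟨C₁, hC₁, hF1⟩ := exists_fisher_le
  obtain ⟨C₂, hC₂, hF2⟩ := exists_fisher_le_hellinger
  -- For `|u| ≤ 1` the exponent `c₀ n a² u² / 2` is shared equally between `κ²` and `u²`; for `|u| ≥
  -- 1` half of `n h / 2` is spent on the factor `√(n h)`. Both leave `c₀ / 4`.
  refine ⟨√C₁ + 4 * √C₂, by positivity, c₀ / 4, by positivity, fun n hn a ha κ hκ u hu => ?_⟩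
  have ha' : a ∈ Set.Icc (0 : ℝ) (1 / 2) := ⟨ha.1.le, ha.2⟩
  have ha'' : a ∈ Set.Icc (0 : ℝ) 1 := ⟨ha.1.le, by linarith [ha.2]⟩
  have ha0 := ha.1
  have hn' : (1 : ℝ) ≤ n := by exact_mod_cast hn
  have hn0 : (0 : ℝ) < n := by linarith
  have hlog : 0 ≤ Real.log n := Real.log_nonneg hn'
  have hHu := hH a ha'' u
  have hh0 := hellinger_nonneg ha'' u
  obtain ⟨hI, hv⟩ := integrable_exp_logRatio_mul_sumScore_sq (n := n) ha'' u
  have hI' : Integrable (fun x => Real.exp (logRatio a u x) * |sumScore a u x| ^ 2)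
    (stdSample n) := by simpa only [sq_abs] using hI
  have hv' : ∫ x, Real.exp (logRatio a u x) * |sumScore a u x| ^ 2 ∂stdSample n =
    n * fisher a u := by simpa only [sq_abs] using hv
  have hs1 : 0 < √C₁ := by positivity
  have hs2 : 0 < √C₂ := by positivity
  rcases le_total |u| 1 with h1 | h1
  · have hu2 : min 1 (u ^ 2) = u ^ 2 := min_eq_right (by rw [← sq_abs]; nlinarith [abs_nonneg u])
    rw [hu2] at hHu
    have hF := hF1 a ha' u (abs_le.1 h1)
    have hU : 0 < √C₁ * (√n * a) := by positivity
    refine (lintegral_exp_mul_le ha'' u hI' hU ?_).trans (ENNReal.ofReal_le_ofReal ?_)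
    · rw [hv', mul_pow, mul_pow, Real.sq_sqrt hC₁.le, Real.sq_sqrt hn0.le]
      calc n * fisher a u ≤ n * (C₁ * a ^ 2) := by gcongr
        _ = _ := by ring
    · have hexp : Real.exp (-(n * hellinger a u / 2)) ≤
          Real.exp (-(c₀ / 4 * n * a ^ 2 * κ ^ 2)) * Real.exp (-(c₀ / 4 * n * a ^ 2) * u ^ 2) := by
        rw [← Real.exp_add]
        apply Real.exp_le_exp.2
        have hk : κ ^ 2 ≤ u ^ 2 := by rw [← sq_abs u]; exact pow_le_pow_left₀ hκ.1 hu 2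
        have h2 := mul_le_mul_of_nonneg_left hHu hn0.le
        have h3 : c₀ / 4 * n * a ^ 2 * κ ^ 2 ≤ c₀ / 4 * n * a ^ 2 * u ^ 2 := by gcongr
        nlinarith
      have hz : 0 ≤ (√C₁ + 4 * √C₂) * (1 + Real.log n) * Real.exp (-(c₀ / 4 * n * a ^ 2)) := by
        positivity
      calc √C₁ * (√n * a) * Real.exp (-(n * hellinger a u / 2))
          ≤ (√C₁ + 4 * √C₂) * (√n * a) * (Real.exp (-(c₀ / 4 * n * a ^ 2 * κ ^ 2)) *
            Real.exp (-(c₀ / 4 * n * a ^ 2) * u ^ 2)) := by gcongr; linarith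
        _ ≤ _ := by rw [← mul_assoc]; exact le_add_of_nonneg_right hz
  · have hu2 : min 1 (u ^ 2) = 1 := min_eq_left (by rw [← sq_abs]; nlinarith [abs_nonneg u])
    rw [hu2, mul_one] at hHu
    -- The truncation level `4 log n` makes the tail term equal to `1 / n`, which is harmless after
    -- multiplication by `n`.
    have hF := hF2 a ha' u h1 (4 * Real.log n) (by positivity)
    have he : Real.exp (-(4 * Real.log n / 4)) = 1 / n := by
      rw [mul_div_cancel_left₀ _ (by norm_num), Real.exp_neg, Real.exp_log hn0, one_div]
    rw [he] at hF
    set h := hellinger a u with hh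
    have hU : 0 < √C₂ * (2 * √(Real.log n) * √(n * h) + 1) := by positivity
    refine (lintegral_exp_mul_le ha'' u hI' hU ?_).trans (ENNReal.ofReal_le_ofReal ?_)
    · rw [hv', mul_pow, Real.sq_sqrt hC₂.le]
      have e1 := Real.sq_sqrt hlog
      have e2 := Real.sq_sqrt (show 0 ≤ n * h by positivity)
      have e3 : (2 * √(Real.log n) * √(n * h)) ^ 2 = 4 * Real.log n * (n * h) := by
        rw [mul_pow, mul_pow, e1, e2]; ring
      have e4 : 0 ≤ 2 * √(Real.log n) * √(n * h) := by positivity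
      calc n * fisher a u ≤ n * (C₂ * (4 * Real.log n * h + 1 / n)) := by gcongr
        _ = C₂ * (4 * Real.log n * (n * h) + 1) := by field_simp
        _ ≤ _ := by rw [← e3]; gcongr; nlinarith
    · have hx : 0 ≤ n * h := by positivity
      have h2 := sqrt_mul_exp_neg_le hx
      have e5 : Real.exp (-(n * h / 2)) = Real.exp (-(n * h / 4)) * Real.exp (-(n * h / 4)) := by
        rw [← Real.exp_add]; congr 1; ring
      have e6 : Real.exp (-(n * h / 4)) ≤ Real.exp (-(c₀ / 4 * n * a ^ 2)) := by
        apply Real.exp_le_exp.2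
        have := mul_le_mul_of_nonneg_left hHu hn0.le
        nlinarith
      have e7 : Real.exp (-(n * h / 4)) ≤ 1 := by
        rw [Real.exp_le_one_iff]; linarith
      have e8 : √(Real.log n) ≤ 1 / 2 + Real.log n / 2 := by
        nlinarith [Real.sq_sqrt hlog, sq_nonneg (√(Real.log n) - 1)]
      have e9 : (2 * √(Real.log n) * √(n * h) + 1) * Real.exp (-(n * h / 4)) ≤
          4 * (1 + Real.log n) := by
        have k1 : 2 * √(Real.log n) * (√(n * h) * Real.exp (-(n * h / 4))) ≤
            2 * √(Real.log n) * 2 := by gcongr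
        nlinarith
      have hz : 0 ≤ (√C₁ + 4 * √C₂) * (√n * a) * Real.exp (-(c₀ / 4 * n * a ^ 2 * κ ^ 2)) *
            Real.exp (-(c₀ / 4 * n * a ^ 2) * u ^ 2) := by positivity
      calc √C₂ * (2 * √(Real.log n) * √(n * h) + 1) * Real.exp (-(n * h / 2))
          = √C₂ * ((2 * √(Real.log n) * √(n * h) + 1) * Real.exp (-(n * h / 4))) *
            Real.exp (-(n * h / 4)) := by rw [e5]; ring
        _ ≤ √C₂ * (4 * (1 + Real.log n)) * Real.exp (-(c₀ / 4 * n * a ^ 2)) := by gcongr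
        _ ≤ (√C₁ + 4 * √C₂) * (1 + Real.log n) * Real.exp (-(c₀ / 4 * n * a ^ 2)) := by
          have : √C₂ * (4 * (1 + Real.log n)) ≤ (√C₁ + 4 * √C₂) * (1 + Real.log n) := by
            have h3 : 0 ≤ √C₁ * (1 + Real.log n) := by positivity
            linarith
          gcongr
        _ ≤ _ := le_add_of_nonneg_left hz

/-- The maximal inequality: a bound of the expected supremum of `exp (3 L / 4)` over an interval of
values of `s` at distance at least `κ` from zero. -/
lemma exists_lintegral_supBound_le : ∃ C > 0, ∃ c > 0, ∀ n : ℕ, 1 ≤ n →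
    ∀ a ∈ Set.Ioc (0 : ℝ) (1 / 2), ∀ κ ∈ Set.Icc (0 : ℝ) 1, ∀ p A A' B : ℝ, 0 ≤ B →
    p ∈ Set.Icc A A' → Set.Icc A A' ⊆ Set.Icc (-B) B → (∀ u ∈ Set.Icc A A', κ ≤ |u|) →
    ∫⁻ x, supBound a p A A' x ∂stdSample n ≤
      ENNReal.ofReal (C * Real.exp (-(c * n * a ^ 2 * κ ^ 2)) +
        C * B * (1 + Real.log n) * Real.exp (-(c * n * a ^ 2))) := by
  obtain ⟨c₀, hc₀, hH⟩ := exists_le_hellinger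
  obtain ⟨C, hC, c, hc, hD⟩ := exists_lintegral_deriv_le
  refine ⟨1 + C * √(Real.pi / c) + 2 * C, by positivity, min c (c₀ / 2), by positivity, ?_⟩
  intro n hn a ha κ hκ p A A' B hB hp hsub hκu
  have ha'' : a ∈ Set.Icc (0 : ℝ) 1 := ⟨ha.1.le, by linarith [ha.2]⟩
  have ha0 := ha.1
  have hn' : (1 : ℝ) ≤ n := by exact_mod_cast hn
  have hn0 : (0 : ℝ) < n := by linarith
  have hlog : 0 ≤ Real.log n := Real.log_nonneg hn'
  set m := min c (c₀ / 2) with hm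
  have hmc : m ≤ c := min_le_left _ _
  have hmc₀ : m ≤ c₀ / 2 := min_le_right _ _
  refine (lintegral_supBound_le ha'' p A A' fun u hu => hD n hn a ha κ hκ u (hκu u hu)).trans ?_
  have h1 : Real.exp (-(n * hellinger a p / 2)) ≤ Real.exp (-(m * n * a ^ 2 * κ ^ 2)) := by
    apply Real.exp_le_exp.2
    have hk : κ ^ 2 ≤ min 1 (p ^ 2) := by
      refine le_min (by nlinarith [hκ.1, hκ.2]) ?_
      rw [← sq_abs p]; exact pow_le_pow_left₀ hκ.1 (hκu p hp) 2
    have h2 : c₀ * a ^ 2 * κ ^ 2 ≤ hellinger a p := le_trans (by gcongr) (hH a ha'' p)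
    have h3 : m * n * a ^ 2 * κ ^ 2 ≤ c₀ / 2 * n * a ^ 2 * κ ^ 2 := by gcongr
    have := mul_le_mul_of_nonneg_left h2 hn0.le
    nlinarith
  set b := c * n * a ^ 2 with hb
  have hb0 : 0 < b := by positivity
  set k1 := C * (√n * a) * Real.exp (-(b * κ ^ 2)) with hk1
  set k2 := C * (1 + Real.log n) * Real.exp (-b) with hk2
  have hk10 : 0 ≤ k1 := by positivity
  have hk20 : 0 ≤ k2 := by positivity
  have h2 : ∫⁻ u in Set.Icc A A', ENNReal.ofReal (k1 * Real.exp (-b * u ^ 2) + k2) ≤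
      ENNReal.ofReal (k1 * √(Real.pi / b)) + ENNReal.ofReal (2 * B * k2) := by
    have e : ∀ u, ENNReal.ofReal (k1 * Real.exp (-b * u ^ 2) + k2) =
        ENNReal.ofReal (k1 * Real.exp (-b * u ^ 2)) + ENNReal.ofReal k2 := fun u =>
      ENNReal.ofReal_add (by positivity) hk20
    simp_rw [e]
    rw [lintegral_add_right _ measurable_const]
    refine add_le_add ?_ ?_
    · refine (setLIntegral_le_lintegral _ _).trans (le_of_eq ?_)
      rw [← ofReal_integral_eq_lintegral_ofReal ((integrable_exp_neg_mul_sq hb0).const_mul k1)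
        (ae_of_all _ fun u => by positivity), integral_const_mul, integral_gaussian]
    · rw [setLIntegral_const, mul_comm (2 * B), ENNReal.ofReal_mul hk20]
      gcongr
      refine (measure_mono hsub).trans (le_of_eq ?_)
      rw [Real.volume_Icc]; congr 1; ring
  refine (add_le_add (ENNReal.ofReal_le_ofReal h1) h2).trans ?_
  rw [← ENNReal.ofReal_add (by positivity) (by positivity),
    ← ENNReal.ofReal_add (by positivity) (by positivity)]
  apply ENNReal.ofReal_le_ofReal
  -- The Gaussian integral in `u` has width of order `1 / (√n a)`, which cancels the factor `√n a`
  -- of the derivative bound; the constant is therefore uniform in `n` and `a`.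
  have e1 : k1 * √(Real.pi / b) = C * √(Real.pi / c) * Real.exp (-(b * κ ^ 2)) := by
    have : √(Real.pi / b) = √(Real.pi / c) / (√n * a) := by
      rw [hb, eq_div_iff (by positivity)]
      have e : √(n : ℝ) * a = √(n * a ^ 2) := by
        rw [Real.sqrt_mul hn0.le, Real.sqrt_sq ha0.le]
      rw [e, ← Real.sqrt_mul (by positivity)]; congr 1; field_simp
    rw [this, hk1]; field_simp
  have e2 : Real.exp (-(b * κ ^ 2)) ≤ Real.exp (-(m * n * a ^ 2 * κ ^ 2)) := by
    apply Real.exp_le_exp.2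
    have : m * n * a ^ 2 * κ ^ 2 ≤ c * n * a ^ 2 * κ ^ 2 := by gcongr
    rw [hb]; linarith
  have e3 : Real.exp (-b) ≤ Real.exp (-(m * n * a ^ 2)) := by
    apply Real.exp_le_exp.2
    have : m * n * a ^ 2 ≤ c * n * a ^ 2 := by gcongr
    rw [hb]; linarith
  set E1 := Real.exp (-(m * n * a ^ 2 * κ ^ 2))
  set E2 := Real.exp (-(m * n * a ^ 2))
  have f1 : C * √(Real.pi / c) * Real.exp (-(b * κ ^ 2)) ≤ C * √(Real.pi / c) * E1 := by gcongr
  have f2 : 2 * B * k2 ≤ 2 * B * (C * (1 + Real.log n) * E2) := by rw [hk2]; gcongr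
  have f3 : 0 ≤ C * E1 := by positivity
  have f4 : 0 ≤ (1 + C * √(Real.pi / c)) * (B * (1 + Real.log n) * E2) := by positivity
  rw [e1]
  nlinarith

/-! ### Deterministic expansions on typical samples -/

/-- The difference of the two sides vanishes at `0` and has derivative `z³ / (1 + z)`, which has the
sign of `z`. -/
lemma log_one_add_le_cubic {u : ℝ} (hu : -1 < u) :
    Real.log (1 + u) ≤ u - u ^ 2 / 2 + u ^ 3 / 3 := by
  set g : ℝ → ℝ := fun u => u - u ^ 2 / 2 + u ^ 3 / 3 - Real.log (1 + u) with hg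
  have hd : ∀ z, -1 < z → HasDerivAt g (z ^ 3 / (1 + z)) z := fun z hz => by
    have h0 : 1 + z ≠ 0 := by linarith
    have h1 : HasDerivAt (fun u : ℝ => Real.log (1 + u)) (1 / (1 + z)) z :=
      ((hasDerivAt_id' z).const_add 1).log h0
    have h2 := ((((hasDerivAt_id' z).fun_sub (((hasDerivAt_id' z).fun_pow 2).div_const 2)).fun_add
      (((hasDerivAt_id' z).fun_pow 3).div_const 3)).fun_sub h1)
    refine h2.congr_deriv ?_
    field_simp; push_cast; ring
  suffices 0 ≤ g u by simp only [hg] at this; linarith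
  have g0 : g 0 = 0 := by simp [hg]
  rcases le_total 0 u with h | h
  · have hm : MonotoneOn g (Set.Ici 0) := by
      refine monotoneOn_of_deriv_nonneg (convex_Ici 0) ?_ ?_ ?_
      · exact fun z hz => (hd z (by linarith [Set.mem_Ici.1 hz])).continuousAt.continuousWithinAt
      · intro z hz
        rw [interior_Ici] at hz
        exact (hd z (by linarith [Set.mem_Ioi.1 hz])).differentiableAt.differentiableWithinAt
      · intro z hz
        rw [interior_Ici] at hz
        have hz' := Set.mem_Ioi.1 hz
        rw [(hd z (by linarith)).deriv]; positivity
    rw [← g0]; exact hm (Set.mem_Ici.2 le_rfl) (Set.mem_Ici.2 h) h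
  · have hm : AntitoneOn g (Set.Ioc (-1) 0) := by
      refine antitoneOn_of_deriv_nonpos (convex_Ioc _ _) ?_ ?_ ?_
      · exact fun z hz => (hd z hz.1).continuousAt.continuousWithinAt
      · intro z hz
        exact (hd z (interior_subset hz).1).differentiableAt.differentiableWithinAt
      · intro z hz
        have hz' := interior_subset hz
        rw [(hd z hz'.1).deriv]
        have h3 : z ^ 3 ≤ 0 := by nlinarith [sq_nonneg z, hz'.2]
        exact div_nonpos_of_nonpos_of_nonneg h3 (by linarith [hz'.1])
    rw [← g0]; exact hm ⟨hu, h⟩ ⟨by norm_num, le_rfl⟩ h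

/-- The second order cumulant expansion of a Bernoulli variable of mean `a`, with a remainder
uniform in `a`. -/
lemma log_bernoulli_mgf_le {a θ : ℝ} (ha : a ∈ Set.Icc (0 : ℝ) 1) (hθ : |θ| ≤ 1) :
    Real.log (1 - a + a * Real.exp θ) ≤ a * θ + a * (1 - a) * θ ^ 2 / 2 + 6 * |θ| ^ 3 := by
  have hE := Real.exp_pos θ
  have h1 := Real.exp_bound hθ (n := 3) (by norm_num)
  have h2 := Real.abs_exp_sub_one_sub_id_le hθ
  have hs : ∑ m ∈ Finset.range 3, θ ^ m / (m.factorial : ℝ) = 1 + θ + θ ^ 2 / 2 := by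
    simp [Finset.sum_range_succ, Nat.factorial]
  rw [hs] at h1
  norm_num [Nat.factorial] at h1
  set w := Real.exp θ - 1 with hw
  have hEw : Real.exp θ = 1 + w := by rw [hw]; ring
  rw [hEw] at *
  have hw1 : -1 < w := by linarith
  have hpos : 0 ≤ |θ| := abs_nonneg θ
  have hsq : θ ^ 2 = |θ| ^ 2 := (sq_abs θ).symm
  have haw : -1 < a * w := by
    rcases le_total 0 w with h | h
    · nlinarith [mul_nonneg ha.1 h]
    · nlinarith [ha.1, ha.2]
  have hlog := log_one_add_le_cubic haw
  have e : 1 - a + a * (1 + w) = 1 + a * w := by ring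
  rw [e]
  have r1 : w ≤ θ + θ ^ 2 / 2 + |θ| ^ 3 := by
    have := (abs_le.1 h1).2
    have : 0 ≤ |θ| ^ 3 := by positivity
    linarith
  have b2 := abs_le.1 h2
  have r2 : |w| ≤ 2 * |θ| := by
    have : |θ| ^ 2 ≤ |θ| := by nlinarith
    rw [abs_le]
    constructor <;> nlinarith [neg_abs_le θ, le_abs_self θ]
  have r3 : θ ^ 2 - 3 * |θ| ^ 3 ≤ w ^ 2 := by
    have k1 : |w - θ| ≤ |θ| ^ 2 := by
      rw [← hsq]; exact h2
    have k2 : |w + θ| ≤ 3 * |θ| := (abs_add_le w θ).trans (by linarith)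
    have k3 : |(w - θ) * (w + θ)| ≤ |θ| ^ 2 * (3 * |θ|) := by
      rw [abs_mul]; gcongr
    have := (abs_le.1 k3).1
    nlinarith
  have r4 : (a * w) ^ 3 ≤ 8 * |θ| ^ 3 := by
    have k1 : |a * w| ≤ 2 * |θ| := by
      rw [abs_mul, abs_of_nonneg ha.1]
      calc a * |w| ≤ 1 * |w| := by gcongr; exact ha.2
        _ ≤ _ := by linarith
    calc (a * w) ^ 3 ≤ |(a * w) ^ 3| := le_abs_self _
      _ = |a * w| ^ 3 := abs_pow _ _
      _ ≤ (2 * |θ|) ^ 3 := by gcongr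
      _ = _ := by ring
  have hc : 0 ≤ |θ| ^ 3 := by positivity
  have m1 := mul_le_mul_of_nonneg_left r1 ha.1
  have m2 := mul_le_mul_of_nonneg_left r3 (sq_nonneg a)
  have a2 : a ^ 2 ≤ 1 := by nlinarith [ha.1, ha.2]
  have m3 : a * |θ| ^ 3 ≤ |θ| ^ 3 := by nlinarith [ha.2]
  have m4 : a ^ 2 * |θ| ^ 3 ≤ |θ| ^ 3 := by nlinarith
  nlinarith

/-! ### Deterministic bounds of the log likelihood ratio. -/

section Sample
variable {n : ℕ} {a s : ℝ} {x : Fin n → ℝ}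

/-- The standardized sum of a sample. -/
def sampleXi (x : Fin n → ℝ) : ℝ := (∑ i, x i) / √n

/-- The empirical second moment of a sample. -/
def sampleSq (x : Fin n → ℝ) : ℝ := (∑ i, x i ^ 2) / n

/-- A bound of the sample maximum. -/
def maxBound (n : ℕ) : ℝ := √(8 * Real.log n)

/-- Samples whose maximum, second moment and standardized sum are under control. -/
def Typical (ρ M : ℝ) (x : Fin n → ℝ) : Prop :=
  (∀ i, |x i| ≤ maxBound n) ∧ |sampleSq x - 1| ≤ ρ ∧ |sampleXi x| ≤ M

/-- Bernoulli's inequality `1 + p u ≤ (1 + u) ^ p` with `p = a / a' ≥ 1`, for each observation. It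
carries bounds at one mixing fraction to all larger ones. -/
lemma logRatio_le_mul {a' : ℝ} (ha' : 0 < a') (h : a' ≤ a) (ha : a ≤ 1) (s : ℝ)
    (x : Fin n → ℝ) : logRatio a s x ≤ a / a' * logRatio a' s x := by
  rw [logRatio, logRatio, Finset.mul_sum]
  refine Finset.sum_le_sum fun i _ => ?_
  have hE := Real.exp_pos (s * x i - s ^ 2 / 2)
  have h1 := likRatio_pos (a := a') ⟨ha'.le, h.trans ha⟩ s (x i)
  have h2 := likRatio_pos (a := a) ⟨(ha'.trans_le h).le, ha⟩ s (x i)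
  rw [← Real.log_rpow h1]
  refine Real.log_le_log h2 ?_
  have := one_add_mul_self_le_rpow_one_add (s := a' * (Real.exp (s * x i - s ^ 2 / 2) - 1))
    (by have h3 : a' ≤ 1 := h.trans ha
        nlinarith) (show 1 ≤ a / a' by rw [le_div_iff₀ ha']; linarith)
  have e1 : 1 + a / a' * (a' * (Real.exp (s * x i - s ^ 2 / 2) - 1)) = likRatio a s (x i) := by
    rw [← mul_assoc, div_mul_cancel₀ _ ha'.ne', likRatio]; ring
  have e2 : 1 + a' * (Real.exp (s * x i - s ^ 2 / 2) - 1) = likRatio a' s (x i) := by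
    rw [likRatio]; ring
  rwa [e1, e2] at this

lemma log_likRatio_le (ha : a ∈ Set.Icc (0 : ℝ) 1) (s x : ℝ) :
    Real.log (likRatio a s x) ≤ a * (Real.exp (s * x - s ^ 2 / 2) - 1) := by
  have := Real.log_le_sub_one_of_pos (likRatio_pos ha s x)
  unfold likRatio at *
  linarith

/-- Once `|s|` is four times the sample maximum, `s x ≤ s² / 4` for every observation, so every
likelihood ratio is below one. -/
lemma logRatio_le_of_large (ha : a ∈ Set.Icc (0 : ℝ) 1) {R : ℝ} (hx : ∀ i, |x i| ≤ R)
    (hs : 4 * R ≤ |s|) : logRatio a s x ≤ -(n * (a * (1 - Real.exp (-(s ^ 2 / 4))))) := by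
  have h : ∀ i, Real.log (likRatio a s (x i)) ≤ -(a * (1 - Real.exp (-(s ^ 2 / 4)))) := fun i => by
    refine (log_likRatio_le ha s (x i)).trans ?_
    have h1 : s * x i ≤ s ^ 2 / 4 := by
      calc s * x i ≤ |s * x i| := le_abs_self _
        _ = |s| * |x i| := abs_mul _ _
        _ ≤ |s| * (|s| / 4) := by gcongr; linarith [hx i]
        _ = s ^ 2 / 4 := by rw [← sq_abs s]; ring
    have h2 : Real.exp (s * x i - s ^ 2 / 2) ≤ Real.exp (-(s ^ 2 / 4)) :=
      Real.exp_le_exp.2 (by linarith)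
    have := mul_le_mul_of_nonneg_left h2 ha.1
    linarith
  calc logRatio a s x ≤ ∑ _i : Fin n, -(a * (1 - Real.exp (-(s ^ 2 / 4)))) :=
        Finset.sum_le_sum fun i _ => h i
    _ = _ := by simp

lemma logRatio_nonpos_of_large (ha : a ∈ Set.Icc (0 : ℝ) 1) {R : ℝ} (hx : ∀ i, |x i| ≤ R)
    (hs : 4 * R ≤ |s|) : logRatio a s x ≤ 0 := by
  refine (logRatio_le_of_large ha hx hs).trans ?_
  have : Real.exp (-(s ^ 2 / 4)) ≤ 1 := by rw [Real.exp_le_one_iff]; nlinarith [sq_nonneg s]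
  have h2 : 0 ≤ (n : ℝ) * (a * (1 - Real.exp (-(s ^ 2 / 4)))) :=
    mul_nonneg (by positivity) (mul_nonneg ha.1 (by linarith))
  linarith

lemma logRatio_le_mul_exp (ha : a ∈ Set.Icc (0 : ℝ) 1) {R : ℝ} (hx : ∀ i, |x i| ≤ R) :
    logRatio a s x ≤ n * (a * Real.exp (R ^ 2 / 2)) := by
  have h : ∀ i, Real.log (likRatio a s (x i)) ≤ a * Real.exp (R ^ 2 / 2) := fun i => by
    refine (log_likRatio_le ha s (x i)).trans (mul_le_mul_of_nonneg_left ?_ ha.1)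
    have h1 : x i ^ 2 ≤ R ^ 2 := by rw [← sq_abs]; exact pow_le_pow_left₀ (abs_nonneg _) (hx i) 2
    have h2 : Real.exp (s * x i - s ^ 2 / 2) ≤ Real.exp (R ^ 2 / 2) :=
      Real.exp_le_exp.2 (by nlinarith [sq_nonneg (x i - s)])
    linarith
  calc logRatio a s x ≤ ∑ _i : Fin n, a * Real.exp (R ^ 2 / 2) :=
        Finset.sum_le_sum fun i _ => h i
    _ = _ := by simp

lemma sum_eq_sqrt_mul_sampleXi (hn : n ≠ 0) (x : Fin n → ℝ) : ∑ i, x i = √n * sampleXi x := by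
  have : (0 : ℝ) < √n := by positivity
  rw [sampleXi]; field_simp

lemma sum_sq_eq_mul_sampleSq (hn : n ≠ 0) (x : Fin n → ℝ) :
    ∑ i, x i ^ 2 = n * sampleSq x := by
  have : (0 : ℝ) < n := by positivity
  rw [sampleSq]; field_simp

end Sample

lemma tendsto_maxBound_div_sqrt : Tendsto (fun n : ℕ => maxBound n / √n) atTop (𝓝 0) := by
  have h1 : Tendsto (fun n : ℕ => Real.log n / n) atTop (𝓝 0) := by
    have := Real.isLittleO_log_id_atTop.tendsto_div_nhds_zero
    exact this.comp tendsto_natCast_atTop_atTop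
  have h2 := ((h1.const_mul 8).sqrt)
  rw [mul_zero, Real.sqrt_zero] at h2
  refine h2.congr fun n => ?_
  rw [maxBound, ← Real.sqrt_div' _ (by positivity)]; congr 1; ring

/-- The local expansion of the log likelihood ratio, uniform in the mixing fraction. -/
lemma exists_logRatio_le_local {K M δ : ℝ} (hK : 0 ≤ K) (hδ : 0 < δ) :
    ∃ ρ > 0, ∀ᶠ n : ℕ in atTop, ∀ x : Fin n → ℝ, Typical ρ M x → ∀ a ∈ Set.Icc (0 : ℝ) 1,
      ∀ s : ℝ, |s| ≤ K / √n → logRatio a s x ≤ sampleXi x ^ 2 / 2 + δ := by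
  -- This tolerance for the second moment keeps its effect on `∑ θ i ^ 2`, with `t² ≤ K²`, below `δ
  -- / 4`.
  refine ⟨δ / (4 * (K ^ 2 + 1)), by positivity, ?_⟩
  have hinv : Tendsto (fun n : ℕ => 1 / (n : ℝ)) atTop (𝓝 0) := tendsto_one_div_atTop_nhds_zero_nat
  have hd : Tendsto (fun n : ℕ => K * (maxBound n / √n) + K ^ 2 / 2 * (1 / (n : ℝ))) atTop
      (𝓝 0) := by
    simpa using (tendsto_maxBound_div_sqrt.const_mul K).add (hinv.const_mul (K ^ 2 / 2))
  have he : Tendsto (fun n : ℕ => (K ^ 3 * M + K ^ 4 / 4) * (1 / (n : ℝ))) atTop (𝓝 0) := by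
    simpa using hinv.const_mul (K ^ 3 * M + K ^ 4 / 4)
  have ev1 := hd.eventually_le_const (u := min 1 (δ / (12 * (K ^ 2 + δ)))) (by positivity)
  have ev2 := he.eventually_le_const (u := δ / 4) (by positivity)
  filter_upwards [ev1, ev2, eventually_ge_atTop 1] with n h1 h2 hn x hx a ha s hs
  obtain ⟨hx1, hx2, hx3⟩ := hx
  set d := K * (maxBound n / √n) + K ^ 2 / 2 * (1 / (n : ℝ)) with hdef
  have hn0 : n ≠ 0 := by omega
  have hn' : (1 : ℝ) ≤ n := by exact_mod_cast hn
  have hnp : (0 : ℝ) < n := by linarith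
  have hsn : 0 < √(n : ℝ) := by positivity
  have hsn1 : 1 ≤ √(n : ℝ) := by rw [Real.one_le_sqrt]; exact hn'
  have hsq : √(n : ℝ) ^ 2 = n := Real.sq_sqrt hnp.le
  have hd0 : 0 ≤ d := by have : 0 ≤ maxBound n := Real.sqrt_nonneg _; positivity
  obtain ⟨t, rfl⟩ : ∃ t, s = t / √n := ⟨s * √n, by field_simp⟩
  have ht : |t| ≤ K := by
    rw [abs_div, abs_of_pos hsn] at hs
    exact (div_le_div_iff_of_pos_right hsn).1 hs
  set θ : Fin n → ℝ := fun i => t / √n * x i - (t / √n) ^ 2 / 2 with hθ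
  have hθd : ∀ i, |θ i| ≤ d := fun i => by
    have e : (t / √n) ^ 2 / 2 = t ^ 2 / 2 * (1 / n) := by rw [div_pow, hsq]; ring
    have e0 : |(t / √n) ^ 2 / 2| = (t / √n) ^ 2 / 2 := abs_of_nonneg (by positivity)
    calc |θ i| ≤ |t / √n * x i| + |(t / √n) ^ 2 / 2| := abs_sub _ _
      _ = |t| * (|x i| / √n) + t ^ 2 / 2 * (1 / n) := by
          rw [abs_mul, abs_div, abs_of_pos hsn, e0, e]; ring
      _ ≤ K * (maxBound n / √n) + K ^ 2 / 2 * (1 / n) := by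
          have : t ^ 2 ≤ K ^ 2 := by rw [← sq_abs]; exact pow_le_pow_left₀ (abs_nonneg _) ht 2
          gcongr
          exact hx1 i
  have hpt : ∀ i, Real.log (likRatio a (t / √n) (x i)) ≤
      a * θ i + (a * (1 - a) / 2 + 6 * d) * θ i ^ 2 := fun i => by
    have h3 := log_bernoulli_mgf_le ha ((hθd i).trans (h1.trans (min_le_left _ _)))
    have h4 : |θ i| ^ 3 ≤ d * θ i ^ 2 := by
      rw [← sq_abs]; have := mul_le_mul_of_nonneg_right (hθd i) (sq_nonneg |θ i|)
      nlinarith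
    unfold likRatio
    linarith
  have hsum : logRatio a (t / √n) x ≤ a * ∑ i, θ i +
      (a * (1 - a) / 2 + 6 * d) * ∑ i, θ i ^ 2 := by
    rw [Finset.mul_sum, Finset.mul_sum, ← Finset.sum_add_distrib]
    exact Finset.sum_le_sum fun i _ => hpt i
  have s1 : ∑ i, θ i = t * sampleXi x - t ^ 2 / 2 := by
    simp only [hθ]
    rw [Finset.sum_sub_distrib, ← Finset.mul_sum, sum_eq_sqrt_mul_sampleXi hn0 x]
    simp only [Finset.sum_const, Finset.card_univ, Fintype.card_fin, nsmul_eq_mul, div_pow, hsq]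
    field_simp
  have s2 : ∑ i, θ i ^ 2 = t ^ 2 * sampleSq x - t ^ 3 * sampleXi x * (1 / n)
      + t ^ 4 / 4 * (1 / n) := by
    have e : ∀ i, θ i ^ 2 = t ^ 2 / n * x i ^ 2 - t ^ 3 / (n * √n) * x i + t ^ 4 / (4 * n ^ 2) :=
      fun i => by
        have e3 : √(n : ℝ) ^ 3 = n * √n := by rw [pow_succ, hsq]
        have e4 : √(n : ℝ) ^ 4 = n ^ 2 := by
          rw [show (4 : ℕ) = 2 * 2 from rfl, pow_mul, hsq]
        simp only [hθ]
        have : (t / √n * x i - (t / √n) ^ 2 / 2) ^ 2 = t ^ 2 / √n ^ 2 * x i ^ 2 -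
            t ^ 3 / √n ^ 3 * x i + t ^ 4 / (4 * √n ^ 4) := by field_simp; ring
        rw [this, hsq, e3, e4]
    rw [Finset.sum_congr rfl fun i _ => e i, Finset.sum_add_distrib, Finset.sum_sub_distrib,
      ← Finset.mul_sum, ← Finset.mul_sum, sum_eq_sqrt_mul_sampleXi hn0 x, sum_sq_eq_mul_sampleSq hn0 x]
    simp only [Finset.sum_const, Finset.card_univ, Fintype.card_fin, nsmul_eq_mul]
    field_simp
  have hθ2 : ∑ i, θ i ^ 2 ≤ t ^ 2 + δ / 2 := by
    rw [s2]
    have t2 : t ^ 2 ≤ K ^ 2 := by rw [← sq_abs]; exact pow_le_pow_left₀ (abs_nonneg _) ht 2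
    have k1 : t ^ 2 * (sampleSq x - 1) ≤ δ / 4 := by
      calc t ^ 2 * (sampleSq x - 1) ≤ t ^ 2 * (δ / (4 * (K ^ 2 + 1))) := by
            gcongr; exact (abs_le.1 hx2).2
        _ ≤ (K ^ 2 + 1) * (δ / (4 * (K ^ 2 + 1))) := by gcongr; linarith
        _ = δ / 4 := by field_simp
    have k2 : -(t ^ 3 * sampleXi x) ≤ K ^ 3 * M := by
      calc -(t ^ 3 * sampleXi x) ≤ |t ^ 3 * sampleXi x| := neg_le_abs _
        _ = |t| ^ 3 * |sampleXi x| := by rw [abs_mul, abs_pow]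
        _ ≤ _ := by gcongr
    have k3 : t ^ 4 ≤ K ^ 4 := by
      calc t ^ 4 = (t ^ 2) ^ 2 := by ring
        _ ≤ (K ^ 2) ^ 2 := by gcongr
        _ = _ := by ring
    have k4 : -(t ^ 3 * sampleXi x) * (1 / n) + t ^ 4 / 4 * (1 / n) ≤
        (K ^ 3 * M + K ^ 4 / 4) * (1 / n) := by
      rw [← add_mul]; gcongr
    linarith
  have t2 : t ^ 2 ≤ K ^ 2 := by rw [← sq_abs]; exact pow_le_pow_left₀ (abs_nonneg _) ht 2
  have haa : a * (1 - a) / 2 ≤ 1 := by nlinarith [ha.1, ha.2]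
  have haa0 : 0 ≤ a * (1 - a) / 2 := by
    have := mul_nonneg ha.1 (sub_nonneg.2 ha.2); linarith
  have hd6 : 6 * d * (t ^ 2 + δ / 2) ≤ δ / 2 := by
    calc 6 * d * (t ^ 2 + δ / 2) ≤ 6 * (δ / (12 * (K ^ 2 + δ))) * (K ^ 2 + δ) := by
          gcongr
          · exact h1.trans (min_le_right _ _)
          · linarith
      _ = δ / 2 := by field_simp; norm_num
  have hfin : (a * (1 - a) / 2 + 6 * d) * ∑ i, θ i ^ 2 ≤
      (a * (1 - a) / 2 + 6 * d) * (t ^ 2 + δ / 2) := by gcongr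
  have hhalf : a * (1 - a) / 2 * (δ / 2) ≤ 1 * (δ / 2) := by gcongr
  rw [s1] at hsum
  -- The main terms are `a (t ξ - t² / 2) + a (1 - a) t² / 2 = ξ² / 2 - (a t - ξ)² / 2`; the bound
  -- no longer depends on `a`.
  nlinarith [sq_nonneg (a * t - sampleXi x)]

/-! ### The tilted labels -/

lemma mul_log_add_le {a d : ℝ} (ha : 0 < a) (hd : |d| < a) :
    (a + d) * Real.log (a + d) ≤
      (a + d) * Real.log a + d + d ^ 2 / (2 * a) + |d| ^ 3 / (2 * a ^ 2) := by
  obtain ⟨u, rfl⟩ : ∃ u, d = a * u := ⟨d / a, by field_simp⟩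
  have hu : |u| < 1 := by
    rw [abs_mul, abs_of_pos ha] at hd
    exact (mul_lt_iff_lt_one_right ha).1 hd
  have hu1 := (abs_lt.1 hu).1
  have h1 : 0 < 1 + u := by linarith
  have e : a + a * u = a * (1 + u) := by ring
  have h := mul_le_mul_of_nonneg_left (log_one_add_le_cubic hu1) h1.le
  rw [e, Real.log_mul ha.ne' h1.ne', abs_mul, abs_of_pos ha]
  have e2 : a * (1 + u) * Real.log a + a * u + (a * u) ^ 2 / (2 * a) +
      (a * |u|) ^ 3 / (2 * a ^ 2) =
      a * ((1 + u) * Real.log a + u + u ^ 2 / 2 + |u| ^ 3 / 2) := by field_simp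
  rw [e2, mul_assoc]
  refine mul_le_mul_of_nonneg_left ?_ ha.le
  have c1 : -(u ^ 3) ≤ |u| ^ 3 := by rw [← abs_pow]; exact neg_le_abs _
  have c2 : u ^ 4 ≤ |u| ^ 3 := by
    have : u ^ 4 = |u| ^ 3 * |u| := by
      rw [← pow_succ, Even.pow_abs ⟨2, rfl⟩]
    rw [this]; exact mul_le_of_le_one_right (by positivity) hu.le
  nlinarith

lemma neg_binEntropy_add_le {a d : ℝ} (ha : a ∈ Set.Ioo (0 : ℝ) 1) (h1 : |d| < a)
    (h2 : |d| < 1 - a) :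
    -Real.binEntropy (a + d) ≤ -Real.binEntropy a + d * (Real.log a - Real.log (1 - a)) +
      d ^ 2 * (1 / (2 * a * (1 - a)) + (1 / (2 * a ^ 2) + 1 / (2 * (1 - a) ^ 2)) * |d|) := by
  have ha0 := ha.1
  have ha1 : 0 < 1 - a := by linarith [ha.2]
  have k1 := mul_log_add_le ha0 h1
  have k2 := mul_log_add_le ha1 (d := -d) (by rwa [abs_neg])
  have e : |d| ^ 3 = d ^ 2 * |d| := by rw [← sq_abs]; ring
  rw [abs_neg, neg_sq, e] at k2
  rw [e] at k1
  simp only [Real.binEntropy, Real.log_inv]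
  have e2 : 1 - (a + d) = 1 - a + -d := by ring
  have e3 : d ^ 2 * (1 / (2 * a * (1 - a)) + (1 / (2 * a ^ 2) + 1 / (2 * (1 - a) ^ 2)) * |d|)
      = d ^ 2 / (2 * a) + d ^ 2 / (2 * (1 - a)) + d ^ 2 * |d| / (2 * a ^ 2) +
        d ^ 2 * |d| / (2 * (1 - a) ^ 2) := by field_simp; ring
  rw [e2, e3]
  linarith

/-- The tilt of the uniform labels `a` along a sample. -/
def tiltedLabels {n : ℕ} (a : ℝ) (x : Fin n → ℝ) (i : Fin n) : ℝ :=
  a + (1 - a) * sampleXi x * (x i - sampleXi x / √n) / √n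

/-! ### Moments of the tilt. -/

section Sums
variable {n : ℕ}

lemma sum_tilt (hn : n ≠ 0) (a : ℝ) (x : Fin n → ℝ) :
    ∑ i, (1 - a) * sampleXi x * (x i - sampleXi x / √n) / √n = 0 := by
  have hsn : 0 < √(n : ℝ) := by positivity
  have hsq : √(n : ℝ) ^ 2 = n := Real.sq_sqrt (by positivity)
  rw [← Finset.sum_div, ← Finset.mul_sum, Finset.sum_sub_distrib, sum_eq_sqrt_mul_sampleXi hn x]
  simp only [Finset.sum_const, Finset.card_univ, Fintype.card_fin, nsmul_eq_mul]
  nth_rw 2 [← hsq]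
  field_simp; ring

lemma sum_tilt_sq (hn : n ≠ 0) (a : ℝ) (x : Fin n → ℝ) :
    ∑ i, ((1 - a) * sampleXi x * (x i - sampleXi x / √n) / √n) ^ 2 =
    (1 - a) ^ 2 * sampleXi x ^ 2 * (sampleSq x - sampleXi x ^ 2 / n) := by
  have hsn : 0 < √(n : ℝ) := by positivity
  have hnp : (0 : ℝ) < n := by positivity
  have hsq : √(n : ℝ) ^ 2 = n := Real.sq_sqrt (by positivity)
  have e : ∀ i, ((1 - a) * sampleXi x * (x i - sampleXi x / √n) / √n) ^ 2 =
      ((1 - a) * sampleXi x) ^ 2 / n * (x i ^ 2 - 2 * sampleXi x / √n * x i + sampleXi x ^ 2 / n) :=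
    fun i => by rw [div_pow, hsq, mul_pow, sub_sq, div_pow, hsq]; ring
  rw [Finset.sum_congr rfl fun i _ => e i, ← Finset.mul_sum, Finset.sum_add_distrib,
    Finset.sum_sub_distrib, ← Finset.mul_sum, sum_eq_sqrt_mul_sampleXi hn x,
    sum_sq_eq_mul_sampleSq hn x]
  simp only [Finset.sum_const, Finset.card_univ, Fintype.card_fin, nsmul_eq_mul]
  field_simp; ring

lemma sum_mul_tiltedLabels (hn : n ≠ 0) (a : ℝ) (x : Fin n → ℝ) :
    ∑ i, x i * tiltedLabels a x i =
    √n * sampleXi x * (a + (1 - a) * (sampleSq x - sampleXi x ^ 2 / n)) := by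
  have hsn : 0 < √(n : ℝ) := by positivity
  have hnp : (0 : ℝ) < n := by positivity
  have hsq : √(n : ℝ) ^ 2 = n := Real.sq_sqrt (by positivity)
  have e : ∀ i, x i * tiltedLabels a x i = a * x i +
      (1 - a) * sampleXi x / √n * (x i ^ 2 - sampleXi x / √n * x i) :=
    fun i => by rw [tiltedLabels]; field_simp
  rw [Finset.sum_congr rfl fun i _ => e i, Finset.sum_add_distrib, ← Finset.mul_sum,
    ← Finset.mul_sum, Finset.sum_sub_distrib, ← Finset.mul_sum, sum_eq_sqrt_mul_sampleXi hn x,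
    sum_sq_eq_mul_sampleSq hn x]
  have : (n : ℝ) = √n * √n := by rw [← sq, hsq]
  field_simp
  rw [hsq]; ring

end Sums

/-- The energy of the tilted labels, up to the profile energy and in units of `sampleXi x ^ 2`. -/
def tiltFactor (a : ℝ) (w : ℝ × ℝ × ℝ) : ℝ :=
  (1 - a) ^ 2 * w.1 * (1 / (2 * a * (1 - a)) + w.2.1) -
    (a + (1 - a) * w.1) ^ 2 / (2 * (a + w.2.2))

/-- The tilt is centred by the sample mean, so it preserves the mixing fraction exactly and the
first order change of the entropy vanishes. What is left is the quadratic entropy cost and the data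
term. The tilt itself is the linearized label posterior `a (1 - a) β x i` at shift `β = ξ / (a √n)`.
-/
lemma labelEnergy_tiltedLabels_le (φ : ℝ) {v : ℝ≥0} (hv : 0 < v) {n : ℕ} (hn : n ≠ 0) {a d : ℝ}
    (ha : a ∈ Set.Ioo (0 : ℝ) 1) {x : Fin n → ℝ}
    (hd : ∀ i, |(1 - a) * sampleXi x * (x i - sampleXi x / √n) / √n| ≤ d)
    (hda : d < a) (hda' : d < 1 - a) :
    tiltedLabels a x ∈ cube n ∧ ∑ i, tiltedLabels a x i = a * n ∧
      labelEnergy φ v x (tiltedLabels a x) ≤ profileEnergy φ v n a + sampleXi x ^ 2 *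
        tiltFactor a (sampleSq x - sampleXi x ^ 2 / n,
          (1 / (2 * a ^ 2) + 1 / (2 * (1 - a) ^ 2)) * d, 1 / (v * n)) := by
  have hs : ∑ i, tiltedLabels a x i = a * n := by
    simp only [tiltedLabels]
    rw [Finset.sum_add_distrib, sum_tilt hn]
    simp [mul_comm]
  refine ⟨mem_cube.2 fun i => ?_, hs, ?_⟩
  · have := abs_le.1 (hd i)
    simp only [tiltedLabels]
    constructor <;> linarith
  · have ha1 : 0 < 1 - a := by linarith [ha.2]
    have ha0 := ha.1
    have hnp : (0 : ℝ) < n := by positivity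
    have hvp : (0 : ℝ) < v := by exact_mod_cast hv
    have hsq : √(n : ℝ) ^ 2 = n := Real.sq_sqrt (by positivity)
    set C := 1 / (2 * a ^ 2) + 1 / (2 * (1 - a) ^ 2) with hC
    have hC0 : 0 ≤ C := by positivity
    have hpt : ∀ i, -Real.binEntropy (tiltedLabels a x i) ≤ -Real.binEntropy a +
        (1 - a) * sampleXi x * (x i - sampleXi x / √n) / √n * (Real.log a - Real.log (1 - a)) +
        ((1 - a) * sampleXi x * (x i - sampleXi x / √n) / √n) ^ 2 *
          (1 / (2 * a * (1 - a)) + C * d) := fun i => by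
      refine (neg_binEntropy_add_le ha ((hd i).trans_lt hda) ((hd i).trans_lt hda')).trans ?_
      gcongr
      exact hd i
    have hsum := Finset.sum_le_sum fun i (_ : i ∈ Finset.univ) => hpt i
    rw [Finset.sum_add_distrib, Finset.sum_add_distrib, ← Finset.sum_mul, ← Finset.sum_mul,
      sum_tilt hn, sum_tilt_sq hn, Finset.sum_neg_distrib] at hsum
    simp only [Finset.sum_const, Finset.card_univ, Fintype.card_fin, nsmul_eq_mul] at hsum
    rw [labelEnergy, hs, sum_mul_tiltedLabels hn, profileEnergy, tiltFactor]
    have e : (v : ℝ) / (1 + v * (a * n)) *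
        (√n * sampleXi x * (a + (1 - a) * (sampleSq x - sampleXi x ^ 2 / n))) ^ 2 / 2 =
        sampleXi x ^ 2 * ((a + (1 - a) * (sampleSq x - sampleXi x ^ 2 / n)) ^ 2 /
          (2 * (a + 1 / (v * n)))) := by
      generalize a + (1 - a) * (sampleSq x - sampleXi x ^ 2 / n) = y
      rw [mul_pow, mul_pow, hsq]
      have : a + 1 / (v * n) = (1 + v * (a * n)) / (v * n) := by field_simp; ring
      rw [this]
      have : 0 < 1 + v * (a * n) := by positivity
      field_simp
    rw [e]
    linarith

/-- At the limiting arguments the factor is `(1 - a) / (2 a) - 1 / (2 a) = -1/2`; continuity does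
the rest. -/
lemma exists_tiltFactor_le {a δ : ℝ} (ha : a ∈ Set.Ioo (0 : ℝ) 1) (hδ : 0 < δ) :
    ∃ ε > 0, ∀ w₁ w₂ w₃ : ℝ, |w₁ - 1| < ε → |w₂| < ε → |w₃| < ε →
      tiltFactor a (w₁, w₂, w₃) ≤ -(1 / 2) + δ := by
  have ha0 := ha.1
  have ha1 : 0 < 1 - a := by linarith [ha.2]
  have hc : ContinuousAt (tiltFactor a) (1, 0, 0) := by
    unfold tiltFactor
    refine ContinuousAt.sub (by fun_prop) (ContinuousAt.div (by fun_prop) (by fun_prop) ?_)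
    simpa using ha0.ne'
  have h1 : tiltFactor a (1, 0, 0) = -(1 / 2) := by
    simp only [tiltFactor]; field_simp; ring
  obtain ⟨ε, hε, h⟩ := Metric.continuousAt_iff.1 hc δ hδ
  refine ⟨ε, hε, fun w₁ w₂ w₃ k1 k2 k3 => ?_⟩
  have := h (x := (w₁, w₂, w₃)) (by
    simp only [Prod.dist_eq, Real.dist_eq, sub_zero]
    exact max_lt k1 (max_lt k2 k3))
  rw [h1, Real.dist_eq] at this
  linarith [(abs_lt.1 this).2]

/-- The energy at a prescribed mixing fraction is at most its limiting expansion. -/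
lemma exists_labelEnergy_le {φ : ℝ} (hφ : 0 < φ) {v : ℝ≥0} (hv : 0 < v) {a M δ : ℝ}
    (ha : a ∈ Set.Ioo (0 : ℝ) 1) (hM : 0 ≤ M) (hδ : 0 < δ) :
    ∃ ρ > 0, ∀ᶠ n : ℕ in atTop, ∀ x : Fin n → ℝ, Typical ρ M x →
      ∃ m ∈ cube n, ∑ i, m i = a * n ∧ labelEnergy φ v x m ≤
        Real.log n + profileConst φ v a - sampleXi x ^ 2 / 2 + δ := by
  have ha0 := ha.1
  have ha1 : 0 < 1 - a := by linarith [ha.2]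
  have hvp : (0 : ℝ) < v := by exact_mod_cast hv
  obtain ⟨ε, hε, htilt⟩ := exists_tiltFactor_le ha (δ := δ / (2 * (M ^ 2 + 1))) (by positivity)
  refine ⟨ε / 2, by positivity, ?_⟩
  set C := 1 / (2 * a ^ 2) + 1 / (2 * (1 - a) ^ 2) with hC
  have hinv : Tendsto (fun n : ℕ => 1 / (n : ℝ)) atTop (𝓝 0) := tendsto_one_div_atTop_nhds_zero_nat
  have hinvs : Tendsto (fun n : ℕ => 1 / √(n : ℝ)) atTop (𝓝 0) := by
    simpa [Real.sqrt_div'] using hinv.sqrt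
  have hd : Tendsto (fun n : ℕ => M * (maxBound n / √n) + M ^ 2 * (1 / √n)) atTop (𝓝 0) := by
    simpa using (tendsto_maxBound_div_sqrt.const_mul M).add (hinvs.const_mul (M ^ 2))
  have hCd : Tendsto (fun n : ℕ => C * (M * (maxBound n / √n) + M ^ 2 * (1 / √n))) atTop (𝓝 0) := by
    simpa using hd.const_mul C
  have hMn : Tendsto (fun n : ℕ => M ^ 2 * (1 / (n : ℝ))) atTop (𝓝 0) := by
    simpa using hinv.const_mul (M ^ 2)
  have hvn : Tendsto (fun n : ℕ => 1 / (v : ℝ) * (1 / (n : ℝ))) atTop (𝓝 0) := by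
    simpa using hinv.const_mul (1 / (v : ℝ))
  filter_upwards [hd.eventually_lt_const ha0, hd.eventually_lt_const ha1,
    hCd.eventually_lt_const hε, hMn.eventually_lt_const (half_pos hε), hvn.eventually_lt_const hε,
    eventually_abs_profileEnergy_sub_le hφ hv (a := min a (1 - a)) (by positivity) (half_pos hδ),
    eventually_ge_atTop 1] with n h1 h2 h3 h4 h5 h6 hn x hx
  obtain ⟨hx1, hx2, hx3⟩ := hx
  have hn0 : n ≠ 0 := by omega
  have hn' : (1 : ℝ) ≤ n := by exact_mod_cast hn
  have hnp : (0 : ℝ) < n := by linarith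
  have hsn : 0 < √(n : ℝ) := by positivity
  have hsn1 : 1 ≤ √(n : ℝ) := by rw [Real.one_le_sqrt]; exact hn'
  have hξ2 : sampleXi x ^ 2 ≤ M ^ 2 := by
    rw [← sq_abs]; exact pow_le_pow_left₀ (abs_nonneg _) hx3 2
  set d := M * (maxBound n / √n) + M ^ 2 * (1 / √n) with hdd
  have hd0 : 0 ≤ d := by have : 0 ≤ maxBound n := Real.sqrt_nonneg _; positivity
  have hxd : ∀ i, |(1 - a) * sampleXi x * (x i - sampleXi x / √n) / √n| ≤ d := fun i => by
    have k : |x i - sampleXi x / √n| ≤ maxBound n + M := by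
      refine (abs_sub _ _).trans (add_le_add (hx1 i) ?_)
      rw [abs_div, abs_of_pos hsn]
      exact (div_le_self (abs_nonneg _) hsn1).trans hx3
    rw [abs_div, abs_mul, abs_mul, abs_of_pos hsn, abs_of_pos ha1]
    calc (1 - a) * |sampleXi x| * |x i - sampleXi x / √n| / √n
        ≤ 1 * M * (maxBound n + M) / √n := by gcongr; linarith
      _ = d := by rw [hdd]; ring
  obtain ⟨hm, hs, hE⟩ := labelEnergy_tiltedLabels_le φ hv hn0 ha hxd h1 h2
  refine ⟨_, hm, hs, hE.trans ?_⟩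
  have hV : |sampleSq x - sampleXi x ^ 2 / n - 1| < ε := by
    have : sampleXi x ^ 2 / n ≤ M ^ 2 * (1 / n) := by rw [div_eq_mul_one_div]; gcongr
    have k0 : 0 ≤ sampleXi x ^ 2 / n := by positivity
    have := abs_le.1 hx2
    rw [abs_lt]; constructor <;> linarith
  have hC0 : 0 ≤ C := by positivity
  have hT := htilt _ (C * d) (1 / (v * n)) hV (by rwa [abs_of_nonneg (by positivity)])
    (by rw [abs_of_nonneg (by positivity), ← one_div_mul_one_div]; exact h5)
  have hP := (abs_le.1 (h6 a ⟨min_le_left _ _, by linarith [min_le_right a (1 - a)]⟩)).2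
  have hm1 := mul_le_mul_of_nonneg_left hT (sq_nonneg (sampleXi x))
  have hm2 : sampleXi x ^ 2 * (δ / (2 * (M ^ 2 + 1))) ≤ δ / 2 := by
    calc sampleXi x ^ 2 * (δ / (2 * (M ^ 2 + 1))) ≤ (M ^ 2 + 1) * (δ / (2 * (M ^ 2 + 1))) := by
          gcongr; linarith
      _ = δ / 2 := by field_simp
  linarith

/-! ### Uniform bounds of the log likelihood ratio in probability -/

lemma maxBound_nonneg (n : ℕ) : 0 ≤ maxBound n := Real.sqrt_nonneg _

lemma sq_maxBound {n : ℕ} (hn : 1 ≤ n) : maxBound n ^ 2 = 8 * Real.log n :=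
  Real.sq_sqrt (by have := Real.log_nonneg (x := n) (by exact_mod_cast hn); positivity)

lemma tendsto_maxBound_mul_rpow_neg {κ : ℝ} (hκ : 0 < κ) :
    Tendsto (fun n : ℕ => 4 * maxBound n * (1 + Real.log n) * (n : ℝ) ^ (-κ)) atTop (𝓝 0) := by
  have h1 : Tendsto (fun n : ℕ => 32 * (1 + 1 / (κ / 4)) ^ 2 * (n : ℝ) ^ (-(κ / 2))) atTop
      (𝓝 0) := by
    simpa using ((tendsto_rpow_neg_atTop (half_pos hκ)).comp
      tendsto_natCast_atTop_atTop).const_mul (32 * (1 + 1 / (κ / 4)) ^ 2)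
  refine squeeze_zero' ?_ ?_ h1
  · filter_upwards [eventually_ge_atTop 1] with n hn
    have := Real.log_nonneg (x := n) (by exact_mod_cast hn)
    have := maxBound_nonneg n
    positivity
  · filter_upwards [eventually_ge_atTop 1] with n hn
    have hn' : (1 : ℝ) ≤ n := by exact_mod_cast hn
    have hnp : (0 : ℝ) < n := by linarith
    have hl := Real.log_nonneg hn'
    have hb : maxBound n ≤ 8 * (1 + Real.log n) := by
      refine Real.sqrt_le_iff.2 ⟨by positivity, by nlinarith⟩
    have hlog : 1 + Real.log n ≤ (1 + 1 / (κ / 4)) * (n : ℝ) ^ (κ / 4) := by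
      have k1 := Real.log_le_rpow_div hnp.le (ε := κ / 4) (by positivity)
      have k2 : 1 ≤ (n : ℝ) ^ (κ / 4) := Real.one_le_rpow hn' (by positivity)
      rw [add_mul, one_div, inv_mul_eq_div]; linarith
    calc 4 * maxBound n * (1 + Real.log n) * (n : ℝ) ^ (-κ)
        ≤ 4 * (8 * (1 + Real.log n)) * (1 + Real.log n) * (n : ℝ) ^ (-κ) := by gcongr
      _ = 32 * (1 + Real.log n) ^ 2 * (n : ℝ) ^ (-κ) := by ring
      _ ≤ 32 * ((1 + 1 / (κ / 4)) * (n : ℝ) ^ (κ / 4)) ^ 2 * (n : ℝ) ^ (-κ) := by gcongr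
      _ = 32 * (1 + 1 / (κ / 4)) ^ 2 * ((n : ℝ) ^ (κ / 4 + κ / 4) * (n : ℝ) ^ (-κ)) := by
          rw [Real.rpow_add hnp]; ring
      _ = _ := by rw [← Real.rpow_add hnp]; congr 2; ring

lemma tendsto_maxBound_mul_exp_neg {c : ℝ} (hc : 0 < c) :
    Tendsto (fun n : ℕ => 4 * maxBound n * (1 + Real.log n) * Real.exp (-(c * n))) atTop
      (𝓝 0) := by
  have h1 := (tendsto_rpow_mul_exp_neg_mul_atTop_nhds_zero 1 c hc).comp tendsto_natCast_atTop_atTop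
  have h2 := (tendsto_maxBound_mul_rpow_neg one_pos).mul h1
  rw [mul_zero] at h2
  refine h2.congr' ?_
  filter_upwards [eventually_ge_atTop 1] with n hn
  have hnp : (0 : ℝ) < n := by exact_mod_cast hn
  simp only [Function.comp, Real.rpow_one, Real.rpow_neg_one, neg_mul]
  field_simp

/-- Split at `a = n ^ (-1/4)`. Above it `n a² ≥ √n`, and the exponential beats every power of `n`;
below it the power of `2 a + 1 / n` is at most `3 n ^ (-γ/4)`. Either gain absorbs the logarithmic
factors. -/
lemma eventually_maxBound_mul_exp_mul_rpow_le {c γ : ℝ} (hc : 0 < c) (hγ : 0 < γ) (hγ1 : γ ≤ 1) :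
    ∀ᶠ n : ℕ in atTop, ∀ a ∈ Set.Ioc (0 : ℝ) (1 / 2),
      4 * maxBound n * (1 + Real.log n) * Real.exp (-(c * n * a ^ 2)) * (2 * a + 1 / n) ^ γ
        ≤ 1 := by
  have h1 := (tendsto_maxBound_mul_rpow_neg (κ := γ / 4) (by positivity)).const_mul 3
  rw [mul_zero] at h1
  have h2 := (tendsto_rpow_mul_exp_neg_mul_atTop_nhds_zero 2 c hc).comp
    (Real.tendsto_sqrt_atTop.comp tendsto_natCast_atTop_atTop)
  filter_upwards [h1.eventually_le_const one_pos, h2.eventually_le_const one_pos,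
    eventually_ge_atTop 1] with n k1 k2 hn a ha
  have hn' : (1 : ℝ) ≤ n := by exact_mod_cast hn
  have hnp : (0 : ℝ) < n := by linarith
  have hl := Real.log_nonneg hn'
  have hb := maxBound_nonneg n
  have ha0 := ha.1
  have hninv : 1 / (n : ℝ) ≤ 1 := by rw [div_le_one hnp]; exact hn'
  refine le_trans ?_ k1
  have key : Real.exp (-(c * n * a ^ 2)) * (2 * a + 1 / n) ^ γ ≤ 3 * (n : ℝ) ^ (-(γ / 4)) := by
    have three : (3 : ℝ) ^ γ ≤ 3 := by
      simpa using Real.rpow_le_rpow_of_exponent_le (x := 3) (by norm_num) hγ1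
    rcases le_total ((n : ℝ) ^ (-(1 / 4) : ℝ)) a with h | h
    · have e1 : √(n : ℝ) ≤ n * a ^ 2 := by
        have : (n : ℝ) ^ (-(1 / 4) : ℝ) * (n : ℝ) ^ (-(1 / 4) : ℝ) ≤ a ^ 2 := by
          rw [sq]; gcongr
        rw [← Real.rpow_add hnp] at this
        calc √(n : ℝ) = n * (n : ℝ) ^ (-(1 / 4) + -(1 / 4) : ℝ) := by
              rw [Real.sqrt_eq_rpow]
              nth_rw 2 [← Real.rpow_one (n : ℝ)]
              rw [← Real.rpow_add hnp]; norm_num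
          _ ≤ _ := by gcongr
      have e2 : Real.exp (-(c * n * a ^ 2)) ≤ (n : ℝ) ^ (-(γ / 4)) := by
        calc Real.exp (-(c * n * a ^ 2)) ≤ Real.exp (-c * √n) := by
              apply Real.exp_le_exp.2; nlinarith
          _ ≤ (n : ℝ) ^ (-1 : ℝ) := by
              simp only [Function.comp, Real.rpow_two, Real.sq_sqrt hnp.le] at k2
              rw [Real.rpow_neg_one, le_inv_comm₀ (Real.exp_pos _) hnp]
              rw [le_inv_comm₀ hnp (Real.exp_pos _)] at *
              rw [← one_div, le_div_iff₀ hnp]; linarith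
          _ ≤ _ := Real.rpow_le_rpow_of_exponent_le hn' (by linarith)
      have e3 : (2 * a + 1 / n) ^ γ ≤ 3 := by
        refine le_trans ?_ three
        have := ha.2
        gcongr; linarith
      calc _ ≤ (n : ℝ) ^ (-(γ / 4)) * 3 := by gcongr
        _ = _ := mul_comm _ _
    · have e1 : 1 / (n : ℝ) ≤ (n : ℝ) ^ (-(1 / 4) : ℝ) := by
        rw [one_div, ← Real.rpow_neg_one]
        exact Real.rpow_le_rpow_of_exponent_le hn' (by norm_num)
      have e2 : (2 * a + 1 / n) ^ γ ≤ 3 * (n : ℝ) ^ (-(γ / 4)) := by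
        calc (2 * a + 1 / n) ^ γ ≤ (3 * (n : ℝ) ^ (-(1 / 4) : ℝ)) ^ γ := by gcongr; linarith
          _ = 3 ^ γ * (n : ℝ) ^ (-(γ / 4)) := by
              rw [Real.mul_rpow (by norm_num) (by positivity), ← Real.rpow_mul hnp.le]
              congr 2; ring
          _ ≤ _ := by gcongr
      have e3 : Real.exp (-(c * n * a ^ 2)) ≤ 1 := by
        rw [Real.exp_le_one_iff]
        have : 0 ≤ c * n * a ^ 2 := by positivity
        linarith
      calc _ ≤ 1 * (3 * (n : ℝ) ^ (-(γ / 4))) := by gcongr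
        _ = _ := one_mul _
  calc _ = 4 * maxBound n * (1 + Real.log n) *
        (Real.exp (-(c * n * a ^ 2)) * (2 * a + 1 / n) ^ γ) := by ring
    _ ≤ 4 * maxBound n * (1 + Real.log n) * (3 * (n : ℝ) ^ (-(γ / 4))) := by gcongr
    _ = _ := by ring

/-- Away from the origin, the log likelihood ratio is below any prescribed level. -/
lemma exists_measure_logRatio_gt_le {a t ε : ℝ} (ha : a ∈ Set.Ioc (0 : ℝ) (1 / 2)) (hε : 0 < ε) :
    ∃ K > 0, ∀ᶠ n : ℕ in atTop, stdSample n {x | (∀ i, |x i| ≤ maxBound n) ∧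
      ∃ s : ℝ, K / √n ≤ |s| ∧ -t < logRatio a s x} ≤ ENNReal.ofReal ε := by
  obtain ⟨C, hC, c, hc, hmom⟩ := exists_lintegral_supBound_le
  have ha0 := ha.1
  have hexp : Tendsto (fun K : ℝ => 2 * Real.exp (3 / 4 * t) * (C * Real.exp (-(c * a ^ 2) * K)))
      atTop (𝓝 0) := by
    have h := (tendsto_rpow_mul_exp_neg_mul_atTop_nhds_zero 0 (c * a ^ 2) (by positivity))
    simp only [Real.rpow_zero, one_mul] at h
    simpa using (h.const_mul C).const_mul (2 * Real.exp (3 / 4 * t))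
  -- At `κ = K / √n` the maximal inequality decays like `exp (-c a² K²)`; `K ≥ 1` allows replacing
  -- `K²` by `K`.
  obtain ⟨K, hK1, hK⟩ := ((eventually_ge_atTop 1).and
    (hexp.eventually_le_const (half_pos hε))).exists
  refine ⟨K, by linarith, ?_⟩
  have hK0 : 0 < K := by linarith
  have h2 : Tendsto (fun n : ℕ => 2 * Real.exp (3 / 4 * t) * C *
      (4 * maxBound n * (1 + Real.log n) * Real.exp (-(c * a ^ 2 * n)))) atTop (𝓝 0) := by
    simpa using (tendsto_maxBound_mul_exp_neg (c := c * a ^ 2) (by positivity)).const_mul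
      (2 * Real.exp (3 / 4 * t) * C)
  have h3 : Tendsto (fun n : ℕ => K / √(n : ℝ)) atTop (𝓝 0) :=
    (Real.tendsto_sqrt_atTop.comp tendsto_natCast_atTop_atTop).const_div_atTop K
  have h4 : Tendsto (fun n : ℕ => (n : ℝ) * (a / 2)) atTop atTop :=
    tendsto_natCast_atTop_atTop.atTop_mul_const (by positivity)
  filter_upwards [h2.eventually_le_const (half_pos hε), h3.eventually_le_const one_pos,
    h4.eventually_ge_atTop t, eventually_ge_atTop 2] with n k2 k3 k4 hn
  have hn1 : 1 ≤ n := by omega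
  have hn2 : (2 : ℝ) ≤ n := by exact_mod_cast hn
  have hnp : (0 : ℝ) < n := by linarith
  have hsn : 0 < √(n : ℝ) := by positivity
  have hlog2 : 1 / 2 ≤ Real.log n := by
    have := Real.log_le_log (by norm_num) hn2
    linarith [Real.log_two_gt_d9]
  have hB1 : 1 ≤ maxBound n := by
    rw [maxBound, Real.one_le_sqrt]; linarith
  have hb := sq_maxBound hn1
  set B := 4 * maxBound n with hB
  set κ := K / √(n : ℝ) with hκ
  have hκ0 : 0 < κ := by positivity
  have hκB : κ ≤ B := by linarith
  set T := ENNReal.ofReal (Real.exp (3 / 4 * (-t))) with hT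
  have hsub : {x : Fin n → ℝ | (∀ i, |x i| ≤ maxBound n) ∧
      ∃ s : ℝ, κ ≤ |s| ∧ -t < logRatio a s x} ⊆
      {x | T ≤ supBound a κ κ B x} ∪ {x | T ≤ supBound a (-κ) (-B) (-κ) x} := by
    rintro x ⟨hx, s, hs, hL⟩
    -- Shifts beyond four times the sample maximum need no probability: there `L ≤ -n a / 2 ≤ -t`.
    have hsB : |s| ≤ B := by
      by_contra! h
      have h5 := logRatio_le_of_large (a := a) (s := s) ⟨ha0.le, by linarith [ha.2]⟩ hx h.le
      have h6 : Real.exp (-(s ^ 2 / 4)) ≤ 1 / 2 := by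
        have : B ^ 2 ≤ s ^ 2 := by
          rw [← sq_abs s]; exact pow_le_pow_left₀ (by linarith) h.le 2
        have h7 : Real.log 2 ≤ s ^ 2 / 4 := by
          rw [hB, mul_pow, hb] at this
          linarith [Real.log_two_lt_d9]
        calc Real.exp (-(s ^ 2 / 4)) ≤ Real.exp (-Real.log 2) := Real.exp_le_exp.2 (by linarith)
          _ = 1 / 2 := by rw [Real.exp_neg, Real.exp_log (by norm_num)]; norm_num
      have h8 : (n : ℝ) * (a / 2) ≤ n * (a * (1 - Real.exp (-(s ^ 2 / 4)))) := by
        gcongr; nlinarith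
      linarith
    have hTL : T ≤ ENNReal.ofReal (Real.exp (3 / 4 * logRatio a s x)) :=
      ENNReal.ofReal_le_ofReal (Real.exp_le_exp.2 (by linarith))
    have haI : a ∈ Set.Icc (0 : ℝ) 1 := ⟨ha0.le, by linarith [ha.2]⟩
    rcases le_total 0 s with h | h
    · rw [abs_of_nonneg h] at hs hsB
      exact Or.inl (hTL.trans (ofReal_exp_le_supBound haI ⟨le_rfl, hκB⟩ ⟨hs, hsB⟩ x))
    · rw [abs_of_nonpos h] at hs hsB
      exact Or.inr (hTL.trans (ofReal_exp_le_supBound haI ⟨by linarith, le_rfl⟩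
        ⟨by linarith, by linarith⟩ x))
  set E := C * Real.exp (-(c * n * a ^ 2 * κ ^ 2)) +
    C * B * (1 + Real.log n) * Real.exp (-(c * n * a ^ 2)) with hE
  have hmark : ∀ p A A', p ∈ Set.Icc A A' → Set.Icc A A' ⊆ Set.Icc (-B) B →
      (∀ u ∈ Set.Icc A A', κ ≤ |u|) →
      stdSample n {x | T ≤ supBound a p A A' x} ≤ ENNReal.ofReal (Real.exp (3 / 4 * t) * E) := by
    intro p A A' hp hAB hu
    have hT0 : T ≠ 0 := by rw [hT, ne_eq, ENNReal.ofReal_eq_zero, not_le]; exact Real.exp_pos _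
    refine (meas_ge_le_lintegral_div (measurable_supBound ⟨ha0.le, by linarith [ha.2]⟩ p A
      A').aemeasurable hT0 (by simp [hT])).trans ?_
    refine (ENNReal.div_le_div_right (hmom n hn1 a ha κ ⟨hκ0.le, k3⟩ p A A' B (by linarith) hp hAB
      hu) _).trans ?_
    rw [hT, ← ENNReal.ofReal_div_of_pos (Real.exp_pos _)]
    refine ENNReal.ofReal_le_ofReal (le_of_eq ?_)
    rw [← hE, mul_neg, Real.exp_neg (3 / 4 * t), div_inv_eq_mul, mul_comm]
  refine (measure_mono hsub).trans ((measure_union_le _ _).trans ?_)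
  refine (add_le_add
    (hmark κ κ B ⟨le_rfl, hκB⟩ (Set.Icc_subset_Icc_left (by linarith)) fun u hu =>
      hu.1.trans (le_abs_self u))
    (hmark (-κ) (-B) (-κ) ⟨by linarith, le_rfl⟩ (Set.Icc_subset_Icc_right (by linarith))
      fun u hu => by linarith [hu.2, neg_le_abs u])).trans ?_
  have hlogn : 0 ≤ Real.log n := by linarith
  have hE0 : 0 ≤ E := by positivity
  rw [← ENNReal.ofReal_add (by positivity) (by positivity)]
  refine ENNReal.ofReal_le_ofReal ?_
  have e1 : Real.exp (-(c * n * a ^ 2 * κ ^ 2)) ≤ Real.exp (-(c * a ^ 2) * K) := by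
    apply Real.exp_le_exp.2
    have : c * n * a ^ 2 * κ ^ 2 = c * a ^ 2 * K ^ 2 := by
      rw [hκ, div_pow, Real.sq_sqrt hnp.le]; field_simp
    rw [this]
    have : K ≤ K ^ 2 := by nlinarith
    have := mul_le_mul_of_nonneg_left this (show 0 ≤ c * a ^ 2 by positivity)
    linarith
  have e2 : c * n * a ^ 2 = c * a ^ 2 * n := by ring
  have e3 := mul_le_mul_of_nonneg_left e1 (show 0 ≤ 2 * Real.exp (3 / 4 * t) * C by positivity)
  rw [hE, e2] at *
  nlinarith

/-- The log likelihood ratio at small mixing fractions is bounded on samples with a controlled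
maximum. -/
lemma logRatio_le_one_of_small {n : ℕ} (hn : 1 ≤ n) {a s : ℝ} {x : Fin n → ℝ}
    (ha : a ∈ Set.Icc (0 : ℝ) 1) (hx : ∀ i, |x i| ≤ maxBound n)
    (h : a ≤ (1 / 2) ^ (5 * (Nat.log 2 n + 1))) : logRatio a s x ≤ 1 := by
  have hnp : (0 : ℝ) < n := by exact_mod_cast hn
  have hpow : (n : ℝ) ≤ 2 ^ (Nat.log 2 n + 1) := by
    exact_mod_cast (Nat.lt_pow_succ_log_self (by norm_num) n).le
  have ha2 : a ≤ 1 / (n : ℝ) ^ 5 := by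
    refine h.trans ?_
    rw [mul_comm 5, pow_mul, one_div_pow, one_div_pow]
    gcongr
  have e : Real.exp (maxBound n ^ 2 / 2) = (n : ℝ) ^ 4 := by
    rw [sq_maxBound hn, show 8 * Real.log n / 2 = (4 : ℕ) * Real.log n by push_cast; ring,
      Real.exp_nat_mul, Real.exp_log hnp]
  -- The exponent `5` of the cutoff is what makes `n · n⁻⁵ · n⁴ = 1`.
  calc logRatio a s x ≤ n * (a * Real.exp (maxBound n ^ 2 / 2)) := logRatio_le_mul_exp ha hx
    _ ≤ n * (1 / (n : ℝ) ^ 5 * (n : ℝ) ^ 4) := by rw [e]; gcongr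
    _ = 1 := by field_simp

lemma neg_one_le_log_div {n : ℕ} (hn : 1 ≤ n) {a η : ℝ} (ha : a ∈ Set.Icc (0 : ℝ) 1) (hη : 0 ≤ η)
    (hη1 : η ≤ 1) : -1 ≤ η * Real.log (n / (a * n + 1)) := by
  have hn' : (1 : ℝ) ≤ n := by exact_mod_cast hn
  have hnp : (0 : ℝ) < n := by linarith
  have hd : 0 < a * n + 1 := by have := mul_nonneg ha.1 hnp.le; linarith
  have : 1 / 2 ≤ n / (a * n + 1) := by
    rw [div_le_div_iff₀ (by norm_num) hd]; nlinarith [ha.2]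
  have h := Real.log_le_log (by norm_num) this
  rw [one_div, Real.log_inv] at h
  have := Real.log_two_lt_d9
  nlinarith

/-- If the log likelihood ratio exceeds its envelope somewhere, then it does so, up to constants, on
the dyadic net of mixing fractions. -/
lemma exists_net_of_logRatio_gt {n : ℕ} (hn : 1 ≤ n) {a s η K : ℝ} {x : Fin n → ℝ}
    (hη : 0 ≤ η) (hη1 : η ≤ 1) (hK : 2 ≤ K)
    (ha : a ∈ Set.Icc (0 : ℝ) 1) (hx : ∀ i, |x i| ≤ maxBound n)
    (hL : K + η * Real.log (n / (a * n + 1)) < logRatio a s x) :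
    ∃ k < 5 * (Nat.log 2 n + 1), |s| ≤ 4 * maxBound n ∧
      K / 2 + η / 2 * Real.log (n / ((1 / 2) ^ k * n + 1)) ≤
        logRatio ((1 / 2) ^ (k + 1)) s x := by
  have hn' : (1 : ℝ) ≤ n := by exact_mod_cast hn
  have hnp : (0 : ℝ) < n := by linarith
  have h1 := neg_one_le_log_div hn ha hη hη1
  have hL1 : 1 < logRatio a s x := by linarith
  have hsmall : (1 / 2) ^ (5 * (Nat.log 2 n + 1)) < a := by
    by_contra! h
    exact hL1.not_ge (logRatio_le_one_of_small hn ha hx h)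
  have ha0 : 0 < a := lt_trans (by positivity) hsmall
  -- Rounding `a` down to a power of `1/2` changes it by a factor at most two, hence by
  -- `logRatio_le_mul` the threshold need only be halved.
  obtain ⟨k, hk1, hk2⟩ := exists_nat_pow_near_of_lt_one ha0 ha.2 (y := 1 / 2) (by norm_num)
    (by norm_num)
  refine ⟨k, ?_, ?_, ?_⟩
  · by_contra! h
    exact (hsmall.trans_le (hk2.trans (pow_le_pow_of_le_one (by norm_num) (by norm_num) h))).false
  · by_contra! h
    exact absurd (logRatio_nonpos_of_large ha hx h.le) (by linarith)
  · have hak : (0 : ℝ) < (1 / 2) ^ (k + 1) := by positivity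
    have h2 := logRatio_le_mul hak hk1.le ha.2 s x
    have h3 : a / (1 / 2) ^ (k + 1) ≤ 2 := by
      rw [div_le_iff₀ hak, pow_succ]; linarith
    have h4 : 0 < logRatio ((1 / 2) ^ (k + 1)) s x := by
      by_contra! h
      have := mul_nonpos_of_nonneg_of_nonpos (div_nonneg ha0.le hak.le) h
      linarith
    have h5 := mul_le_mul_of_nonneg_right h3 h4.le
    have h6 : Real.log (n / ((1 / 2) ^ k * n + 1)) ≤ Real.log (n / (a * n + 1)) := by
      apply Real.log_le_log (by positivity)
      gcongr
    have h7 := mul_le_mul_of_nonneg_left h6 hη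
    linarith

/-- The log likelihood ratio grows at most like a small multiple of `log (n / (a n + 1))`, uniformly
in the mixing fraction and the shift. -/
lemma exists_measure_logRatio_gt_log_le {η ε : ℝ} (hη : 0 < η) (hη1 : η ≤ 1) (hε : 0 < ε) :
    ∃ K, ∀ᶠ n : ℕ in atTop, stdSample n {x | (∀ i, |x i| ≤ maxBound n) ∧
      ∃ a ∈ Set.Icc (0 : ℝ) 1, ∃ s : ℝ, K + η * Real.log (n / (a * n + 1)) < logRatio a s x} ≤
        ENNReal.ofReal ε := by
  obtain ⟨C, hC, c, hc, hmom⟩ := exists_lintegral_supBound_le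
  -- The threshold on the net is `η / 2`, and the exponent of the maximal inequality `3/4`; so
  -- Markov's inequality yields the power `3 η / 8 = 2 γ` of `2 a + 1 / n`. One factor `γ` absorbs
  -- the logarithms, the other makes the union bound summable.
  obtain ⟨γ, hγ⟩ : ∃ γ, γ = 3 * η / 16 := ⟨_, rfl⟩
  have hγ0 : 0 < γ := by rw [hγ]; positivity
  have hγ1 : γ ≤ 1 := by linarith
  set q : ℝ := (1 / 2) ^ γ with hq
  have hq0 : 0 < q := by positivity
  have hq1 : q < 1 := Real.rpow_lt_one (by norm_num) (by norm_num) hγ0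
  have hexp : Tendsto (fun K : ℝ => 3 * C * ((1 - q)⁻¹ + 1) * Real.exp (-(3 / 8) * K))
      atTop (𝓝 0) := by
    have h := (tendsto_rpow_mul_exp_neg_mul_atTop_nhds_zero 0 (3 / 8) (by norm_num))
    simp only [Real.rpow_zero, one_mul] at h
    simpa using h.const_mul (3 * C * ((1 - q)⁻¹ + 1))
  obtain ⟨K, hK2, hK⟩ := ((eventually_ge_atTop 2).and (hexp.eventually_le_const hε)).exists
  refine ⟨K, ?_⟩
  have hlogn : Tendsto (fun n : ℕ => (5 * (Nat.log 2 n + 1) : ℕ) * (1 / (n : ℝ)) ^ γ) atTop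
      (𝓝 0) := by
    have h1 := ((isLittleO_log_rpow_atTop hγ0).tendsto_div_nhds_zero.comp
      tendsto_natCast_atTop_atTop).const_mul (5 / Real.log 2)
    have h2 := ((tendsto_rpow_neg_atTop hγ0).comp tendsto_natCast_atTop_atTop).const_mul 5
    have h3 := h1.add h2
    simp only [mul_zero, add_zero] at h3
    refine squeeze_zero' (Eventually.of_forall fun n => by positivity) ?_ h3
    filter_upwards [eventually_ge_atTop 1] with n hn
    have hnp : (0 : ℝ) < n := by exact_mod_cast hn
    have hl2 := Real.log_pos (x := 2) (by norm_num)
    have k1 : (Nat.log 2 n : ℝ) * Real.log 2 ≤ Real.log n := by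
      rw [← Real.log_pow]
      apply Real.log_le_log (by positivity)
      exact_mod_cast Nat.pow_log_le_self 2 (by omega)
    have k2 : (Nat.log 2 n : ℝ) ≤ Real.log n / Real.log 2 := by rwa [le_div_iff₀ hl2]
    have k3 : (1 / (n : ℝ)) ^ γ = (n : ℝ) ^ (-γ) := by
      rw [one_div, Real.inv_rpow hnp.le, Real.rpow_neg hnp.le]
    simp only [Function.comp]
    rw [k3, div_eq_mul_inv (Real.log n), ← Real.rpow_neg hnp.le]
    push_cast
    calc 5 * ((Nat.log 2 n : ℝ) + 1) * (n : ℝ) ^ (-γ)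
        ≤ 5 * (Real.log n / Real.log 2 + 1) * (n : ℝ) ^ (-γ) := by gcongr
      _ = _ := by ring
  filter_upwards [eventually_maxBound_mul_exp_mul_rpow_le hc hγ0 hγ1,
    hlogn.eventually_le_const one_pos, eventually_ge_atTop 1] with n k1 k2 hn
  have hn' : (1 : ℝ) ≤ n := by exact_mod_cast hn
  have hnp : (0 : ℝ) < n := by linarith
  have hlog := Real.log_nonneg hn'
  set B := 4 * maxBound n with hB
  have hB0 : 0 ≤ B := by have := maxBound_nonneg n; positivity
  set N := 5 * (Nat.log 2 n + 1) with hN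
  set A : ℕ → ℝ := fun k => (1 / 2) ^ (k + 1) with hA
  have hAI : ∀ k, A k ∈ Set.Ioc (0 : ℝ) (1 / 2) := fun k => by
    refine ⟨by simp only [hA]; positivity, ?_⟩
    exact (pow_le_pow_of_le_one (a := (1 / 2 : ℝ)) (by norm_num) (by norm_num)
      (show 1 ≤ k + 1 by omega)).trans_eq (pow_one _)
  have h2A : ∀ k, 2 * A k = (1 / 2) ^ k := fun k => by simp only [hA]; rw [pow_succ]; ring
  set T : ℕ → ℝ := fun k =>
    Real.exp (3 / 4 * (K / 2 + η / 2 * Real.log (n / ((1 / 2) ^ k * n + 1)))) with hT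
  have hsub : {x : Fin n → ℝ | (∀ i, |x i| ≤ maxBound n) ∧
      ∃ a ∈ Set.Icc (0 : ℝ) 1, ∃ s : ℝ, K + η * Real.log (n / (a * n + 1)) < logRatio a s x} ⊆
      ⋃ k ∈ Finset.range N, {x | ENNReal.ofReal (T k) ≤ supBound (A k) 0 (-B) B x} := by
    rintro x ⟨hx, a, ha, s, hL⟩
    obtain ⟨k, hk, hs, h⟩ := exists_net_of_logRatio_gt hn hη.le hη1 hK2 ha hx hL
    simp only [Set.mem_iUnion, Finset.mem_range, Set.mem_ofPred_eq]
    refine ⟨k, hk, le_trans (ENNReal.ofReal_le_ofReal (Real.exp_le_exp.2 ?_))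
      (ofReal_exp_le_supBound ⟨(hAI k).1.le, by linarith [(hAI k).2]⟩ ⟨by linarith, hB0⟩
        (abs_le.1 hs) x)⟩
    simp only [hA]; linarith
  have hTinv : ∀ k, 1 / T k = Real.exp (-(3 / 8) * K) * ((2 * A k + 1 / n) ^ γ) ^ 2 := fun k => by
    have hpos : 0 < 2 * A k + 1 / n := by have := (hAI k).1; positivity
    have e1 : (n : ℝ) / ((1 / 2) ^ k * n + 1) = (2 * A k + 1 / n)⁻¹ := by
      rw [h2A]; field_simp
    rw [← Real.rpow_natCast, ← Real.rpow_mul hpos.le, Real.rpow_def_of_pos hpos, ← Real.exp_add,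
      one_div, ← Real.exp_neg, e1, Real.log_inv, hγ]
    congr 1; push_cast; ring
  have hterm : ∀ k, stdSample n {x | ENNReal.ofReal (T k) ≤ supBound (A k) 0 (-B) B x} ≤
      ENNReal.ofReal (3 * C * Real.exp (-(3 / 8) * K) * (q ^ k + (1 / (n : ℝ)) ^ γ)) := by
    intro k
    have hT0 : 0 < T k := Real.exp_pos _
    have hA0 := (hAI k).1
    refine (meas_ge_le_lintegral_div (measurable_supBound ⟨hA0.le, by linarith [(hAI k).2]⟩ 0
      (-B) B).aemeasurable (by simpa using hT0) (by simp)).trans ?_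
    refine (ENNReal.div_le_div_right (hmom n hn (A k) (hAI k) 0 ⟨le_rfl, zero_le_one⟩ 0 (-B) B B hB0
      ⟨by linarith, hB0⟩ le_rfl fun u _ => abs_nonneg u) _).trans ?_
    rw [← ENNReal.ofReal_div_of_pos hT0]
    refine ENNReal.ofReal_le_ofReal ?_
    rw [div_eq_mul_one_div, hTinv]
    set y := (2 * A k + 1 / n) ^ γ with hy
    have hy0 : 0 ≤ y := by positivity
    have hy2 : y ≤ 2 := by
      have h2 : (2 : ℝ) ^ γ ≤ 2 := by
        simpa using Real.rpow_le_rpow_of_exponent_le (x := 2) (by norm_num) hγ1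
      refine le_trans ?_ h2
      have : 1 / (n : ℝ) ≤ 1 := by rw [div_le_one hnp]; exact hn'
      have := (hAI k).2
      rw [hy]; gcongr; linarith
    -- Subadditivity of the power separates a geometric term, summable over the net, from one of
    -- size `n ^ (-γ)`, which meets only logarithmically many net points.
    have hysum : y ≤ q ^ k + (1 / (n : ℝ)) ^ γ := by
      refine (Real.rpow_add_le_add_rpow (by positivity) (by positivity) hγ0.le hγ1).trans ?_
      rw [h2A, hq, ← Real.rpow_natCast, ← Real.rpow_mul (by norm_num), ← Real.rpow_natCast,
        ← Real.rpow_mul (by norm_num), mul_comm]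
    have hk := k1 (A k) (hAI k)
    have e : C * Real.exp (-(c * n * A k ^ 2 * 0 ^ 2)) = C := by simp
    rw [e]
    have hmain : (C + C * B * (1 + Real.log n) * Real.exp (-(c * n * A k ^ 2))) * y ^ 2 ≤
        3 * C * y := by
      have h1 := mul_le_mul_of_nonneg_left hk (mul_nonneg hC.le hy0)
      have h2 := mul_le_mul_of_nonneg_left hy2 (mul_nonneg hC.le hy0)
      linarith
    calc _ = Real.exp (-(3 / 8) * K) *
          ((C + C * B * (1 + Real.log n) * Real.exp (-(c * n * A k ^ 2))) * y ^ 2) := by ring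
      _ ≤ Real.exp (-(3 / 8) * K) * (3 * C * (q ^ k + (1 / (n : ℝ)) ^ γ)) := by
          exact mul_le_mul_of_nonneg_left (hmain.trans (by gcongr)) (Real.exp_pos _).le
      _ = _ := by ring
  refine (measure_mono hsub).trans ((measure_biUnion_finset_le _ _).trans ?_)
  refine (Finset.sum_le_sum fun k _ => hterm k).trans ?_
  rw [← ENNReal.ofReal_sum_of_nonneg fun k _ => by positivity]
  refine ENNReal.ofReal_le_ofReal (le_trans ?_ hK)
  rw [← Finset.mul_sum, Finset.sum_add_distrib]
  simp only [Finset.sum_const, Finset.card_range, nsmul_eq_mul]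
  have hgeom : ∑ k ∈ Finset.range N, q ^ k ≤ (1 - q)⁻¹ := by
    rw [← tsum_geometric_of_lt_one hq0.le hq1]
    exact (summable_geometric_of_lt_one hq0.le hq1).sum_le_tsum _ fun k _ => by positivity
  calc _ ≤ 3 * C * Real.exp (-(3 / 8) * K) * ((1 - q)⁻¹ + 1) := by gcongr
    _ = _ := by ring

/-! ### Gaussian samples are typical -/

lemma exists_gaussian_tail_le : ∃ D > 0, ∀ R : ℝ, 0 ≤ R →
    gaussianReal 0 1 {z | R < |z|} ≤ ENNReal.ofReal (D * Real.exp (-(R ^ 2 / 4))) := by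
  have hI := integrable_exp_sq_gaussian
  refine ⟨(∫ z, Real.exp (z ^ 2 / 4) ∂gaussianReal 0 1) + 1, ?_, fun R hR => ?_⟩
  · have : 0 ≤ ∫ z, Real.exp (z ^ 2 / 4) ∂gaussianReal 0 1 :=
      integral_nonneg fun z => (Real.exp_pos _).le
    linarith
  have hsub : {z : ℝ | R < |z|} ⊆
      {z | ENNReal.ofReal (Real.exp (R ^ 2 / 4)) ≤ ENNReal.ofReal (Real.exp (z ^ 2 / 4))} := by
    intro z hz
    refine ENNReal.ofReal_le_ofReal (Real.exp_le_exp.2 ?_)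
    have : R ^ 2 ≤ z ^ 2 := by
      rw [← sq_abs z]; exact pow_le_pow_left₀ hR (le_of_lt hz) 2
    linarith
  refine (measure_mono hsub).trans ((meas_ge_le_lintegral_div (by fun_prop)
    (by simpa using Real.exp_pos _) (by simp)).trans ?_)
  rw [← ofReal_integral_eq_lintegral_ofReal hI (ae_of_all _ fun z => (Real.exp_pos _).le),
    ← ENNReal.ofReal_div_of_pos (Real.exp_pos _)]
  refine ENNReal.ofReal_le_ofReal ?_
  rw [Real.exp_neg, div_eq_mul_inv]
  gcongr
  linarith

lemma exists_measure_maxBound_le : ∃ D > 0, ∀ n : ℕ, 1 ≤ n →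
    stdSample n {x | ¬∀ i, |x i| ≤ maxBound n} ≤ ENNReal.ofReal (D / n) := by
  obtain ⟨D, hD, h⟩ := exists_gaussian_tail_le
  refine ⟨D, hD, fun n hn => ?_⟩
  have hnp : (0 : ℝ) < n := by exact_mod_cast hn
  have hsub : {x : Fin n → ℝ | ¬∀ i, |x i| ≤ maxBound n} ⊆
      ⋃ i, (fun x : Fin n → ℝ => x i) ⁻¹' {z | maxBound n < |z|} := by
    intro x hx
    simpa using hx
  have hms : MeasurableSet {z : ℝ | maxBound n < |z|} :=
    measurableSet_lt measurable_const (by fun_prop)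
  have hi : ∀ i : Fin n, stdSample n ((fun x : Fin n → ℝ => x i) ⁻¹' {z | maxBound n < |z|}) ≤
      ENNReal.ofReal (D * Real.exp (-(maxBound n ^ 2 / 4))) := fun i => by
    rw [(measurePreserving_eval (fun _ : Fin n => gaussianReal 0 1) i).measure_preimage
      hms.nullMeasurableSet]
    exact h _ (maxBound_nonneg n)
  refine (measure_mono hsub).trans ((measure_iUnion_fintype_le _ _).trans ?_)
  refine (Finset.sum_le_sum fun i _ => hi i).trans ?_
  rw [← ENNReal.ofReal_sum_of_nonneg fun i _ => by positivity]
  refine ENNReal.ofReal_le_ofReal (le_of_eq ?_)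
  -- The constant `8` in `maxBound` gives each coordinate a tail of order `n⁻²`, so the union bound
  -- leaves `D / n`.
  have e : Real.exp (-(maxBound n ^ 2 / 4)) = 1 / (n : ℝ) ^ 2 := by
    rw [sq_maxBound hn, show 8 * Real.log n / 4 = (2 : ℕ) * Real.log n by push_cast; ring,
      Real.exp_neg, Real.exp_nat_mul, Real.exp_log hnp, one_div]
  rw [e]
  simp only [Finset.sum_const, Finset.card_univ, Fintype.card_fin, nsmul_eq_mul]
  field_simp

lemma sampleXi_sample {Ω : Type*} (X : ℕ → Ω → ℝ) (n : ℕ) (ω : Ω) :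
    sampleXi (sample X n ω) = xi X n ω := by
  simp only [sampleXi, sample, xi, Fin.sum_univ_eq_sum_range (fun i => X i ω) n]

/-! ### Passage to the sequence of observations. -/

section Sequence
variable {Ω : Type*} [MeasurableSpace Ω] {P : Measure Ω} {X : ℕ → Ω → ℝ}

lemma hasLaw_sample (hX : iIndepFun X P) (hlaw : ∀ i, HasLaw (X i) (gaussianReal 0 1) P) (n : ℕ) :
    HasLaw (sample X n) (stdSample n) P :=
  (hX.precomp (g := fun i : Fin n => (i : ℕ)) Fin.val_injective).hasLaw_pi fun i => hlaw i

lemma hasLaw_sum (hX : iIndepFun X P) [IsProbabilityMeasure P]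
    (hlaw : ∀ i, HasLaw (X i) (gaussianReal 0 1) P) (n : ℕ) :
    HasLaw (∑ i ∈ Finset.range n, X i) (gaussianReal 0 n) P := by
  induction n with
  | zero =>
    simp only [Finset.range_zero, Finset.sum_empty, Nat.cast_zero, gaussianReal_zero_var]
    exact hasLaw_dirac_of_ae_eq (ae_of_all _ fun _ => rfl)
  | succ n ih =>
    have hind := hX.indepFun_sum_range_succ₀ (fun i => (hlaw i).aemeasurable) n
    rw [Finset.sum_range_succ]
    refine ⟨ih.aemeasurable.add (hlaw n).aemeasurable, ?_⟩
    rw [gaussianReal_add_gaussianReal_of_indepFun hind ih.map_eq (hlaw n).map_eq]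
    simp

lemma hasLaw_xi (hX : iIndepFun X P) [IsProbabilityMeasure P]
    (hlaw : ∀ i, HasLaw (X i) (gaussianReal 0 1) P) {n : ℕ} (hn : 1 ≤ n) :
    HasLaw (xi X n) (gaussianReal 0 1) P := by
  have h := gaussianReal_div_const (hasLaw_sum hX hlaw n) (√n)
  have e : (n : ℝ≥0) / .mk (√(n : ℝ) ^ 2) (sq_nonneg _) = 1 := by
    have hnp : (n : ℝ) ≠ 0 := by positivity
    apply NNReal.coe_injective
    rw [NNReal.coe_div]
    simp [hnp]
  rw [e, zero_div] at h
  convert h using 1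
  ext ω
  simp [xi]

lemma tendstoInMeasure_sampleSq (hX : iIndepFun X P) [IsProbabilityMeasure P]
    (hlaw : ∀ i, HasLaw (X i) (gaussianReal 0 1) P) :
    TendstoInMeasure P (fun n ω => sampleSq (sample X n ω)) atTop (fun _ => 1) := by
  have hae : ∀ i, AEMeasurable (X i) P := fun i => (hlaw i).aemeasurable
  have hsq : Integrable (fun z : ℝ => z ^ 2) (gaussianReal 0 1) :=
    (memLp_id_gaussianReal' 2 (by simp)).integrable_sq
  have hint : Integrable (fun ω => X 0 ω ^ 2) P := by
    have : Integrable ((fun z : ℝ => z ^ 2) ∘ X 0) P := by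
      rw [← integrable_map_measure (by fun_prop) (hae 0), (hlaw 0).map_eq]
      exact hsq
    exact this
  have hmean : ∫ ω, X 0 ω ^ 2 ∂P = 1 := by
    have h1 := (hlaw 0).integral_comp (f := fun z : ℝ => z ^ 2) (by fun_prop)
    have h2 := variance_fun_id_gaussianReal (μ := 0) (v := 1)
    rw [variance_eq_integral measurable_id'.aemeasurable] at h2
    simp only [integral_id_gaussianReal, sub_zero, NNReal.coe_one] at h2
    rw [← h2]; exact h1
  have hlln := strong_law_ae_real (fun i ω => X i ω ^ 2) hint
    (fun i j hij => (hX.indepFun hij).comp (φ := fun z : ℝ => z ^ 2) (ψ := fun z : ℝ => z ^ 2)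
      (by fun_prop) (by fun_prop))
    (fun i => (IdentDistrib.mk (hae i) (hae 0) (by rw [(hlaw i).map_eq, (hlaw 0).map_eq])).comp
      (u := fun z : ℝ => z ^ 2) (by fun_prop))
  rw [hmean] at hlln
  have e : ∀ n ω, sampleSq (sample X n ω) = (∑ i ∈ Finset.range n, X i ω ^ 2) / n := fun n ω => by
    simp only [sampleSq, sample, Fin.sum_univ_eq_sum_range (fun i => X i ω ^ 2) n]
  simp only [e]
  refine tendstoInMeasure_of_tendsto_ae (fun n => ?_) hlln
  exact AEMeasurable.aestronglyMeasurable (by fun_prop)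

/-- Gaussian samples are typical with high probability. -/
lemma exists_measure_not_typical_le (hX : iIndepFun X P) [IsProbabilityMeasure P]
    (hlaw : ∀ i, HasLaw (X i) (gaussianReal 0 1) P) {ε : ℝ} (hε : 0 < ε) :
    ∃ M, 0 ≤ M ∧ ∀ ρ > 0, ∀ᶠ n : ℕ in atTop,
      P {ω | ¬Typical ρ M (sample X n ω)} ≤ ENNReal.ofReal ε := by
  obtain ⟨D, hD, htail⟩ := exists_gaussian_tail_le
  obtain ⟨D', hD', hmax⟩ := exists_measure_maxBound_le
  have hε3 : 0 < ε / 3 := by positivity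
  have hlim : Tendsto (fun M : ℝ => D * Real.exp (-(M ^ 2 / 4))) atTop (𝓝 0) := by
    have : Tendsto (fun M : ℝ => M ^ 2 / 4) atTop atTop :=
      (tendsto_pow_atTop (by norm_num)).atTop_div_const (by norm_num)
    simpa using (Real.tendsto_exp_neg_atTop_nhds_zero.comp this).const_mul D
  obtain ⟨M, hM0, hM⟩ := ((eventually_ge_atTop 0).and (hlim.eventually_le_const hε3)).exists
  refine ⟨M, hM0, fun ρ hρ => ?_⟩
  have h1 := (tendstoInMeasure_iff_dist.1 (tendstoInMeasure_sampleSq hX hlaw) ρ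
    hρ).eventually_le_const (ENNReal.ofReal_pos.2 hε3)
  have h2 : Tendsto (fun n : ℕ => D' / (n : ℝ)) atTop (𝓝 0) :=
    tendsto_const_div_atTop_nhds_zero_nat D'
  filter_upwards [h1, h2.eventually_le_const hε3, eventually_ge_atTop 1] with n k1 k2 hn
  have hsub : {ω | ¬Typical ρ M (sample X n ω)} ⊆
      (sample X n ⁻¹' {x | ¬∀ i, |x i| ≤ maxBound n} ∪
        {ω | ρ ≤ dist (sampleSq (sample X n ω)) 1}) ∪ xi X n ⁻¹' {z | M < |z|} := by
    intro ω hω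
    by_contra hcon
    simp only [Set.mem_union, not_or, Set.mem_preimage, Set.mem_ofPred_eq, not_not, not_le,
      not_lt] at hcon
    refine hω ⟨hcon.1.1, ?_, ?_⟩
    · have := hcon.1.2; rw [Real.dist_eq] at this; exact this.le
    · rw [sampleXi_sample]; exact hcon.2
  have b1 : P (sample X n ⁻¹' {x | ¬∀ i, |x i| ≤ maxBound n}) ≤ ENNReal.ofReal (ε / 3) := by
    refine (Measure.le_map_apply (hasLaw_sample hX hlaw n).aemeasurable _).trans ?_
    rw [(hasLaw_sample hX hlaw n).map_eq]
    exact (hmax n hn).trans (ENNReal.ofReal_le_ofReal k2)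
  have b2 : P (xi X n ⁻¹' {z | M < |z|}) ≤ ENNReal.ofReal (ε / 3) := by
    refine (Measure.le_map_apply (hasLaw_xi hX hlaw hn).aemeasurable _).trans ?_
    rw [(hasLaw_xi hX hlaw hn).map_eq]
    exact (htail M hM0).trans (ENNReal.ofReal_le_ofReal hM)
  refine (measure_mono hsub).trans ((measure_union_le _ _).trans
    ((add_le_add ((measure_union_le _ _).trans (add_le_add b1 k1)) b2).trans ?_))
  rw [← ENNReal.ofReal_add hε3.le hε3.le, ← ENNReal.ofReal_add (by positivity) hε3.le]
  exact ENNReal.ofReal_le_ofReal (by linarith)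

end Sequence

/-! ### The energy landscape of typical samples -/

/-- Label marginals of near minimal energy have their mixing fraction bounded away from `0` and
`1`. -/
lemma exists_fraction_mem_Icc {φ : ℝ} (hφ : 1 < φ) {v : ℝ≥0} (hv : 0 < v) {η : ℝ}
    (hη0 : 0 ≤ η) (hη : η < φ - 1) (K U : ℝ) :
    ∃ a ∈ Set.Ioc (0 : ℝ) (1 / 2), ∀ᶠ n : ℕ in atTop, ∀ x : Fin n → ℝ,
      (∀ α ∈ Set.Icc (0 : ℝ) 1, ∀ s, logRatio α s x ≤ K + η * Real.log (n / (α * n + 1))) →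
      ∀ m ∈ cube n, ∀ α, ∑ i, m i = α * n → labelEnergy φ v x m ≤ Real.log n + U →
        α ∈ Set.Icc a (1 - a) := by
  obtain ⟨C, hC⟩ := exists_le_profileEnergy hφ hv
  -- The extra `φ - 1/2` pays for the penalty that is not being estimated: each logarithm is at
  -- least `-1`.
  set W := U + C + K + (φ - 1 / 2) with hW
  set a1 := Real.exp (-(W / (φ - 1 - η))) / 2 with ha1
  set a2 := Real.exp (-(W / (φ - 1 / 2))) / 2 with ha2
  have ha1p : 0 < a1 := by positivity
  have ha2p : 0 < a2 := by positivity
  refine ⟨min (1 / 2) (min a1 a2), ⟨by positivity, min_le_left _ _⟩, ?_⟩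
  filter_upwards [tendsto_one_div_atTop_nhds_zero_nat.eventually_le_const (lt_min ha1p ha2p),
    eventually_ge_atTop 1] with n h1 hn x hA m hm α hα hE
  have hn' : (1 : ℝ) ≤ n := by exact_mod_cast hn
  have hnp : (0 : ℝ) < n := by linarith
  have hαI : α ∈ Set.Icc (0 : ℝ) 1 := by
    have hs := sum_card_bounds (mem_cube.1 hm)
    rw [hα] at hs
    exact ⟨by nlinarith [hs.1], by nlinarith [hs.2]⟩
  have hlow := profileEnergy_sub_logRatio_le (φ := φ) hv (by omega : n ≠ 0) x hm hα
  set β := (v : ℝ) / (1 + v * ∑ i, m i) * ∑ i, x i * m i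
  have hβ : 0 ≤ β ^ 2 / (2 * (v : ℝ)) := by positivity
  have hP := hC n hn' α hαI
  have hL := hA α hαI β
  have hbound : ∀ c : ℝ, c ∈ Set.Icc (0 : ℝ) 1 → -1 ≤ Real.log (n / (c * n + 1)) := fun c hc => by
    simpa using neg_one_le_log_div hn hc zero_le_one le_rfl
  set w1 := Real.log (n / (α * n + 1)) with hw1
  set w2 := Real.log (n / ((1 - α) * n + 1)) with hw2
  have l1 : -1 ≤ w1 := hbound α hαI
  have l2 : -1 ≤ w2 := hbound (1 - α) ⟨by linarith [hαI.2], by linarith [hαI.1]⟩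
  have hsum : (φ - 1 - η) * w1 + (φ - 1 / 2) * w2 ≤ U + C + K := by
    simp only at hlow
    linarith
  have d1 : 0 < φ - 1 - η := by linarith
  have d2 : 0 < φ - 1 / 2 := by linarith
  -- A bounded logarithm means `c + 1 / n ≥ exp (-W / d)`; half of this survives once `1 / n` is at
  -- most the other half.
  have key : ∀ c d : ℝ, 0 ≤ c → 0 < d → Real.log (n / (c * n + 1)) ≤ W / d →
      1 / (n : ℝ) ≤ Real.exp (-(W / d)) / 2 → Real.exp (-(W / d)) / 2 ≤ c := by
    intro c d hc hd hl hn2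
    have hpos : (0 : ℝ) < n / (c * n + 1) := by positivity
    rw [Real.log_le_iff_le_exp hpos, div_le_iff₀ (by positivity)] at hl
    have h3 := mul_le_mul_of_nonneg_left hl (Real.exp_pos (-(W / d))).le
    rw [← mul_assoc, ← Real.exp_add, neg_add_cancel, Real.exp_zero, one_mul] at h3
    have h4 : Real.exp (-(W / d)) ≤ c + 1 / n := by
      have : (c + 1 / n) * n = c * n + 1 := by field_simp
      rw [← this] at h3
      exact le_of_mul_le_mul_right h3 hnp
    linarith
  have r1 : w1 ≤ W / (φ - 1 - η) := by rw [le_div_iff₀ d1]; nlinarith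
  have r2 : w2 ≤ W / (φ - 1 / 2) := by
    rw [le_div_iff₀ d2]; nlinarith
  have hm1 := min_le_right (1 / 2) (min a1 a2)
  refine ⟨hm1.trans ((min_le_left _ _).trans (key α _ hαI.1 d1 r1 (h1.trans (min_le_left _ _)))),
    ?_⟩
  have := key (1 - α) _ (by linarith [hαI.2]) d2 r2 (h1.trans (min_le_right _ _))
  have := hm1.trans (min_le_right _ _)
  linarith

lemma Typical.mono {n : ℕ} {ρ ρ' M : ℝ} {x : Fin n → ℝ} (h : Typical ρ M x) (hρ : ρ ≤ ρ') :
    Typical ρ' M x := ⟨h.1, h.2.1.trans hρ, h.2.2⟩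

/-- The expansion of the energy landscape holds at the sample `x`, with precision `δ`: the energy at
the mixing fraction `α₀` is as small as expected, and label marginals whose energy is at most
`log n + U` have a mixing fraction in `[a, 1 - a]`, a shift of order `n ^ (-1 / 2)`, and an energy
that is no smaller than expected. -/
def RegularAt (φ : ℝ) (v : ℝ≥0) (U a δ α₀ K : ℝ) {n : ℕ} (x : Fin n → ℝ) : Prop :=
  (∃ m ∈ cube n, ∑ i, m i = α₀ * n ∧
    labelEnergy φ v x m ≤ Real.log n + profileConst φ v α₀ - sampleXi x ^ 2 / 2 + δ) ∧
  ∀ m ∈ cube n, ∀ α, ∑ i, m i = α * n → labelEnergy φ v x m ≤ Real.log n + U →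
    α ∈ Set.Icc a (1 - a) ∧ |v / (1 + v * ∑ i, m i) * ∑ i, x i * m i| ≤ K / √n ∧
      Real.log n + profileConst φ v α - sampleXi x ^ 2 / 2 - δ ≤ labelEnergy φ v x m

/-- Deterministic form of the expansion of the energy landscape. -/
lemma regularAt_of_bounds {φ : ℝ} (hφ : 1 < φ) {v : ℝ≥0} (hv : 0 < v) {n : ℕ} (hn : n ≠ 0)
    {x : Fin n → ℝ} {U a δ α₀ K t : ℝ} (ha : a ∈ Set.Ioc (0 : ℝ) (1 / 2)) (hδ1 : δ ≤ 1)
    (ht0 : 0 ≤ t) (ht : U - limitConst φ v + 1 ≤ t)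
    (hupper : ∃ m ∈ cube n, ∑ i, m i = α₀ * n ∧
      labelEnergy φ v x m ≤ Real.log n + profileConst φ v α₀ - sampleXi x ^ 2 / 2 + δ)
    (hfrac : ∀ m ∈ cube n, ∀ α, ∑ i, m i = α * n → labelEnergy φ v x m ≤ Real.log n + U →
      α ∈ Set.Icc a (1 - a))
    (hprof : ∀ α ∈ Set.Icc a (1 - a),
      |profileEnergy φ v n α - (Real.log n + profileConst φ v α)| ≤ δ / 2)
    (hlocal : ∀ α ∈ Set.Icc (0 : ℝ) 1, ∀ s : ℝ, |s| ≤ K / √n →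
      logRatio α s x ≤ sampleXi x ^ 2 / 2 + δ / 2)
    (hfar : ∀ s : ℝ, K / √n ≤ |s| → logRatio a s x ≤ -t) :
    RegularAt φ v U a δ α₀ K x := by
  refine ⟨hupper, fun m hm α hα hE => ?_⟩
  have hαI := hfrac m hm α hα hE
  have hα0 : α ∈ Set.Ioo (0 : ℝ) 1 := ⟨ha.1.trans_le hαI.1, by linarith [ha.1, hαI.2]⟩
  have hlow := profileEnergy_sub_logRatio_le (φ := φ) hv hn x hm hα
  set β := (v : ℝ) / (1 + v * ∑ i, m i) * ∑ i, x i * m i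
  simp only at hlow
  have hβ : 0 ≤ β ^ 2 / (2 * (v : ℝ)) := by positivity
  have hp := (abs_le.1 (hprof α hαI)).1
  -- A larger shift would give `L(α, β) ≤ (α / a) L(a, β) ≤ -t`, and then an energy above `log n +
  -- U` by the choice of `t`.
  have hsmall : |β| ≤ K / √n := by
    by_contra! h
    have h1 := hfar β h.le
    have h2 := logRatio_le_mul ha.1 hαI.1 hα0.2.le β x
    have h3 : 1 ≤ α / a := by rw [le_div_iff₀ ha.1]; linarith [hαI.1]
    have h4 := mul_le_mul_of_nonneg_left h1 (zero_le_one.trans h3)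
    have h5 := mul_le_mul_of_nonneg_right h3 ht0
    have h6 := limitConst_le_profileConst hφ v hα0
    linarith
  refine ⟨hαI, hsmall, ?_⟩
  have := hlocal α ⟨hα0.1.le, hα0.2.le⟩ β hsmall
  linarith

section Sequence
variable {Ω : Type*} [MeasurableSpace Ω] {P : Measure Ω} {X : ℕ → Ω → ℝ}

/-- The expansion of the energy landscape holds with high probability. -/
lemma exists_measure_not_regularAt_le [IsProbabilityMeasure P] (hX : iIndepFun X P)
    (hlaw : ∀ i, HasLaw (X i) (gaussianReal 0 1) P) {φ : ℝ} (hφ : 1 < φ) {v : ℝ≥0} (hv : 0 < v)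
    (U : ℝ) {ε : ℝ} (hε : 0 < ε) :
    ∃ a > 0, ∀ δ > 0, δ ≤ 1 → ∀ α₀ ∈ Set.Ioo (0 : ℝ) 1, ∃ K > 0, ∀ᶠ n : ℕ in atTop,
      P {ω | ¬RegularAt φ v U a δ α₀ K (sample X n ω)} ≤ ENNReal.ofReal ε := by
  have hε3 : 0 < ε / 3 := by positivity
  set η := min ((φ - 1) / 2) 1 with hη
  have hη0 : 0 < η := lt_min (by linarith) one_pos
  have hηφ : η < φ - 1 := (min_le_left _ _).trans_lt (by linarith)
  obtain ⟨M, hM, htyp⟩ := exists_measure_not_typical_le hX hlaw hε3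
  obtain ⟨KA, hA⟩ := exists_measure_logRatio_gt_log_le hη0 (min_le_right _ _) hε3
  obtain ⟨a, ha, hfrac⟩ := exists_fraction_mem_Icc hφ hv hη0.le hηφ KA U
  -- The bound `a` is fixed before the precision `δ`, so that later `δ` may be taken from the gap of
  -- the profile constant on `[a, 1 - a]`.
  refine ⟨a, ha.1, fun δ hδ hδ1 α₀ hα₀ => ?_⟩
  set t := |U - limitConst φ v| + 1 with ht
  obtain ⟨K, hK, hB⟩ := exists_measure_logRatio_gt_le (t := t) ha hε3
  refine ⟨K, hK, ?_⟩
  obtain ⟨ρ₁, hρ₁, hloc⟩ := exists_logRatio_le_local (M := M) hK.le (half_pos hδ)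
  obtain ⟨ρ₂, hρ₂, hup⟩ := exists_labelEnergy_le (φ := φ) (by linarith) hv hα₀ hM hδ
  filter_upwards [htyp (min ρ₁ ρ₂) (lt_min hρ₁ hρ₂), hA, hB, hloc, hup, hfrac,
    eventually_abs_profileEnergy_sub_le (φ := φ) (by linarith) hv ha.1 (half_pos hδ),
    eventually_ge_atTop 1] with n k1 k2 k3 k4 k5 k6 k7 hn
  set bad₁ : Set (Fin n → ℝ) := {x | (∀ i, |x i| ≤ maxBound n) ∧
    ∃ a ∈ Set.Icc (0 : ℝ) 1, ∃ s : ℝ, KA + η * Real.log (n / (a * n + 1)) < logRatio a s x}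
  set bad₂ : Set (Fin n → ℝ) := {x | (∀ i, |x i| ≤ maxBound n) ∧
    ∃ s : ℝ, K / √n ≤ |s| ∧ -t < logRatio a s x}
  have hsub : {ω | ¬RegularAt φ v U a δ α₀ K (sample X n ω)} ⊆
      ({ω | ¬Typical (min ρ₁ ρ₂) M (sample X n ω)} ∪ sample X n ⁻¹' bad₁) ∪
        sample X n ⁻¹' bad₂ := by
    intro ω hω
    by_contra hcon
    simp only [Set.mem_union, not_or, Set.mem_preimage, Set.mem_ofPred_eq, not_not] at hcon
    obtain ⟨⟨hT, h1⟩, h2⟩ := hcon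
    refine hω (regularAt_of_bounds (t := t) hφ hv (by omega) ha hδ1 (by positivity)
      (by linarith [le_abs_self (U - limitConst φ v)]) (k5 _ (hT.mono (min_le_right _ _)))
      (k6 _ fun α hα s => ?_) k7 (k4 _ (hT.mono (min_le_left _ _))) fun s hs => ?_)
    · by_contra! h
      exact h1 ⟨hT.1, α, hα, s, h⟩
    · by_contra! h
      exact h2 ⟨hT.1, s, hs, h⟩
  -- This inequality holds for arbitrary sets, so the exceptional events, which involve uncountable
  -- unions over `s` and `a`, need not be shown measurable.
  have hmap : ∀ A : Set (Fin n → ℝ), P (sample X n ⁻¹' A) ≤ stdSample n A := fun A => by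
    rw [← (hasLaw_sample hX hlaw n).map_eq]
    exact Measure.le_map_apply (hasLaw_sample hX hlaw n).aemeasurable A
  refine (measure_mono hsub).trans ((measure_union_le _ _).trans
    ((add_le_add ((measure_union_le _ _).trans (add_le_add k1 ((hmap _).trans k2)))
      ((hmap _).trans k3)).trans ?_))
  rw [← ENNReal.ofReal_add hε3.le hε3.le, ← ENNReal.ofReal_add (by positivity) hε3.le]
  exact ENNReal.ofReal_le_ofReal (by linarith)

end Sequence

/-! ### Consequences of the expansion -/

lemma tendsto_measure_zero_of_eventually_le {Ω : Type*} [MeasurableSpace Ω] {P : Measure Ω}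
    {A : ℕ → Set Ω} (h : ∀ ε > 0, ∀ᶠ n in atTop, P (A n) ≤ ENNReal.ofReal ε) :
    Tendsto (fun n => P (A n)) atTop (𝓝 0) := by
  rw [ENNReal.tendsto_nhds_zero]
  intro ε hε
  rcases eq_or_ne ε ∞ with rfl | htop
  · simp
  · have := h ε.toReal (ENNReal.toReal_pos hε.ne' htop)
    rwa [ENNReal.ofReal_toReal htop] at this

/-! ### Minima and minimizers at regular samples. -/

section Regular
variable {φ : ℝ} {v : ℝ≥0} {n : ℕ} {x : Fin n → ℝ} {U a δ α₀ K : ℝ}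

/-- The test labels put the minimizer below `log n + U`, where the lower bound applies, and its
profile constant is at least the minimal one. -/
lemma RegularAt.abs_minLabelEnergy_sub_le (hφ : 1 < φ) (hn : n ≠ 0) (ha : 0 < a)
    (hU : limitConst φ v + δ ≤ U) (h : RegularAt φ v U a δ (optFraction φ) K x) :
    |minLabelEnergy φ v x - (Real.log n + limitConst φ v - sampleXi x ^ 2 / 2)| ≤ δ := by
  obtain ⟨⟨m₀, hm₀, -, hE₀⟩, h2⟩ := h
  obtain ⟨m, hm, hE, hmin⟩ := exists_labelEnergy_min (φ := φ) (by linarith) v x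
  have hn' : (n : ℝ) ≠ 0 := by positivity
  have hup := (hmin m₀ hm₀).trans hE₀
  rw [profileConst_optFraction hφ] at hup
  obtain ⟨hα, -, hlow⟩ := h2 m hm ((∑ i, m i) / n) (by field_simp)
    (by rw [hE]; nlinarith [sq_nonneg (sampleXi x)])
  have := limitConst_le_profileConst hφ v
    (α := (∑ i, m i) / n) ⟨ha.trans_le hα.1, by linarith [hα.2]⟩
  rw [hE] at hlow
  rw [abs_le]
  constructor <;> linarith

/-- Marginals with energy above `log n + U` satisfy the lower bound trivially, since `U` is at least
the profile constant at `α₀`. -/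
lemma RegularAt.abs_freeEnergyAt_sub_le (hφ : 1 < φ) (hv : 0 < v) (hδ : 0 ≤ δ)
    (hα₀ : α₀ ∈ Set.Ioo (0 : ℝ) 1) (hU : profileConst φ v α₀ ≤ U)
    (h : RegularAt φ v U a δ α₀ K x) :
    |freeEnergyAt φ v x α₀ - nullFreeEnergy x -
      (Real.log n + profileConst φ v α₀ - sampleXi x ^ 2 / 2)| ≤ δ := by
  obtain ⟨⟨m₀, hm₀, hs₀, hE₀⟩, h2⟩ := h
  have hφ0 : 0 < φ := by linarith
  have hup := freeEnergyAt_le hφ0 hv hm₀ hs₀ (x := x)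
  have hlow := le_freeEnergyAt (x := x) hφ0 hv ⟨hα₀.1.le, hα₀.2.le⟩
    (c := Real.log n + profileConst φ v α₀ - sampleXi x ^ 2 / 2 - δ) fun m hm hs => by
      by_cases hE : labelEnergy φ v x m ≤ Real.log n + U
      · exact (h2 m hm α₀ hs hE).2.2
      · nlinarith [sq_nonneg (sampleXi x)]
  rw [abs_le]
  constructor <;> linarith

lemma RegularAt.isOptimal (hφ : 1 < φ) (hv : 0 < v) (hn : n ≠ 0)
    (hU : limitConst φ v + δ ≤ U) (h : RegularAt φ v U a δ (optFraction φ) K x)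
    {q : (Fin n → Fin 2) → ℝ} {r : ℝ × ℝ → ℝ} (hqr : IsOptimal φ v x q r) :
    expectedCount q / n ∈ Set.Icc a (1 - a) ∧ |meanB r| ≤ K / √n ∧
      profileConst φ v (expectedCount q / n) ≤ limitConst φ v + 2 * δ := by
  obtain ⟨⟨m₀, hm₀, -, hE₀⟩, h2⟩ := h
  have hφ0 : 0 < φ := by linarith
  obtain ⟨hm, hE, hB⟩ := hqr.spec hφ0 hv
  obtain ⟨-, -, -, hmin⟩ := exists_labelEnergy_min hφ0 v x
  have hn' : (n : ℝ) ≠ 0 := by positivity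
  have hup := (hmin m₀ hm₀).trans hE₀
  rw [profileConst_optFraction hφ] at hup
  rw [expectedCount_eq, hB]
  obtain ⟨hα, hβ, hlow⟩ := h2 _ hm ((∑ i, marginal q i) / n) (by field_simp)
    (by rw [hE]; nlinarith [sq_nonneg (sampleXi x)])
  exact ⟨hα, hβ, by linarith⟩

end Regular

/-! ### Limits in probability and in distribution. -/

section Sequence
variable {Ω : Type*} [MeasurableSpace Ω] {P : Measure Ω} [IsProbabilityMeasure P]
  {X : ℕ → Ω → ℝ} {φ : ℝ} {v : ℝ≥0}

lemma stat_eq {Ω : Type*} (hφ : 0 < φ) (hv : 0 < v) (X : ℕ → Ω → ℝ) (n : ℕ) (ω : Ω) :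
    stat φ v X n ω = minLabelEnergy φ v (sample X n ω) := by
  rw [stat, freeEnergy_eq hφ hv, add_sub_cancel_left]

lemma tendstoInMeasure_stat_sub (hX : iIndepFun X P)
    (hlaw : ∀ i, HasLaw (X i) (gaussianReal 0 1) P) (hφ : 1 < φ) (hv : 0 < v) :
    TendstoInMeasure P (fun n ω => stat φ v X n ω -
      (Real.log n + limitConst φ v - xi X n ω ^ 2 / 2)) atTop (fun _ => 0) := by
  refine tendstoInMeasure_iff_norm.2 fun δ hδ => tendsto_measure_zero_of_eventually_le
    fun ε hε => ?_
  obtain ⟨a, ha, h⟩ := exists_measure_not_regularAt_le hX hlaw hφ hv (limitConst φ v + 1) hε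
  -- Precision `δ / 2` contradicts a deviation of at least `δ`.
  obtain ⟨K, -, hK⟩ := h (min (δ / 2) 1) (by positivity) (min_le_right _ _) _ (optFraction_mem hφ)
  filter_upwards [hK, eventually_ge_atTop 1] with n hn hn1
  refine (measure_mono fun ω hω hreg => ?_).trans hn
  have := hreg.abs_minLabelEnergy_sub_le hφ (by omega) ha
    (add_le_add_right (min_le_right _ _) _)
  rw [Set.mem_ofPred_eq, sub_zero, Real.norm_eq_abs, stat_eq (by linarith) hv] at hω
  rw [sampleXi_sample] at this
  linarith [min_le_left (δ / 2) 1]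

lemma tendstoInMeasure_freeEnergyAt_sub (hX : iIndepFun X P)
    (hlaw : ∀ i, HasLaw (X i) (gaussianReal 0 1) P) (hφ : 1 < φ) (hv : 0 < v) {α : ℝ}
    (hα : α ∈ Set.Ioo (0 : ℝ) 1) :
    TendstoInMeasure P (fun n ω => freeEnergyAt φ v (sample X n ω) α
      - nullFreeEnergy (sample X n ω) -
      (Real.log n + profileConst φ v α - xi X n ω ^ 2 / 2)) atTop (fun _ => 0) := by
  refine tendstoInMeasure_iff_norm.2 fun δ hδ => tendsto_measure_zero_of_eventually_le
    fun ε hε => ?_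
  obtain ⟨a, ha, h⟩ := exists_measure_not_regularAt_le hX hlaw hφ hv (profileConst φ v α) hε
  obtain ⟨K, -, hK⟩ := h (min (δ / 2) 1) (by positivity) (min_le_right _ _) _ hα
  filter_upwards [hK] with n hn
  refine (measure_mono fun ω hω hreg => ?_).trans hn
  have := hreg.abs_freeEnergyAt_sub_le hφ hv (by positivity) hα le_rfl
  rw [Set.mem_ofPred_eq, sub_zero, Real.norm_eq_abs] at hω
  rw [sampleXi_sample] at this
  linarith [min_le_left (δ / 2) 1]

lemma tendsto_measure_fraction (hX : iIndepFun X P)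
    (hlaw : ∀ i, HasLaw (X i) (gaussianReal 0 1) P) (hφ : 1 < φ) (hv : 0 < v) {γ : ℝ}
    (hγ : 0 < γ) :
    Tendsto (fun n : ℕ => P {ω | ∃ q r, IsOptimal φ v (sample X n ω) q r ∧
      γ ≤ |expectedCount q / n - optFraction φ|}) atTop (𝓝 0) := by
  refine tendsto_measure_zero_of_eventually_le fun ε hε => ?_
  obtain ⟨a, ha, h⟩ := exists_measure_not_regularAt_le hX hlaw hφ hv (limitConst φ v + 1) hε
  obtain ⟨δ, hδ, hsep⟩ := exists_limitConst_add_le hφ v ha hγ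
  obtain ⟨K, -, hK⟩ := h (min (δ / 3) 1) (by positivity) (min_le_right _ _) _ (optFraction_mem hφ)
  filter_upwards [hK, eventually_ge_atTop 1] with n hn hn1
  refine (measure_mono ?_).trans hn
  rintro ω ⟨q, r, hqr, hd⟩ hreg
  obtain ⟨h1, -, h2⟩ := hreg.isOptimal hφ hv (by omega)
    (add_le_add_right (min_le_right _ _) _) hqr
  linarith [hsep _ h1 hd, min_le_left (δ / 3) 1]

lemma tendsto_measure_meanB (hX : iIndepFun X P)
    (hlaw : ∀ i, HasLaw (X i) (gaussianReal 0 1) P) (hφ : 1 < φ) (hv : 0 < v) {γ : ℝ}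
    (hγ : 0 < γ) :
    Tendsto (fun n : ℕ => P {ω | ∃ q r, IsOptimal φ v (sample X n ω) q r ∧
      γ ≤ √(Real.log n) * |meanB r|}) atTop (𝓝 0) := by
  refine tendsto_measure_zero_of_eventually_le fun ε hε => ?_
  obtain ⟨a, ha, h⟩ := exists_measure_not_regularAt_le hX hlaw hφ hv (limitConst φ v + 1) hε
  obtain ⟨K, hK0, hK⟩ := h 1 one_pos le_rfl _ (optFraction_mem hφ)
  have hlim : Tendsto (fun n : ℕ => K * (maxBound n / √n)) atTop (𝓝 0) := by
    simpa using tendsto_maxBound_div_sqrt.const_mul K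
  filter_upwards [hK, hlim.eventually_lt_const hγ, eventually_ge_atTop 1] with n hn hn2 hn1
  refine (measure_mono ?_).trans hn
  rintro ω ⟨q, r, hqr, hd⟩ hreg
  obtain ⟨-, h1, -⟩ := hreg.isOptimal hφ hv (by omega) le_rfl hqr
  have hlog := Real.log_nonneg (x := n) (by exact_mod_cast hn1)
  have h2 : √(Real.log n) ≤ maxBound n := Real.sqrt_le_sqrt (by linarith)
  have := maxBound_nonneg n
  have : √(Real.log n) * |meanB r| ≤ K * (maxBound n / √n) := by
    calc √(Real.log n) * |meanB r| ≤ maxBound n * (K / √n) := by gcongr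
      _ = _ := by ring
  linarith

lemma tendstoInDistribution_stat (hX : iIndepFun X P)
    (hlaw : ∀ i, HasLaw (X i) (gaussianReal 0 1) P) (hφ : 1 < φ) (hv : 0 < v) :
    TendstoInDistribution (fun (n : ℕ) ω => -2 * (stat φ v X n ω - Real.log n - limitConst φ v))
      atTop (fun z : ℝ => z ^ 2) (fun _ => P) (gaussianReal 0 1) := by
  have hxi : ∀ n, AEMeasurable (xi X n) P := fun n => by
    have : ∀ i, AEMeasurable (X i) P := fun i => (hlaw i).aemeasurable
    unfold xi; fun_prop
  refine tendstoInDistribution_of_tendstoInMeasure_sub (X := fun n ω => xi X n ω ^ 2) _ _ ?_ ?_ ?_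
  -- For `n ≥ 1` the law of `ξ_n ^ 2` is exactly the limit law, so the sequence of laws is
  -- eventually constant.
  · refine ⟨fun n => (hxi n).pow_const 2, by fun_prop, tendsto_const_nhds.congr' ?_⟩
    filter_upwards [eventually_ge_atTop 1] with n hn
    apply Subtype.ext
    change (gaussianReal 0 1).map (fun z : ℝ => z ^ 2) = P.map (fun ω => xi X n ω ^ 2)
    rw [← (hasLaw_xi hX hlaw hn).map_eq, AEMeasurable.map_map_of_aemeasurable (by fun_prop) (hxi n)]
    rfl
  · refine tendstoInMeasure_iff_norm.2 fun ε hε => ?_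
    have h := tendstoInMeasure_iff_norm.1 (tendstoInMeasure_stat_sub hX hlaw hφ hv) (ε / 2)
      (half_pos hε)
    refine h.congr fun n => ?_
    congr 1
    ext ω
    simp only [Set.mem_ofPred_eq, sub_zero, Pi.sub_apply, Pi.zero_apply, Real.norm_eq_abs]
    have e : -2 * (stat φ v X n ω - Real.log n - limitConst φ v) - xi X n ω ^ 2 =
        -2 * (stat φ v X n ω - (Real.log n + limitConst φ v - xi X n ω ^ 2 / 2)) := by ring
    rw [e, abs_mul, abs_neg, abs_two, div_le_iff₀' two_pos]
  · intro n
    have h1 : AEMeasurable (stat φ v X n) P := by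
      have := (continuous_minLabelEnergy (φ := φ) (by linarith) v n).measurable.comp_aemeasurable
        (hasLaw_sample hX hlaw n).aemeasurable
      refine this.congr (ae_of_all _ fun ω => (stat_eq (by linarith) hv X n ω).symm)
    fun_prop

end Sequence

end

end MixVB

/-- Under the null hypothesis (i.i.d. standard Gaussian observations) and for `φ > 1`; the prior
variance `σ²` of `b` is `v`. -/
theorem theorem3 {Ω : Type*} [MeasurableSpace Ω] (P : Measure Ω) [IsProbabilityMeasure P]
    (X : ℕ → Ω → ℝ) (hX : iIndepFun X P) (hlaw : ∀ i, HasLaw (X i) (gaussianReal 0 1) P)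
    (φ : ℝ) (hφ : 1 < φ) (v : ℝ≥0) (hv : 0 < v) :
    -- the standardized sum is exactly standard normal
    (∀ n : ℕ, 1 ≤ n → HasLaw (MixVB.xi X n) (gaussianReal 0 1) P) ∧
    -- expansion of the variational free energy up to `o(1)` in probability
    TendstoInMeasure P
      (fun n ω => MixVB.stat φ v X n ω -
        (Real.log n + MixVB.limitConst φ v - MixVB.xi X n ω ^ 2 / 2))
      atTop (fun _ => 0) ∧
    -- expansion of the free energy at a prescribed mixing fraction
    (∀ α ∈ Set.Ioo (0 : ℝ) 1, TendstoInMeasure P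
      (fun n ω => MixVB.freeEnergyAt φ v (MixVB.sample X n ω) α
        - MixVB.nullFreeEnergy (MixVB.sample X n ω) -
        (Real.log n + MixVB.profileConst φ v α - MixVB.xi X n ω ^ 2 / 2))
      atTop (fun _ => 0)) ∧
    -- the constant is minimized over the mixing fraction exactly at `α₀`
    (MixVB.optFraction φ ∈ Set.Ioo (0 : ℝ) 1 ∧
      MixVB.profileConst φ v (MixVB.optFraction φ) = MixVB.limitConst φ v ∧
      ∀ α ∈ Set.Ioo (0 : ℝ) 1, α ≠ MixVB.optFraction φ →
        MixVB.limitConst φ v < MixVB.profileConst φ v α) ∧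
    -- optimal factorized laws exist for every sample
    (∀ (n : ℕ) (x : Fin n → ℝ), ∃ q r, MixVB.IsOptimal φ v x q r) ∧
    -- their mixing fraction tends to `α₀`
    (∀ ε : ℝ, 0 < ε → Tendsto (fun n : ℕ => P {ω | ∃ q r,
      MixVB.IsOptimal φ v (MixVB.sample X n ω) q r ∧
        ε ≤ |MixVB.expectedCount q / n - MixVB.optFraction φ|}) atTop (𝓝 0)) ∧
    -- their mean `⟨b⟩` is `o(1/√(log n))`
    (∀ ε : ℝ, 0 < ε → Tendsto (fun n : ℕ => P {ω | ∃ q r,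
      MixVB.IsOptimal φ v (MixVB.sample X n ω) q r ∧
        ε ≤ Real.sqrt (Real.log n) * |MixVB.meanB r|}) atTop (𝓝 0)) ∧
    -- the null distribution: the law of the square of a standard normal variable
    TendstoInDistribution
      (fun (n : ℕ) ω => -2 * (MixVB.stat φ v X n ω - Real.log n - MixVB.limitConst φ v))
      atTop (fun z : ℝ => z ^ 2) (fun _ => P) (gaussianReal 0 1) := by
  refine ⟨fun n hn => MixVB.hasLaw_xi hX hlaw hn, MixVB.tendstoInMeasure_stat_sub hX hlaw hφ hv,
    fun α hα => MixVB.tendstoInMeasure_freeEnergyAt_sub hX hlaw hφ hv hα,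
    ⟨MixVB.optFraction_mem hφ, MixVB.profileConst_optFraction hφ v,
      fun α hα hne => MixVB.limitConst_lt_profileConst hφ v hα hne⟩,
    fun n x => MixVB.exists_isOptimal (by linarith) hv x,
    fun ε hε => MixVB.tendsto_measure_fraction hX hlaw hφ hv hε,
    fun ε hε => MixVB.tendsto_measure_meanB hX hlaw hφ hv hε,
    MixVB.tendstoInDistribution_stat hX hlaw hφ hv⟩
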